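/- \textbf{Definitions.} Let $k,d\ge 1$ be integers. A graph $G_0$ on the set $[k]^d$ of strings is a $(k,d)$-semi-hypercube if for every string $\sigma$ over $[k]$ of length $|\sigma|<d$ and all $i\ne i'$ in $[k]$, the edges of $G_0$ between the strings with prefix $\sigma+i$ and those with prefix $\sigma+i'$ form a perfect matching of these two sets. For $V\subseteq[k]^d$ and a string $\sigma$ of length at most $d$, let $V_\sigma$ (the cluster $\sigma$) be the set of $v\in V$ having $\sigma$ as a prefix; the cluster is $\tau$-critical if $0<|V_\sigma|<(1-\tau)k^{d-|\sigma|}$. For $\tau\in(0,1)$, an induced subgraph $G=G_0[V]=(V,E)$ of a $(k,d)$-semi-hypercube $G_0$ is a $(k,d,\tau)$-semi-hypercube if for every $\sigma$ of length less than $d$: (1) at most one child cluster $\sigma+t$, $t\in[k]$, is $\tau$-critical; (2) if $\sigma+t$ is $\tau$-critical, then $|E[V_{\sigma+t},V_\sigma\setminus V_{\sigma+t}]|\ge\frac{9}{10}\,k'\,|V_{\sigma+t}|$, where $k'$ is the number of nonempty child clusters of $\sigma$ that are not $\tau$-critical. An oblivious routing $R$ on $G$ is a family of probability distributions $R(s,t)$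 on the $(s,t)$-paths of $G$, $s,t\in V$. It has length $h$ if every path in the support of some $R(s,t)$ has at most $h$ edges. A demand $D:V\times V\to\mathbb{R}_{\ge0}$ is unit if $\sum_{u}(D(u,v)+D(v,u))\le\deg_G(v)$ for all $v\in V$. The congestion of routing $D$ by $R$ is $\max_{e\in E}\sum_{s,t}D(s,t)\,\Pr_{p\sim R(s,t)}[e\in p]$. \textbf{Theorem.} There are an absolute constant $C$ and a single randomized word-RAM program $P$ such that the following holds. Let $G=(V,E)$ be a $(k,d,\tau)$-semi-hypercube with $\tau\le\frac1{27d}$ and $k\ge27\cdot2^d$. Then there is an oblivious routing $R$ on $G$ such that (a) $R$ has length at most $C d^3$; (b) $R$ routes every unit demand with congestion at most $C\cdot kd\cdot10^d$; (c) paths of $R$ can be sampled in expected time at most $C d^3$: for every numbering of $V$ by $0,\dots,|V|-1$ there is a stored data structure of at most $C\cdot kd\,|V|$ words, for word length $O(\log(kd\,|V|))$ bits, with access to which $P$, given any $s,t\in V$, outputs the vertex sequence of a path distributed exactly as $R(s,t)$, after an expected number of at most $C d^3$ steps. (Steps are elementary register, arithmetic, memory, comparison and output operations on words, and draws of a uniformly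 random integer from $\{0,\dots,x\}$ for a given word $x$.) -/

import Mathlib

open scoped ENNReal NNReal

/-! ## Semi-hypercubes -/

namespace SemiHypercube

/-- A graph on the strings `[k]^d` is a `(k, d)`-semi-hypercube if for every string `σ` of length
less than `d` and all `i ≠ i'`, the edges between the clusters `σ + i` and `σ + i'` form a perfect
matching of these clusters: each vertex of either one has exactly one neighbour in the other. -/
def IsFull (k d : ℕ) (G : SimpleGraph (Fin d → Fin k)) : Prop :=
  0 < k ∧ 0 < d ∧
    ∀ σ : List (Fin k), σ.length < d → ∀ i i' : Fin k, i ≠ i' →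
      ∀ u : Fin d → Fin k, (σ ++ [i]) <+: List.ofFn u →
        ∃! v : Fin d → Fin k, (σ ++ [i']) <+: List.ofFn v ∧ G.Adj u v

variable {k d : ℕ}

/-- The cluster `V_σ`: the vertices of `V` that have the string `σ` as a prefix. -/
def cluster (V : Finset (Fin d → Fin k)) (σ : List (Fin k)) : Finset V :=
  Finset.univ.filter fun v => σ <+: List.ofFn v.1

/-- The cluster `V_σ` is `τ`-critical: `0 < |V_σ| < (1 - τ) k ^ (d - |σ|)`. -/
def IsCritical (τ : ℝ) (V : Finset (Fin d → Fin k)) (σ : List (Fin k)) : Prop :=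
  0 < (cluster V σ).card ∧ ((cluster V σ).card : ℝ) < (1 - τ) * (k : ℝ) ^ (d - σ.length)

open scoped Classical in
/-- `numSolid τ V σ` is the number of nonempty, non-`τ`-critical child clusters of `σ`. -/
noncomputable def numSolid (τ : ℝ) (V : Finset (Fin d → Fin k)) (σ : List (Fin k)) : ℕ :=
  (Finset.univ.filter fun i : Fin k =>
    (cluster V (σ ++ [i])).Nonempty ∧ ¬ IsCritical τ V (σ ++ [i])).card

open scoped Classical in
/-- `(k, d, τ)`-semi-hypercubes with vertex set `V ⊆ [k]^d`. In `critical_degree`, the left-hand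
side counts the edges between the critical child `V_{σ+t}` and `V_σ \ V_{σ+t}`. -/
structure IsSemiHypercube (τ : ℝ) (V : Finset (Fin d → Fin k)) (G : SimpleGraph V) : Prop where
  tau_pos : 0 < τ
  tau_lt_one : τ < 1
  /-- `G` is the subgraph induced on `V` by a `(k, d)`-semi-hypercube. -/
  induced : ∃ G₀ : SimpleGraph (Fin d → Fin k), IsFull k d G₀ ∧ G = G₀.comap Subtype.val
  /-- Every cluster has at most one critical child cluster. -/
  critical_unique : ∀ σ : List (Fin k), σ.length < d → ∀ i j : Fin k,
    IsCritical τ V (σ ++ [i]) → IsCritical τ V (σ ++ [j]) → i = j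
  /-- The critical child has average degree at least `9/10` of the number of the nonempty
  noncritical children. -/
  critical_degree : ∀ σ : List (Fin k), σ.length < d → ∀ t : Fin k,
    IsCritical τ V (σ ++ [t]) →
      ((G.interedges (cluster V (σ ++ [t])) (cluster V σ \ cluster V (σ ++ [t]))).card : ℝ) ≥
        9 / 10 * (numSolid τ V σ : ℝ) * ((cluster V (σ ++ [t])).card : ℝ)

end SemiHypercube

/-! ## Demands and oblivious routings -/

namespace Routing

variable {W : Type*} [Fintype W]

/-- The load of a demand at a vertex. -/
noncomputable def load (D : W → W → ℝ≥0) (v : W) : ℝ≥0 := ∑ u, (D u v + D v u)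

open scoped Classical in
/-- A demand is unit, i.e. degree-respecting, if its load at each vertex is at most the degree. -/
def IsUnitDemand (G : SimpleGraph W) (D : W → W → ℝ≥0) : Prop :=
  ∀ v, load D v ≤ (G.degree v : ℝ≥0)

/-- An oblivious routing: for all `s`, `t` a probability distribution on the `(s, t)`-paths
(without repeated vertices) of `G`. -/
abbrev Oblivious (G : SimpleGraph W) : Type _ := ∀ s t : W, PMF (G.Path s t)

/-- Every path in the support of `R` has at most `h` edges. -/
def HasLength {G : SimpleGraph W} (R : Oblivious G) (h : ℕ) : Prop :=
  ∀ s t : W, ∀ p ∈ (R s t).support, (p : G.Walk s t).length ≤ h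

/-- The expected amount of flow over `e` when each `D s t` is routed along a path drawn
from `R s t`. -/
noncomputable def edgeCongestion {G : SimpleGraph W} (R : Oblivious G) (D : W → W → ℝ≥0)
    (e : Sym2 W) : ℝ≥0∞ :=
  ∑ s, ∑ t, (D s t : ℝ≥0∞) *
    (R s t).toOuterMeasure {p : G.Path s t | e ∈ (p : G.Walk s t).edges}

/-- The congestion of routing `D` by `R`: the maximum over the edges. -/
noncomputable def congestion {G : SimpleGraph W} (R : Oblivious G) (D : W → W → ℝ≥0) : ℝ≥0∞ :=
  ⨆ e ∈ G.edgeSet, edgeCongestion R D e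

end Routing

/-! ## A randomized word RAM

Programs are structured; each executed instruction and each evaluated test costs one step. There
are finitely many registers in use in a program, and a random-access memory addressed by words.
Registers and memory cells hold words, i.e. numbers below `2 ^ w`, where `w` is the word length. -/

namespace WordRAM

/-- The arithmetic operations on words. -/
inductive BinOp
  | add
  | sub
  | mul
  | div

/-- Arithmetic on words of length `w` (subtraction is truncated at `0`, `x / 0 = 0`). -/
def BinOp.eval (w : ℕ) : BinOp → ℕ → ℕ → ℕ
  | .add, x, y => (x + y) % 2 ^ w
  | .sub, x, y => x - y
  | .mul, x, y => (x * y) % 2 ^ w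
  | .div, x, y => x / y

/-- Programs. Natural-number arguments are register names, except for the second argument of
`const`, which is a literal. -/
inductive Prog
  /-- no operation -/
  | skip
  /-- `const r c`: put the literal `c` into register `r` -/
  | const (r c : ℕ)
  /-- `bin op r a b`: put the result of `op` on registers `a`, `b` into register `r` -/
  | bin (op : BinOp) (r a b : ℕ)
  /-- `load r a`: read into `r` the memory cell whose address is in `a` -/
  | load (r a : ℕ)
  /-- `store a b`: write register `b` to the memory cell whose address is in `a` -/
  | store (a b : ℕ)
  /-- `rand r a`: put into `r` a fresh uniformly random element of `{0, …, x}`, `x` the content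
  of register `a` -/
  | rand (r a : ℕ)
  /-- `out a`: append the content of register `a` to the output -/
  | out (a : ℕ)
  /-- sequential composition -/
  | seq (p q : Prog)
  /-- `ite a b p q`: run `p` if register `a` is less than register `b`, and `q` otherwise -/
  | ite (a b : ℕ) (p q : Prog)
  /-- `loop a b p`: run `p` again and again, while register `a` is less than register `b` -/
  | loop (a b : ℕ) (p : Prog)

/-- A configuration: what remains to be executed, registers, memory and the output so far. -/
structure Config where
  todo : List Prog
  reg : ℕ → ℕ
  mem : ℕ → ℕ
  output : List ℕ

/-- One step of the machine with word length `w`. The machine has halted when `todo = []`. -/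
noncomputable def step (w : ℕ) (c : Config) : PMF Config :=
  match c.todo with
  | [] => PMF.pure c
  | .skip :: K => PMF.pure { c with todo := K }
  | .const r x :: K =>
      PMF.pure { c with todo := K, reg := Function.update c.reg r (x % 2 ^ w) }
  | .bin op r a b :: K =>
      PMF.pure { c with
        todo := K, reg := Function.update c.reg r (op.eval w (c.reg a) (c.reg b)) }
  | .load r a :: K =>
      PMF.pure { c with todo := K, reg := Function.update c.reg r (c.mem (c.reg a)) }
  | .store a b :: K =>
      PMF.pure { c with todo := K, mem := Function.update c.mem (c.reg a) (c.reg b) }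
  | .rand r a :: K =>
      (PMF.uniformOfFinset (Finset.range (c.reg a + 1)) Finset.nonempty_range_add_one).map
        fun x => { c with todo := K, reg := Function.update c.reg r x }
  | .out a :: K => PMF.pure { c with todo := K, output := c.output ++ [c.reg a] }
  | .seq p q :: K => PMF.pure { c with todo := p :: q :: K }
  | .ite a b p q :: K =>
      PMF.pure { c with todo := (if c.reg a < c.reg b then p else q) :: K }
  | .loop a b p :: K =>
      PMF.pure { c with todo := if c.reg a < c.reg b then p :: .loop a b p :: K else K }

/-- The distribution of the configuration after `n` steps. -/
noncomputable def run (w : ℕ) : ℕ → Config → PMF Config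
  | 0, c => PMF.pure c
  | n + 1, c => (step w c).bind (run w n)

/-- The expected number `∑ n, P[T > n]` of steps `T` until the machine halts, started in `c`. -/
noncomputable def expectedTime (w : ℕ) (c : Config) : ℝ≥0∞ :=
  ∑' n : ℕ, (run w n c).toOuterMeasure {c' | c'.todo ≠ []}

/-- The probability that the machine, started in `c`, halts with output exactly `l`
(the events "halted within `n` steps with output `l`" increase with `n`). -/
noncomputable def outputProb (w : ℕ) (c : Config) (l : List ℕ) : ℝ≥0∞ :=
  ⨆ n : ℕ, (run w n c).toOuterMeasure {c' | c'.todo = [] ∧ c'.output = l}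

/-- The initial configuration of a query `(x, y)`: the memory holds the stored data structure
`data` in the cells `0, …, data.length - 1`, the registers `0` and `1` hold `x` and `y`, and all
other cells and registers are `0`. -/
def init (P : Prog) (data : List ℕ) (x y : ℕ) : Config where
  todo := [P]
  reg := fun r => if r = 0 then x else if r = 1 then y else 0
  mem := fun a => data.getD a 0
  output := []

/-- With word length `w`, the program `P` samples from the oblivious routing `R` in expected time
at most `T`, using the stored data structure `data`. Vertices are represented by their numbers
under `num`; on the query `(s, t)`, the list of the vertices of a random path is output, and the
path is distributed exactly as `R s t`. -/
def Samples {W : Type*} [Fintype W] {G : SimpleGraph W} (P : Prog) (w : ℕ) (data : List ℕ)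
    (num : W ≃ Fin (Fintype.card W)) (R : Routing.Oblivious G) (T : ℝ≥0∞) : Prop :=
  ∀ s t : W,
    (∀ p : G.Path s t,
      outputProb w (init P data (num s) (num t))
        ((p : G.Walk s t).support.map fun v => (num v : ℕ)) = R s t p) ∧
    expectedTime w (init P data (num s) (num t)) ≤ T

end WordRAM

/-! Changing one digit of a vertex (`nb`) follows an edge of a matching, which may permute all later
digits arbitrarily. What can be controlled is injectivity: once the old digit is known, a move can
be undone (`Cube.nb_injective`). Walks therefore randomize the digits from the last one upwards. As
long as the clusters passed are not critical, the position after n moves has point masses at most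
k^(-n), and each move hits a missing vertex with probability at most τ.

If no cluster of v below the top is critical (v is final), this reaches the level of all of V; then
the digits of a target r are set from the top downwards, and the walk ends in r. Otherwise the
randomization stops at the deepest critical cluster (`base`), and a hop along a random edge leaves
it for a solid, i.e. nonempty noncritical, child of the nearest proper ancestor having one
(`hopLevel`). The degree condition provides most of these edges. Few vertices lie on many critical
levels (`Cube.card_manyCrit_mul_le`), so hops to vertices on more than `base - hopLevel` critical
levels can be rejected. A successful trial then lowers the rank, the sum of the dimensions of the
critical clusters of the position (`Cube.rank_lt`), and the rank is at most d². Trials succeed with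
probability at least 1/2 (`Cube.efficient`) and are repeated until they do. A route from s to t
walks from both sides to a random final vertex r and has its loops erased; this gives length O(d³).

For the congestion, let C_l be the critical child of the prefix of length l of a fixed vertex, and
X_l the expected number of hops out of C_l when every vertex starts at most K walks. A walk in C_l
stays there until it hops on level l, and it enters C_l only by a hop from some C_l' with l' < l,
with probability at most 4|C_l|/|C_l'|. Hence X_l ≤ K|C_l| + ∑_{l' < l} 4 (|C_l|/|C_l'|) X_l', so
that X_l ≤ K 5^l |C_l| (`Cube.sum_visits_site_le`), and at most K 5^d successful trials are expected
from each vertex. One successful trial from every vertex makes at most 14d visits to a fixed vertex,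
on average over r (`Cube.sum_trial_occ_le`). With K = kd this bounds the congestion by O(kd · d ·
5^d), and d · 5^d ≤ 10^d.

The program only looks up tables: each vertex has a record with its lists of choices and the results
of all moves. Its analysis (`Spec`) carries lower bounds on output probabilities and upper bounds on
truncated expected times. Repeated trials are treated by `spec_reject`, and lower bounds of total
mass 1 are exact (`outputProb_eq_of_spec`). -/

/-! ## Expectations over discrete distributions -/

namespace PMF

/-- The expectation of a nonnegative function. -/
noncomputable def expect {α : Type*} (p : PMF α) (φ : α → ℝ≥0∞) : ℝ≥0∞ := ∑' a, p a * φ a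

variable {α β : Type*}

theorem expect_pure (a : α) (φ : α → ℝ≥0∞) : (PMF.pure a).expect φ = φ a := by
  classical
  unfold expect
  rw [tsum_eq_single a]
  · simp
  · intro b hb
    simp [PMF.pure_apply, hb]

theorem expect_bind (p : PMF α) (f : α → PMF β) (φ : β → ℝ≥0∞) :
    (p.bind f).expect φ = p.expect fun a => (f a).expect φ := by
  unfold expect
  simp_rw [PMF.bind_apply, ← ENNReal.tsum_mul_right]
  rw [ENNReal.tsum_comm]
  simp_rw [mul_assoc, ENNReal.tsum_mul_left]

theorem expect_map (p : PMF α) (f : α → β) (φ : β → ℝ≥0∞) :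
    (p.map f).expect φ = p.expect fun a => φ (f a) := by
  rw [← PMF.bind_pure_comp, expect_bind]
  simp [expect_pure]

theorem expect_mono {p : PMF α} {φ ψ : α → ℝ≥0∞} (h : ∀ a ∈ p.support, φ a ≤ ψ a) :
    p.expect φ ≤ p.expect ψ := by
  refine ENNReal.tsum_le_tsum fun a => ?_
  by_cases ha : a ∈ p.support
  · exact mul_le_mul_right (h a ha) _
  · simp [(p.apply_eq_zero_iff a).2 ha]

theorem expect_congr {p : PMF α} {φ ψ : α → ℝ≥0∞} (h : ∀ a ∈ p.support, φ a = ψ a) :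
    p.expect φ = p.expect ψ :=
  le_antisymm (expect_mono fun a ha => (h a ha).le) (expect_mono fun a ha => (h a ha).ge)

theorem expect_const (p : PMF α) (c : ℝ≥0∞) : p.expect (fun _ => c) = c := by
  simp [expect, ENNReal.tsum_mul_right, p.tsum_coe]

theorem expect_le {p : PMF α} {φ : α → ℝ≥0∞} {c : ℝ≥0∞} (h : ∀ a ∈ p.support, φ a ≤ c) :
    p.expect φ ≤ c :=
  (expect_mono h).trans (expect_const p c).le

theorem expect_add (p : PMF α) (φ ψ : α → ℝ≥0∞) :
    p.expect (fun a => φ a + ψ a) = p.expect φ + p.expect ψ := by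
  simp [expect, mul_add, ENNReal.tsum_add]

theorem expect_mul_left (p : PMF α) (c : ℝ≥0∞) (φ : α → ℝ≥0∞) :
    p.expect (fun a => c * φ a) = c * p.expect φ := by
  simp only [expect, ← ENNReal.tsum_mul_left]
  exact tsum_congr fun a => by ring

theorem expect_mul_right (p : PMF α) (c : ℝ≥0∞) (φ : α → ℝ≥0∞) :
    p.expect (fun a => φ a * c) = p.expect φ * c := by
  simp only [expect, ← ENNReal.tsum_mul_right]
  exact tsum_congr fun a => by ring

theorem expect_finsetSum {ι : Type*} (s : Finset ι) (p : PMF α) (φ : ι → α → ℝ≥0∞) :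
    p.expect (fun a => ∑ i ∈ s, φ i a) = ∑ i ∈ s, p.expect (φ i) := by
  classical
  induction s using Finset.induction_on with
  | empty => simp [expect]
  | insert i s hi ih => simp only [Finset.sum_insert hi, expect_add, ih]

theorem expect_iSup (p : PMF α) (φ : ℕ → α → ℝ≥0∞) (h : Monotone φ) :
    p.expect (fun a => ⨆ n, φ n a) = ⨆ n, p.expect (φ n) := by
  apply le_antisymm
  · unfold expect
    rw [ENNReal.tsum_eq_iSup_sum]
    refine iSup_le fun s => ?_
    simp_rw [ENNReal.mul_iSup]
    rw [ENNReal.finsetSum_iSup_of_monotone]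
    · exact iSup_mono fun n => ENNReal.sum_le_tsum s
    · intro a m n hmn
      exact mul_le_mul_right (h hmn a) _
  · exact iSup_le fun n => expect_mono fun a _ => le_iSup (fun n => φ n a) n

theorem toOuterMeasure_eq_expect (p : PMF α) (s : Set α) :
    p.toOuterMeasure s = p.expect (s.indicator fun _ => 1) := by
  rw [PMF.toOuterMeasure_apply]
  refine tsum_congr fun a => ?_
  by_cases ha : a ∈ s <;> simp [ha]

theorem toOuterMeasure_bind (p : PMF α) (f : α → PMF β) (s : Set β) :
    (p.bind f).toOuterMeasure s = p.expect fun a => (f a).toOuterMeasure s :=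
  PMF.toOuterMeasure_bind_apply p f s

theorem toOuterMeasure_le_one (p : PMF α) (s : Set α) : p.toOuterMeasure s ≤ 1 := by
  rw [toOuterMeasure_eq_expect]
  exact expect_le fun a _ => Set.indicator_le_self' (by simp) a |>.trans le_rfl

theorem apply_eq_expect [DecidableEq α] (p : PMF α) (a : α) :
    p a = p.expect fun b => if b = a then 1 else 0 := by
  unfold expect
  rw [tsum_eq_single a] <;> simp +contextual

end PMF

/-! ## A program logic for the randomized word RAM -/

namespace WordRAM

variable {w : ℕ}

theorem outputProb_mono_aux (w : ℕ) (l : List ℕ) :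
    Monotone fun n c => (run w n c).toOuterMeasure {c' | c'.todo = [] ∧ c'.output = l} := by
  refine monotone_nat_of_le_succ fun n => ?_
  induction n with
  | zero =>
    intro c
    simp only [run, PMF.toOuterMeasure_bind]
    by_cases hc : c.todo = []
    · simp [step, hc, PMF.expect_pure]
    · simp [hc]
  | succ n ih =>
    intro c
    change ((step w c).bind (run w n)).toOuterMeasure _ ≤
      ((step w c).bind (run w (n + 1))).toOuterMeasure _
    rw [PMF.toOuterMeasure_bind, PMF.toOuterMeasure_bind]
    exact PMF.expect_mono fun c' _ => ih c'

/-- One inequality suffices: the program logic only propagates lower bounds, and these become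
equalities at the very end. -/
theorem expect_outputProb_le (c : Config) (l : List ℕ) :
    (step w c).expect (fun c' => outputProb w c' l) ≤ outputProb w c l := by
  unfold outputProb
  rw [PMF.expect_iSup _ _ (outputProb_mono_aux w l)]
  refine iSup_le fun n => ?_
  rw [← PMF.toOuterMeasure_bind]
  exact le_iSup (fun n => (run w n c).toOuterMeasure {c' | c'.todo = [] ∧ c'.output = l}) (n + 1)

/-- For a fixed number of steps, different outputs are disjoint events; monotonicity allows passing
to the limit. -/
theorem tsum_outputProb_le_one (c : Config) : ∑' l, outputProb w c l ≤ 1 := by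
  rw [ENNReal.tsum_eq_iSup_sum]
  refine iSup_le fun s => ?_
  unfold outputProb
  rw [ENNReal.finsetSum_iSup_of_monotone fun l m n h => outputProb_mono_aux w l h c]
  refine iSup_le fun n => ?_
  simp_rw [PMF.toOuterMeasure_eq_expect, ← PMF.expect_finsetSum]
  refine PMF.expect_le fun c' _ => ?_
  simp only [Set.indicator_apply, Set.mem_ofPred_eq]
  by_cases hc : c'.todo = []
  · simp only [hc, true_and, Finset.sum_ite_eq]
    split_ifs <;> simp
  · simp [hc]

/-- The expected number of steps among the first `N`. -/
noncomputable def timeUpTo (w N : ℕ) (c : Config) : ℝ≥0∞ :=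
  ∑ n ∈ Finset.range N, (run w n c).toOuterMeasure {c' | c'.todo ≠ []}

theorem expectedTime_eq_iSup (w : ℕ) (c : Config) :
    expectedTime w c = ⨆ N, timeUpTo w N c :=
  ENNReal.tsum_eq_iSup_nat

/-- This finiteness is the purpose of the truncation: it permits the cancellation in `spec_reject`.
-/
theorem timeUpTo_le (w N : ℕ) (c : Config) : timeUpTo w N c ≤ N := by
  refine (Finset.sum_le_card_nsmul _ _ 1 fun n _ => PMF.toOuterMeasure_le_one _ _).trans ?_
  simp

/-- Keeping N on the right, although N - 1 would do, lets all rules of the program logic share the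
same N. -/
theorem timeUpTo_le_step (w N : ℕ) (c : Config) :
    timeUpTo w N c ≤ 1 + (step w c).expect (timeUpTo w N) := by
  have h : timeUpTo w (N + 1) c ≤ 1 + (step w c).expect (timeUpTo w N) := by
    unfold timeUpTo
    rw [Finset.sum_range_succ', add_comm, PMF.expect_finsetSum]
    refine add_le_add (PMF.toOuterMeasure_le_one _ _) (Finset.sum_le_sum fun n _ => ?_)
    rw [run, PMF.toOuterMeasure_bind]
  refine le_trans ?_ h
  exact Finset.sum_le_sum_of_subset (Finset.range_mono (Nat.le_succ N))

theorem timeUpTo_halted (w N : ℕ) (c : Config) (hc : c.todo = []) : timeUpTo w N c = 0 := by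
  have h : ∀ n, run w n c = PMF.pure c := by
    intro n
    induction n with
    | zero => rfl
    | succ n ih => simp [run, step, hc, ih]
  simp [timeUpTo, h, hc]

/-- Started in `c`, the machine outputs each `l` with probability at least `ν l`, and among the
first `N` steps it makes at most `T + n` in expectation. -/
def Spec (w N n : ℕ) (c : Config) (ν : List ℕ → ℝ≥0∞) (T : ℝ≥0∞) : Prop :=
  (∀ l, ν l ≤ outputProb w c l) ∧ timeUpTo w N c ≤ T + n

variable {N n : ℕ} {ν : List ℕ → ℝ≥0∞} {T : ℝ≥0∞} {K : List Prog} {reg mem : ℕ → ℕ} {o : List ℕ}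

theorem Spec.weaken {c : Config} {n' : ℕ} {ν' : List ℕ → ℝ≥0∞} {T' : ℝ≥0∞}
    (h : Spec w N n c ν T) (hν : ∀ l, ν' l ≤ ν l) (hT : T + n ≤ T' + n') :
    Spec w N n' c ν' T' :=
  ⟨fun l => (hν l).trans (h.1 l), h.2.trans hT⟩

theorem Spec.fuel {c : Config} {n' : ℕ} (h : Spec w N n c ν T) (hn : n ≤ n') :
    Spec w N n' c ν T :=
  h.weaken (fun _ => le_rfl) (by gcongr)

theorem Spec.of_step {c c' : Config} (hs : step w c = PMF.pure c') (h : Spec w N n c' ν T) :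
    Spec w N (n + 1) c ν T := by
  constructor
  · intro l
    refine (h.1 l).trans ?_
    have := expect_outputProb_le (w := w) c l
    rwa [hs, PMF.expect_pure] at this
  · refine (timeUpTo_le_step w N c).trans ?_
    rw [hs, PMF.expect_pure]
    refine (add_le_add_right h.2 1).trans (le_of_eq ?_)
    push_cast
    ring

theorem spec_halt (w N n : ℕ) (reg mem : ℕ → ℕ) (o : List ℕ) (T : ℝ≥0∞) :
    Spec w N n ⟨[], reg, mem, o⟩ (fun l => if l = o then 1 else 0) T := by
  constructor
  · intro l
    beta_reduce
    split_ifs with h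
    · refine le_trans ?_ (le_iSup _ 0)
      simp [run, h]
    · exact zero_le
  · rw [timeUpTo_halted _ _ _ rfl]
    exact zero_le

theorem spec_skip (h : Spec w N n ⟨K, reg, mem, o⟩ ν T) :
    Spec w N (n + 1) ⟨.skip :: K, reg, mem, o⟩ ν T := .of_step rfl h

theorem spec_const {r x : ℕ}
    (h : Spec w N n ⟨K, Function.update reg r (x % 2 ^ w), mem, o⟩ ν T) :
    Spec w N (n + 1) ⟨.const r x :: K, reg, mem, o⟩ ν T := .of_step rfl h

theorem spec_bin {op : BinOp} {r a b : ℕ}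
    (h : Spec w N n ⟨K, Function.update reg r (op.eval w (reg a) (reg b)), mem, o⟩ ν T) :
    Spec w N (n + 1) ⟨.bin op r a b :: K, reg, mem, o⟩ ν T := .of_step rfl h

theorem spec_load {r a : ℕ}
    (h : Spec w N n ⟨K, Function.update reg r (mem (reg a)), mem, o⟩ ν T) :
    Spec w N (n + 1) ⟨.load r a :: K, reg, mem, o⟩ ν T := .of_step rfl h

theorem spec_store {a b : ℕ}
    (h : Spec w N n ⟨K, reg, Function.update mem (reg a) (reg b), o⟩ ν T) :
    Spec w N (n + 1) ⟨.store a b :: K, reg, mem, o⟩ ν T := .of_step rfl h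

theorem spec_out {a : ℕ} (h : Spec w N n ⟨K, reg, mem, o ++ [reg a]⟩ ν T) :
    Spec w N (n + 1) ⟨.out a :: K, reg, mem, o⟩ ν T := .of_step rfl h

theorem spec_seq {p q : Prog} (h : Spec w N n ⟨p :: q :: K, reg, mem, o⟩ ν T) :
    Spec w N (n + 1) ⟨.seq p q :: K, reg, mem, o⟩ ν T := .of_step rfl h

theorem spec_ite_pos {a b : ℕ} {p q : Prog} (hab : reg a < reg b)
    (h : Spec w N n ⟨p :: K, reg, mem, o⟩ ν T) :
    Spec w N (n + 1) ⟨.ite a b p q :: K, reg, mem, o⟩ ν T :=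
  .of_step (by simp [step, hab]) h

theorem spec_ite_neg {a b : ℕ} {p q : Prog} (hab : ¬ reg a < reg b)
    (h : Spec w N n ⟨q :: K, reg, mem, o⟩ ν T) :
    Spec w N (n + 1) ⟨.ite a b p q :: K, reg, mem, o⟩ ν T :=
  .of_step (by simp [step, hab]) h

theorem spec_loop_pos {a b : ℕ} {p : Prog} (hab : reg a < reg b)
    (h : Spec w N n ⟨p :: .loop a b p :: K, reg, mem, o⟩ ν T) :
    Spec w N (n + 1) ⟨.loop a b p :: K, reg, mem, o⟩ ν T :=
  .of_step (by simp [step, hab]) h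

theorem spec_loop_neg {a b : ℕ} {p : Prog} (hab : ¬ reg a < reg b)
    (h : Spec w N n ⟨K, reg, mem, o⟩ ν T) :
    Spec w N (n + 1) ⟨.loop a b p :: K, reg, mem, o⟩ ν T :=
  .of_step (by simp [step, hab]) h

/-- The uniform distribution on `{0, …, x}`. -/
noncomputable def unif (x : ℕ) : PMF ℕ :=
  PMF.uniformOfFinset (Finset.range (x + 1)) Finset.nonempty_range_add_one

theorem mem_support_unif {x y : ℕ} : y ∈ (unif x).support ↔ y ≤ x := by
  simp [unif]

theorem spec_rand {r a : ℕ} {ν : ℕ → List ℕ → ℝ≥0∞} {T : ℕ → ℝ≥0∞}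
    (h : ∀ x ≤ reg a, Spec w N n ⟨K, Function.update reg r x, mem, o⟩ (ν x) (T x)) :
    Spec w N (n + 1) ⟨.rand r a :: K, reg, mem, o⟩
      (fun l => (unif (reg a)).expect fun x => ν x l) ((unif (reg a)).expect T) := by
  have hs : step w ⟨.rand r a :: K, reg, mem, o⟩ =
      (unif (reg a)).map fun x => ⟨K, Function.update reg r x, mem, o⟩ := rfl
  constructor
  · intro l
    refine le_trans ?_ (expect_outputProb_le _ l)
    rw [hs, PMF.expect_map]
    exact PMF.expect_mono fun x hx => (h x (mem_support_unif.1 hx)).1 l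
  · refine (timeUpTo_le_step w N _).trans ?_
    rw [hs, PMF.expect_map]
    have : (unif (reg a)).expect (fun x => timeUpTo w N ⟨K, Function.update reg r x, mem, o⟩) ≤
        (unif (reg a)).expect T + n := by
      rw [← PMF.expect_const (unif (reg a)) (n : ℝ≥0∞), ← PMF.expect_add]
      exact PMF.expect_mono fun x hx => (h x (mem_support_unif.1 hx)).2
    refine (add_le_add_right this 1).trans (le_of_eq ?_)
    push_cast
    ring

theorem _root_.PMF.expect_split {α : Type*} (p : PMF α) (s : Set α) [DecidablePred (· ∈ s)]
    (φ : α → ℝ≥0∞) (c : ℝ≥0∞) :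
    p.expect (fun a => if a ∈ s then φ a else c) =
      p.expect (s.indicator φ) + p.toOuterMeasure sᶜ * c := by
  rw [PMF.toOuterMeasure_eq_expect, ← PMF.expect_mul_right, ← PMF.expect_add]
  refine PMF.expect_congr fun a _ => ?_
  by_cases h : a ∈ s <;> simp [h]

theorem _root_.PMF.toOuterMeasure_add_compl {α : Type*} (p : PMF α) (s : Set α) :
    p.toOuterMeasure s + p.toOuterMeasure sᶜ = 1 := by
  rw [PMF.toOuterMeasure_eq_expect, PMF.toOuterMeasure_eq_expect, ← PMF.expect_add]
  refine Eq.trans ?_ (PMF.expect_const p 1)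
  refine PMF.expect_congr fun a _ => ?_
  by_cases h : a ∈ s <;> simp [h]

theorem _root_.PMF.expect_filter {α : Type*} (p : PMF α) (s : Set α) (h : ∃ a ∈ s, a ∈ p.support)
    (φ : α → ℝ≥0∞) :
    (p.filter s h).expect φ = (p.toOuterMeasure s)⁻¹ * p.expect (s.indicator φ) := by
  unfold PMF.expect
  rw [← ENNReal.tsum_mul_left]
  refine tsum_congr fun a => ?_
  rw [PMF.filter_apply, PMF.toOuterMeasure_apply]
  by_cases ha : a ∈ s
  · simp only [ha, Set.indicator_of_mem]
    ring
  · simp [ha]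

/-- Rejection sampling: from every configuration in `Rep`, one trial with outcome distribution `τ`
is made; it leads to an outcome in `s`, after which the output distribution is at least `ν o`, or
back into `Rep`. -/
theorem spec_reject {O : Type*} (Rep : Config → Prop) (τ : PMF O) (s : Set O)
    (hs : ∃ a ∈ s, a ∈ τ.support) (hp : 2⁻¹ ≤ τ.toOuterMeasure s)
    (ν : O → List ℕ → ℝ≥0∞) (T₀ : ℝ≥0∞)
    (h : ∀ (ν' : List ℕ → ℝ≥0∞) (T' : ℝ≥0∞), (∀ c, Rep c → Spec w N 0 c ν' T') →
      ∀ (φ : O → List ℕ → ℝ≥0∞) (t : O → ℝ≥0∞),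
        (∀ o ∈ s, φ o = ν o) → (∀ o ∉ s, φ o = ν') →
        (∀ o ∈ s, t o = T₀) → (∀ o ∉ s, t o = T') →
        ∀ c, Rep c → Spec w N n c (fun l => τ.expect fun o => φ o l) (τ.expect t))
    (c : Config) (hc : Rep c) :
    Spec w N 0 c (fun l => (τ.filter s hs).expect fun o => ν o l) (T₀ + 2 * n) := by
  classical
  -- These are the worst output probability and the worst truncated time over all of `Rep`. Applying
  -- the one-trial hypothesis at every configuration in `Rep` gives ν' ≥ E[ν; success] + qν' and T'
  -- ≤ pT₀ + qT' + n, where p + q = 1. The terms with q cancel, because both quantities are finite,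
  -- and p ≥ 1/2 turns n / p into 2n.
  set ν' : List ℕ → ℝ≥0∞ := fun l => ⨅ (c : Config) (_ : Rep c), outputProb w c l with hν'
  set T' : ℝ≥0∞ := ⨆ (c : Config) (_ : Rep c), timeUpTo w N c with hT'
  have hrep : ∀ c, Rep c → Spec w N 0 c ν' T' := fun c hc =>
    ⟨fun l => iInf₂_le c hc, by simpa using le_iSup₂ (f := fun c (_ : Rep c) => timeUpTo w N c) c hc⟩
  have key := h ν' T' hrep (fun o l => if o ∈ s then ν o l else ν' l)
    (fun o => if o ∈ s then T₀ else T') (by intro o ho; simp [ho]) (by intro o ho; simp [ho])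
    (by intro o ho; simp [ho]) (by intro o ho; simp [ho])
  simp only [Spec, PMF.expect_split] at key
  set p := τ.toOuterMeasure s with hpdef
  set q := τ.toOuterMeasure sᶜ with hqdef
  have hpq : p + q = 1 := τ.toOuterMeasure_add_compl s
  have hp0 : p ≠ 0 := fun h0 => by simp [h0] at hp
  have hpt : p ≠ ⊤ := ((τ.toOuterMeasure_le_one s).trans_lt ENNReal.one_lt_top).ne
  have hqt : q ≠ ⊤ := ((τ.toOuterMeasure_le_one sᶜ).trans_lt ENNReal.one_lt_top).ne
  constructor
  · intro l
    refine le_trans ?_ ((hrep c hc).1 l)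
    beta_reduce
    rw [PMF.expect_filter]
    have h1 : τ.expect (s.indicator fun o => ν o l) + q * ν' l ≤ ν' l :=
      le_iInf₂ fun c hc => (key c hc).1 l
    have hfin : ν' l ≠ ⊤ := by
      refine (lt_of_le_of_lt (iInf₂_le c hc) ?_).ne
      exact lt_of_le_of_lt (iSup_le fun n => PMF.toOuterMeasure_le_one _ _) ENNReal.one_lt_top
    have h2 : τ.expect (s.indicator fun o => ν o l) + q * ν' l ≤ p * ν' l + q * ν' l := by
      rwa [← add_mul, hpq, one_mul]
    rw [ENNReal.inv_mul_le_iff hp0 hpt]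
    exact (ENNReal.add_le_add_iff_right (ENNReal.mul_ne_top hqt hfin)).1 h2
  · refine ((hrep c hc).2).trans ?_
    simp only [Nat.cast_zero, add_zero]
    have h1 : T' ≤ τ.expect (s.indicator fun _ => T₀) + q * T' + n :=
      iSup₂_le fun c hc => (key c hc).2
    have hE : τ.expect (s.indicator fun _ => T₀) = p * T₀ := by
      rw [hpdef, PMF.toOuterMeasure_eq_expect, ← PMF.expect_mul_right]
      refine PMF.expect_congr fun a _ => ?_
      by_cases h : a ∈ s <;> simp [h]
    have hfin : T' ≠ ⊤ :=
      (lt_of_le_of_lt (iSup₂_le fun c _ => timeUpTo_le w N c) (ENNReal.natCast_lt_top N)).ne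
    have h2 : p * T' + q * T' ≤ (p * T₀ + n) + q * T' := by
      rw [← add_mul, hpq, one_mul]
      refine h1.trans (le_of_eq ?_)
      rw [hE]
      ring
    have h3 := (ENNReal.add_le_add_iff_right (ENNReal.mul_ne_top hqt hfin)).1 h2
    have h4 : T' ≤ p⁻¹ * (p * T₀ + n) := by
      rw [← ENNReal.mul_le_iff_le_inv hp0 hpt]
      exact h3
    refine h4.trans ?_
    rw [mul_add, ← mul_assoc, ENNReal.inv_mul_cancel hp0 hpt, one_mul]
    gcongr
    rw [ENNReal.inv_le_iff_inv_le]
    exact hp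

/-- The bounds from below have total mass 1 while the output probabilities sum to at most 1, so none
of the bounds can be strict. -/
theorem outputProb_eq_of_spec {c : Config} {μ : PMF (List ℕ)} (h : Spec w N n c μ T)
    (l : List ℕ) : outputProb w c l = μ l := by
  refine le_antisymm ?_ (h.1 l)
  by_contra! hlt
  have h1 : ∑' l, μ l < ∑' l, outputProb w c l :=
    ENNReal.tsum_lt_tsum (μ.tsum_coe_ne_top) h.1 hlt
  rw [μ.tsum_coe] at h1
  exact absurd (tsum_outputProb_le_one c) (not_le.2 h1)

theorem expectedTime_le_of_spec {c : Config} {ν : List ℕ → ℝ≥0∞} (h : ∀ N, Spec w N n c ν T) :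
    expectedTime w c ≤ T + n := by
  rw [expectedTime_eq_iSup]
  exact iSup_le fun N => (h N).2

end WordRAM


/-! ## Sampling schemes -/

/-- A recipe for random walks. `move y c` is the vertex reached from `y` by the move with code `c`,
if there is one. A trial from `v` with target `r` makes one uniformly random move from each of the
lists in `script v r`; trials are repeated until one succeeds. A trial from a final vertex is the
last one. -/
structure Scheme (W : Type*) where
  move : W → ℕ → Option W
  script : W → W → List (List ℕ)
  final : W → Bool

namespace Scheme

open WordRAM

variable {W : Type*} (S : Scheme W)

/-- The move with code `c` on possibly undefined positions. -/
def moveO (o : Option W) (c : ℕ) : Option W := o.bind fun y => S.move y c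

/-- The position after a uniformly random move from the list `l`. -/
noncomputable def stepLaw (l : List ℕ) (o : Option W) : PMF (Option W) :=
  (unif (l.length - 1)).map fun x => S.moveO o (l.getD x 0)

/-- The successive positions of random moves from the given lists. -/
noncomputable def traceLaw : List (List ℕ) → Option W → PMF (List (Option W))
  | [], _ => PMF.pure []
  | l :: ls, o => (S.stepLaw l o).bind fun o' => (traceLaw ls o').map (o' :: ·)

noncomputable def trial (v r : W) : PMF (List (Option W)) := S.traceLaw (S.script v r) (some v)

/-- The traces of successful trials from `v`. -/
def succ (v : W) : Set (List (Option W)) := {tr | tr.getLastD (some v) ≠ none}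

open scoped Classical in
/-- The distribution of the trace of a successful trial. -/
noncomputable def condTrial (v r : W) : PMF (List (Option W)) :=
  if h : ∃ tr ∈ succ v, tr ∈ (S.trial v r).support then (S.trial v r).filter (succ v) h
  else PMF.pure []

/-- The last vertex of a successful trial. -/
def endpoint (v : W) (tr : List (Option W)) : W := (tr.getLastD (some v)).getD v

/-- The random walk from `v` towards `r`, with at most `n` successful trials. -/
noncomputable def reach : ℕ → W → W → PMF (List W)
  | 0, _, _ => PMF.pure []
  -- The positions of a successful trial are all defined, so `reduceOption` drops nothing. The start
  -- `v` is not part of the list.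
  | n + 1, v, r => (S.condTrial v r).bind fun tr =>
      if S.final v then PMF.pure tr.reduceOption
      else (reach n (endpoint v tr) r).map (tr.reduceOption ++ ·)

/-- The random walk from `s` to `t` through a random element of `core`. -/
noncomputable def walkLaw (core : List W) (n : ℕ) (s t : W) : PMF (List W) :=
  -- The default `s` is never taken when `core` is nonempty. When both halves end in the chosen core
  -- element, it occurs twice in a row; loop erasure removes the repetition.
  (unif (core.length - 1)).bind fun x => (S.reach n s (core.getD x s)).bind fun a =>
    (S.reach n t (core.getD x s)).map fun b => s :: a ++ (t :: b).reverse

theorem length_of_mem_traceLaw {ls : List (List ℕ)} {o : Option W} {tr : List (Option W)}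
    (h : tr ∈ (S.traceLaw ls o).support) : tr.length = ls.length := by
  induction ls generalizing o tr with
  | nil => simp [traceLaw] at h; simp [h]
  | cons l ls ih =>
    simp only [traceLaw, PMF.mem_support_bind_iff, PMF.mem_support_map_iff] at h
    obtain ⟨o', -, tr', h', rfl⟩ := h
    simp [ih h']

theorem stepLaw_none (l : List ℕ) : S.stepLaw l none = PMF.pure none := by
  simp only [stepLaw, moveO, Option.bind_none]
  exact PMF.map_const _ _

theorem getLastD_of_mem_traceLaw_none {ls : List (List ℕ)} {tr : List (Option W)}
    (h : tr ∈ (S.traceLaw ls none).support) : tr.getLastD none = none := by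
  induction ls generalizing tr with
  | nil => simp [traceLaw] at h; simp [h]
  | cons l ls ih =>
    simp only [traceLaw, stepLaw_none, PMF.pure_bind, PMF.mem_support_map_iff] at h
    obtain ⟨tr', h', rfl⟩ := h
    rw [List.getLastD_cons]
    exact ih h'

/-- The undefined position is absorbing, so a defined last position forces all earlier ones to be
defined. -/
theorem exists_map_some_of_mem_traceLaw {ls : List (List ℕ)} {o : Option W}
    {tr : List (Option W)} (h : tr ∈ (S.traceLaw ls o).support) (hs : tr.getLastD o ≠ none) :
    ∃ a : List W, tr = a.map some := by
  induction ls generalizing o tr with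
  | nil => simp [traceLaw] at h; exact ⟨[], by simp [h]⟩
  | cons l ls ih =>
    simp only [traceLaw, PMF.mem_support_bind_iff, PMF.mem_support_map_iff] at h
    obtain ⟨o', -, tr', h', rfl⟩ := h
    rw [List.getLastD_cons] at hs
    cases o' with
    | none => exact absurd (S.getLastD_of_mem_traceLaw_none h') hs
    | some y =>
      obtain ⟨a, rfl⟩ := ih h' hs
      exact ⟨y :: a, rfl⟩

theorem reduceOption_map_some (a : List W) : (a.map some).reduceOption = a := by
  simp [List.reduceOption]

theorem map_some_reduceOption {v r : W} {tr : List (Option W)}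
    (h : tr ∈ (S.trial v r).support) (hs : tr ∈ succ v) : tr.reduceOption.map some = tr := by
  obtain ⟨a, rfl⟩ := S.exists_map_some_of_mem_traceLaw h hs
  rw [reduceOption_map_some]

theorem some_endpoint {v : W} {tr : List (Option W)} (hs : tr ∈ succ v) :
    some (endpoint v tr) = tr.getLastD (some v) := by
  obtain ⟨y, hy⟩ := Option.ne_none_iff_exists'.1 hs
  rw [endpoint, hy, Option.getD_some]

/-- Trials succeed with probability at least `1 / 2`, have at most `J` moves, and the successful
nonfinal ones decrease `rank`. -/
structure Efficient (rank : W → ℕ) (J : ℕ) : Prop where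
  half_le : ∀ v r, S.final r → 2⁻¹ ≤ (S.trial v r).toOuterMeasure (succ v)
  rank_lt : ∀ v r, ¬ S.final v → ∀ tr ∈ (S.trial v r).support, tr ∈ succ v →
    rank (endpoint v tr) < rank v
  length_le : ∀ v r, (S.script v r).length ≤ J
  script_ne_nil : ∀ v r, ∀ l ∈ S.script v r, l ≠ []

variable {S} {rank : W → ℕ} {J : ℕ}

theorem Efficient.exists_succ (hS : S.Efficient rank J) (v r : W) (hr : S.final r) :
    ∃ tr ∈ succ v, tr ∈ (S.trial v r).support := by
  by_contra! h
  have : (S.trial v r).toOuterMeasure (succ v) = 0 := by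
    rw [PMF.toOuterMeasure_apply_eq_zero_iff, Set.disjoint_left]
    exact fun tr h1 h2 => h tr h2 h1
  simpa [this] using hS.half_le v r hr

theorem Efficient.condTrial_eq (hS : S.Efficient rank J) (v r : W) (hr : S.final r) :
    S.condTrial v r = (S.trial v r).filter (succ v) (hS.exists_succ v r hr) := by
  rw [condTrial, dif_pos (hS.exists_succ v r hr)]

theorem Efficient.mem_condTrial (hS : S.Efficient rank J) {v r : W} (hr : S.final r)
    {tr : List (Option W)} (h : tr ∈ (S.condTrial v r).support) :
    tr ∈ succ v ∧ tr ∈ (S.trial v r).support := by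
  rw [hS.condTrial_eq v r hr] at h
  exact (PMF.mem_support_filter_iff _).1 h

/-- Conditioning on an event of probability at least 1/2 at most doubles expectations. Hence only
unconditioned trials have to be analysed. -/
theorem Efficient.condTrial_expect_le (hS : S.Efficient rank J) {v r : W} (hr : S.final r)
    (φ : List (Option W) → ℝ≥0∞) :
    (S.condTrial v r).expect φ ≤ 2 * (S.trial v r).expect φ := by
  rw [hS.condTrial_eq v r hr, PMF.expect_filter]
  gcongr
  · rw [ENNReal.inv_le_iff_inv_le]
    exact hS.half_le v r hr
  · exact PMF.expect_mono fun a _ => Set.indicator_le_self' (fun _ _ => zero_le) a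

theorem Efficient.length_of_mem_reach (hS : S.Efficient rank J) {n : ℕ} {v r : W}
    (hr : S.final r) {a : List W} (h : a ∈ (S.reach n v r).support) : a.length ≤ n * J := by
  induction n generalizing v a with
  | zero => simp [reach] at h; simp [h]
  | succ n ih =>
    simp only [reach, PMF.mem_support_bind_iff] at h
    obtain ⟨tr, htr, h⟩ := h
    obtain ⟨hs, ht⟩ := hS.mem_condTrial hr htr
    have hl : tr.reduceOption.length ≤ J := by
      rw [← List.length_map (f := some), S.map_some_reduceOption ht hs,
        S.length_of_mem_traceLaw ht]
      exact hS.length_le v r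
    split_ifs at h with hf
    · simp only [PMF.support_pure, Set.mem_singleton_iff] at h
      subst h
      nlinarith
    · rw [PMF.mem_support_map_iff] at h
      obtain ⟨a', ha', rfl⟩ := h
      have := ih ha'
      rw [List.length_append]
      nlinarith

end Scheme

/-! ## The sampling program -/

namespace WordRAM

/-- The sequential composition of a list of programs. -/
def Prog.block : List Prog → Prog
  | [] => .skip
  | p :: ps => .seq p (block ps)

/-- The cells from `q` on hold the list `l`. -/
def Holds (mem : ℕ → ℕ) : ℕ → List ℕ → Prop
  | _, [] => True
  | q, a :: l => mem q = a ∧ Holds mem (q + 1) l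

theorem Holds.congr {mem mem' : ℕ → ℕ} {q : ℕ} {l : List ℕ} (h : Holds mem q l)
    (heq : ∀ a, q ≤ a → a < q + l.length → mem' a = mem a) : Holds mem' q l := by
  induction l generalizing q with
  | nil => trivial
  | cons x l ih =>
    refine ⟨(heq q le_rfl (by simp)).trans h.1, ih h.2 fun a h1 h2 => heq a (by omega) ?_⟩
    simp only [List.length_cons]
    omega

theorem holds_append {mem : ℕ → ℕ} {q : ℕ} {l l' : List ℕ} :
    Holds mem q (l ++ l') ↔ Holds mem q l ∧ Holds mem (q + l.length) l' := by
  induction l generalizing q with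
  | nil => simp [Holds]
  | cons x l ih =>
    simp only [List.cons_append, Holds, ih, List.length_cons, and_assoc]
    rw [show q + 1 + l.length = q + (l.length + 1) by ring]

variable {w N n : ℕ} {ν : List ℕ → ℝ≥0∞} {T : ℝ≥0∞} {K : List Prog} {reg mem : ℕ → ℕ} {o : List ℕ}

theorem spec_block_cons {p : Prog} {ps : List Prog}
    (h : Spec w N n ⟨p :: .block ps :: K, reg, mem, o⟩ ν T) :
    Spec w N (n + 1) ⟨.block (p :: ps) :: K, reg, mem, o⟩ ν T := spec_seq h

theorem spec_block_nil (h : Spec w N n ⟨K, reg, mem, o⟩ ν T) :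
    Spec w N (n + 1) ⟨.block [] :: K, reg, mem, o⟩ ν T := spec_skip h

theorem spec_add {r a b x y : ℕ} {ps : List Prog} (ha : reg a = x) (hb : reg b = y)
    (hlt : x + y < 2 ^ w)
    (h : Spec w N n ⟨.block ps :: K, Function.update reg r (x + y), mem, o⟩ ν T) :
    Spec w N (n + 2) ⟨.block (.bin .add r a b :: ps) :: K, reg, mem, o⟩ ν T := by
  refine spec_block_cons (spec_bin ?_)
  rwa [BinOp.eval, ha, hb, Nat.mod_eq_of_lt hlt]

theorem spec_mul {r a b x y : ℕ} {ps : List Prog} (ha : reg a = x) (hb : reg b = y)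
    (hlt : x * y < 2 ^ w)
    (h : Spec w N n ⟨.block ps :: K, Function.update reg r (x * y), mem, o⟩ ν T) :
    Spec w N (n + 2) ⟨.block (.bin .mul r a b :: ps) :: K, reg, mem, o⟩ ν T := by
  refine spec_block_cons (spec_bin ?_)
  rwa [BinOp.eval, ha, hb, Nat.mod_eq_of_lt hlt]

theorem spec_sub {r a b x y : ℕ} {ps : List Prog} (ha : reg a = x) (hb : reg b = y)
    (h : Spec w N n ⟨.block ps :: K, Function.update reg r (x - y), mem, o⟩ ν T) :
    Spec w N (n + 2) ⟨.block (.bin .sub r a b :: ps) :: K, reg, mem, o⟩ ν T := by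
  refine spec_block_cons (spec_bin ?_)
  rwa [BinOp.eval, ha, hb]

theorem spec_lit {r x : ℕ} {ps : List Prog} (hx : x < 2 ^ w)
    (h : Spec w N n ⟨.block ps :: K, Function.update reg r x, mem, o⟩ ν T) :
    Spec w N (n + 2) ⟨.block (.const r x :: ps) :: K, reg, mem, o⟩ ν T := by
  refine spec_block_cons (spec_const ?_)
  rwa [Nat.mod_eq_of_lt hx]

theorem spec_read {r a x y : ℕ} {ps : List Prog} (ha : reg a = x) (hm : mem x = y)
    (h : Spec w N n ⟨.block ps :: K, Function.update reg r y, mem, o⟩ ν T) :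
    Spec w N (n + 2) ⟨.block (.load r a :: ps) :: K, reg, mem, o⟩ ν T := by
  refine spec_block_cons (spec_load ?_)
  rwa [ha, hm]

theorem spec_write {a b x y : ℕ} {ps : List Prog} (ha : reg a = x) (hb : reg b = y)
    (h : Spec w N n ⟨.block ps :: K, reg, Function.update mem x y, o⟩ ν T) :
    Spec w N (n + 2) ⟨.block (.store a b :: ps) :: K, reg, mem, o⟩ ν T := by
  refine spec_block_cons (spec_store ?_)
  rwa [ha, hb]

theorem spec_print {a x : ℕ} {ps : List Prog} (ha : reg a = x)
    (h : Spec w N n ⟨.block ps :: K, reg, mem, o ++ [x]⟩ ν T) :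
    Spec w N (n + 2) ⟨.block (.out a :: ps) :: K, reg, mem, o⟩ ν T := by
  refine spec_block_cons (spec_out ?_)
  rwa [ha]

/-- Draw a random entry of the current list of moves and make this move. -/
def stepBody : Prog := .block
  -- Register 13 points to three words (length - 1, a, b). The drawn code is in the cell x + a + b ·
  -- (register 7), where register 7 holds the address of the target. A code is an offset in a
  -- record: adding the current address (register 11) gives the cell with the next address, which is
  -- also appended to the buffer ending at register 12.
  [.load 15 13, .rand 15 15, .bin .add 16 13 2, .load 16 16, .bin .add 17 13 3, .load 17 17,
    .bin .mul 17 17 7, .bin .add 15 15 16, .bin .add 15 15 17, .load 15 15, .bin .add 15 15 11,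
    .load 11 15, .store 12 11, .bin .add 12 12 2, .bin .add 13 13 4]

def stepLoop : Prog := .loop 13 14 stepBody

/-- One trial, which is made permanent if it is successful. -/
def trialBody : Prog := .block
  -- Registers 8, 9, 10 hold the current vertex, the end of the buffer and whether the walk is over.
  -- The trial works on copies in registers 11 and 12 (register 31 is 0, so adding it copies), and a
  -- failed trial only leaves garbage beyond the end of the buffer. Success is the test 11 < 6, as
  -- all vertex addresses are below that of the dead record.
  [.bin .add 11 8 31, .bin .add 12 9 31, .bin .add 15 8 3, .load 13 15, .bin .add 15 8 4,
    .load 14 15, stepLoop,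
    .ite 11 6 (.block [.bin .add 15 8 5, .load 10 15, .bin .add 8 11 31, .bin .add 9 12 31]) .skip]

def trialLoop : Prog := .loop 10 2 trialBody

/-- How a scheme is stored in the cells `0, …, L - 1`: `A v` is the address of the record of `v`
and `D` that of a record for undefined positions. -/
structure Layout {W : Type*} (S : Scheme W) (core : List W) (num : W → ℕ) (w : ℕ)
    (data : ℕ → ℕ) (L : ℕ) (A : W → ℕ) (D : ℕ) : Prop where
  L_lt : L + 4 < 2 ^ w
  A_lt : ∀ v, A v < D
  D_lt : D < L
  A_inj : ∀ u v, A u = A v → u = v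
  -- The cell `A u + 1` is scratch space for the last occurrence of `u`; writing to it must not
  -- destroy the vertex numbers, which are read while printing.
  A_add_one_ne : ∀ u v, A u + 1 ≠ A v
  A_add_le : ∀ v, A v + 4 < L
  num_eq : ∀ v, data (A v) = num v
  final_eq : ∀ v, data (A v + 4) = if S.final v then 1 else 0
  -- One address formula x + a + b · A r covers both kinds of choices: with b = 0 the list is stored
  -- with `v`, with b = 1 it is read from the record of the target. The number of choices does not
  -- depend on the target.
  exists_script : ∀ v, ∃ p len, data (A v + 2) = p ∧ data (A v + 3) = p + 3 * len ∧
    p + 3 * len ≤ L ∧ ∀ r, (S.script v r).length = len ∧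
      ∀ j (hj : j < (S.script v r).length), ∃ a b, data (p + 3 * j) = (S.script v r)[j].length - 1 ∧
        data (p + 3 * j + 1) = a ∧ data (p + 3 * j + 2) = b ∧ b * A r < L ∧
        ∀ x (hx : x < (S.script v r)[j].length), x + a + b * A r < L ∧
          data (x + a + b * A r) = (S.script v r)[j][x]
  -- Undefined positions are included: the dead record leads back to itself, so definedness is
  -- tested only once, after the trial.
  move_eq : ∀ v r, ∀ l ∈ S.script v r, ∀ c ∈ l, ∀ o : Option W,
    c + o.elim D A < L ∧ data (c + o.elim D A) = (S.moveO o c).elim D A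
  header : data 0 = D ∧ data 1 = core.length - 1 ∧ 6 ≤ L
  core_eq : ∀ i (hi : i < core.length), i + data 2 < L ∧ data (i + data 2) = A core[i]
  index_eq : ∀ v, num v + data 3 < L ∧ data (num v + data 3) = A v

/-- The registers that stay constant hold their intended values. -/
structure Consts (reg : ℕ → ℕ) (D R : ℕ) : Prop where
  r2 : reg 2 = 1
  r3 : reg 3 = 2
  r4 : reg 4 = 3
  r5 : reg 5 = 4
  r6 : reg 6 = D
  r7 : reg 7 = R
  r31 : reg 31 = 0

theorem Consts.congr {reg reg' : ℕ → ℕ} {D R : ℕ} (h : Consts reg D R)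
    (heq : ∀ r, r < 8 ∨ 17 < r → reg' r = reg r) : Consts reg' D R :=
  ⟨by rw [heq _ (by simp), h.r2], by rw [heq _ (by simp), h.r3], by rw [heq _ (by simp), h.r4],
    by rw [heq _ (by simp), h.r5], by rw [heq _ (by simp), h.r6], by rw [heq _ (by simp), h.r7],
    by rw [heq _ (by simp), h.r31]⟩

variable {W : Type*} {S : Scheme W} {core : List W} {num : W → ℕ} {data : ℕ → ℕ} {L D : ℕ}
  {A : W → ℕ}

/-- Fifteen instructions at two steps each and the closing `skip` make 31 steps; the loop test will
make 32 per random move. -/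
theorem spec_stepBody (hL : Layout S core num w data L A D) {reg mem : ℕ → ℕ} {l : List ℕ}
    {p a b q : ℕ} {r : W} {pos : Option W} {φ : Option W → List ℕ → ℝ≥0∞}
    {t : Option W → ℝ≥0∞} (hl : l ≠ [])
    (hc : Consts reg D (A r)) (hmem : ∀ a < L, mem a = data a)
    (hp : p + 3 ≤ L) (h0 : data p = l.length - 1) (h1 : data (p + 1) = a)
    (h2 : data (p + 2) = b) (hb : b * A r < L)
    (hx : ∀ x (hx : x < l.length), x + a + b * A r < L ∧ data (x + a + b * A r) = l[x])
    (hmove : ∀ c ∈ l, c + pos.elim D A < L ∧ data (c + pos.elim D A) = (S.moveO pos c).elim D A)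
    (h13 : reg 13 = p) (h11 : reg 11 = pos.elim D A) (h12 : reg 12 = q) (hq : q + 1 < 2 ^ w)
    (hK : ∀ pos' ∈ (S.stepLaw l pos).support, ∀ (reg' : ℕ → ℕ), (∀ i, i < 11 ∨ i = 14 ∨ 17 < i → reg' i = reg i) →
      reg' 13 = p + 3 → reg' 11 = pos'.elim D A → reg' 12 = q + 1 →
      Spec w N n ⟨K, reg', Function.update mem q (pos'.elim D A), o⟩ (φ pos') (t pos')) :
    Spec w N (n + 31) ⟨stepBody :: K, reg, mem, o⟩
      (fun x => (S.stepLaw l pos).expect fun pos' => φ pos' x) ((S.stepLaw l pos).expect t) := by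
  have hLw := hL.L_lt
  refine spec_block_cons (spec_load ?_)
  rw [h13, hmem p (by omega), h0]
  simp only [Scheme.stepLaw, PMF.expect_map]
  refine spec_block_cons ?_
  have e15 : Function.update reg 15 (l.length - 1) 15 = l.length - 1 := by simp
  have := spec_rand (w := w) (N := N) (n := n + 27) (r := 15) (a := 15) (mem := mem) (o := o)
    (reg := Function.update reg 15 (l.length - 1)) (K := Prog.block
      [.bin .add 16 13 2, .load 16 16, .bin .add 17 13 3, .load 17 17,
    .bin .mul 17 17 7, .bin .add 15 15 16, .bin .add 15 15 17, .load 15 15, .bin .add 15 15 11,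
    .load 11 15, .store 12 11, .bin .add 12 12 2, .bin .add 13 13 4] :: K)
    (ν := fun x => φ (S.moveO pos (l.getD x 0))) (T := fun x => t (S.moveO pos (l.getD x 0)))
    (fun x hxle => by
      have hpos : 0 < l.length := List.length_pos_iff.2 hl
      have hxl : x < l.length := by rw [e15] at hxle; omega
      obtain ⟨hx1, hx2⟩ := hx x hxl
      obtain ⟨hm1, hm2⟩ := hmove l[x] (List.getElem_mem hxl)
      rw [List.getD_eq_getElem l 0 hxl]
      refine spec_add (x := p) (y := 1) (by simp [h13]) (by simp [hc.r2]) (by omega) ?_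
      refine spec_read (x := p + 1) (y := a) (by simp) (by rw [hmem _ (by omega), h1]) ?_
      refine spec_add (x := p) (y := 2) (by simp [h13]) (by simp [hc.r3]) (by omega) ?_
      refine spec_read (x := p + 2) (y := b) (by simp) (by rw [hmem _ (by omega), h2]) ?_
      refine spec_mul (x := b) (y := A r) (by simp) (by simp [hc.r7]) (by omega) ?_
      refine spec_add (x := x) (y := a) (by simp) (by simp) (by omega) ?_
      refine spec_add (x := x + a) (y := b * A r) (by simp) (by simp) (by omega) ?_
      refine spec_read (x := x + a + b * A r) (y := l[x]) (by simp) (by rw [hmem _ hx1, hx2]) ?_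
      refine spec_add (x := l[x]) (y := pos.elim D A) (by simp) (by simp [h11]) (by omega) ?_
      refine spec_read (x := l[x] + pos.elim D A) (y := (S.moveO pos l[x]).elim D A) (by simp)
        (by rw [hmem _ hm1, hm2]) ?_
      refine spec_write (x := q) (y := (S.moveO pos l[x]).elim D A) (by simp [h12]) (by simp) ?_
      refine spec_add (x := q) (y := 1) (by simp [h12]) (by simp [hc.r2]) (by omega) ?_
      refine spec_add (x := p) (y := 3) (by simp [h13]) (by simp [hc.r4]) (by omega) ?_
      refine spec_block_nil (hK _ ?_ _ ?_ (by simp) (by simp) (by simp))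
      · rw [Scheme.stepLaw, PMF.mem_support_map_iff]
        exact ⟨x, mem_support_unif.2 (by omega), by rw [List.getD_eq_getElem l 0 hxl]⟩
      rintro i (hi | rfl | hi)
      · simp [show i ≠ 11 by omega, show i ≠ 12 by omega,
          show i ≠ 13 by omega, show i ≠ 15 by omega, show i ≠ 16 by omega, show i ≠ 17 by omega]
      · simp
      · simp [show i ≠ 11 by omega, show i ≠ 12 by omega,
          show i ≠ 13 by omega, show i ≠ 15 by omega, show i ≠ 16 by omega, show i ≠ 17 by omega])
  rwa [e15] at this

/-- The continuation may depend on the trace through `φ` and `t`: successful and failed trials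
continue differently, which is the form that `spec_reject` asks for. -/
theorem spec_stepLoop (hL : Layout S core num w data L A D) {r v : W} {p : ℕ} {mem₀ : ℕ → ℕ}
    {reg₀ : ℕ → ℕ} {q₀ : ℕ}
    {J : ℕ} (hLq : L ≤ q₀) (hqJ : q₀ + J + 1 < 2 ^ w)
    (hmem₀ : ∀ a < L, mem₀ a = data a) (hc : Consts reg₀ D (A r))
    (hp : p + 3 * (S.script v r).length ≤ L)
    (hscript : ∀ j (hj : j < (S.script v r).length), ∃ a b,
      data (p + 3 * j) = (S.script v r)[j].length - 1 ∧
        data (p + 3 * j + 1) = a ∧ data (p + 3 * j + 2) = b ∧ b * A r < L ∧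
        ∀ x (hx : x < (S.script v r)[j].length), x + a + b * A r < L ∧
          data (x + a + b * A r) = (S.script v r)[j][x])
    (hne : ∀ l ∈ S.script v r, l ≠ []) (hJ : (S.script v r).length ≤ J)
    (j : ℕ) (ls : List (List ℕ)) (hls : (S.script v r).drop j = ls)
    (reg mem : ℕ → ℕ) (pos : Option W) (φ : List (Option W) → List ℕ → ℝ≥0∞)
    (t : List (Option W) → ℝ≥0∞)
    (hreg : ∀ i, i < 11 ∨ 17 < i → reg i = reg₀ i)
    (hmem : ∀ a < q₀, mem a = mem₀ a)
    (hj : j ≤ (S.script v r).length)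
    (h13 : reg 13 = p + 3 * j) (h14 : reg 14 = p + 3 * (S.script v r).length)
    (h11 : reg 11 = pos.elim D A) (h12 : reg 12 = q₀ + j)
    (hK : ∀ tr ∈ (S.traceLaw ls pos).support, ∀ (reg' mem' : ℕ → ℕ),
      (∀ i, i < 11 ∨ 17 < i → reg' i = reg₀ i) → (∀ a < q₀ + j, mem' a = mem a) →
      Holds mem' (q₀ + j) (tr.map fun o => o.elim D A) →
      reg' 11 = (tr.getLastD pos).elim D A → reg' 12 = q₀ + j + tr.length →
      Spec w N n ⟨K, reg', mem', o⟩ (φ tr) (t tr)) :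
    Spec w N (n + 1 + 32 * ls.length) ⟨stepLoop :: K, reg, mem, o⟩
      (fun x => (S.traceLaw ls pos).expect fun tr => φ tr x) ((S.traceLaw ls pos).expect t) := by
  have hLw := hL.L_lt
  induction ls generalizing j reg mem pos φ t with
  | nil =>
    have hjl : j = (S.script v r).length :=
      le_antisymm hj (List.drop_eq_nil_iff.1 hls)
    simp only [Scheme.traceLaw, PMF.expect_pure]
    refine spec_loop_neg (by rw [h13, h14, hjl]; simp) ?_
    exact hK [] (by simp [Scheme.traceLaw]) reg mem hreg (fun _ _ => rfl) trivial
      (by simpa using h11) (by simpa using h12)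
  | cons l ls ih =>
    have hjl : j < (S.script v r).length := by
      by_contra! hcon
      rw [List.drop_eq_nil_of_le hcon] at hls
      exact absurd hls (by simp)
    rw [List.drop_eq_getElem_cons hjl] at hls
    obtain ⟨hl1, hl2⟩ := List.cons.inj hls
    simp only [Scheme.traceLaw, PMF.expect_bind, PMF.expect_map]
    rw [show n + 1 + 32 * (l :: ls).length = (n + 1 + 32 * ls.length) + 31 + 1 by
      simp only [List.length_cons]; ring]
    refine spec_loop_pos (by rw [h13, h14]; omega) ?_
    obtain ⟨a, b, h0, h1, h2, hb, hx⟩ := hscript j hjl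
    subst hl1
    have hlmem : (S.script v r)[j] ∈ S.script v r := List.getElem_mem hjl
    refine spec_stepBody hL (p := p + 3 * j) (q := q₀ + j) (r := r)
      (φ := fun pos' x => (S.traceLaw ls pos').expect fun a => φ (pos' :: a) x)
      (t := fun pos' => (S.traceLaw ls pos').expect fun a => t (pos' :: a))
      (hne _ hlmem)
      (hc.congr fun i hi => hreg i (by omega)) (fun a ha => (hmem a (by omega)).trans (hmem₀ a ha))
      (by omega) h0 h1 h2 hb hx (fun c hc => hL.move_eq v r _ hlmem c hc pos) h13 h11 h12
      (by omega) ?_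
    intro pos' hpos reg' hreg' h13' h11' h12'
    refine ih (j + 1) hl2 reg' _ pos' _ _ ?_ ?_ hjl (by rw [h13']; ring) ?_ h11'
      (by rw [h12']; ring) ?_
    · intro i hi
      rw [hreg' i (by omega), hreg i hi]
    · intro a ha
      rw [Function.update_of_ne (by omega), hmem a ha]
    · rw [hreg' 14 (by simp), h14]
    · intro tr htr reg'' mem'' hreg'' hmem'' hh hlast hlen
      refine hK (pos' :: tr) ?_ reg'' mem'' hreg'' ?_ ⟨?_, ?_⟩ ?_ ?_
      · simp only [Scheme.traceLaw, PMF.mem_support_bind_iff, PMF.mem_support_map_iff]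
        exact ⟨pos', hpos, tr, htr, rfl⟩
      · intro a ha
        rw [hmem'' a (by omega), Function.update_of_ne (by omega)]
      · rw [hmem'' _ (by omega), Function.update_self]
      · rw [add_assoc]; exact hh
      · rw [List.getLastD_cons]; exact hlast
      · rw [hlen, List.length_cons]; ring

end WordRAM

/-! ### Repeating trials until the walk ends. -/

namespace WordRAM
variable {w N n : ℕ} {ν : List ℕ → ℝ≥0∞} {T : ℝ≥0∞} {K : List Prog} {reg mem : ℕ → ℕ} {o : List ℕ}
variable {W : Type*} {S : Scheme W} {core : List W} {num : W → ℕ} {data : ℕ → ℕ} {L D : ℕ}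
  {A : W → ℕ}

theorem map_elim_eq {tr : List (Option W)} (h : tr.reduceOption.map some = tr) :
    tr.map (fun o => o.elim D A) = tr.reduceOption.map A := by
  conv_lhs => rw [← h]
  simp

/-- Induction on a bound for the rank: `spec_reject` absorbs the failed trials from `v`, and the
induction hypothesis treats the walk from the endpoint, whose rank is smaller. A trial takes at most
32J + 40 steps and two are expected at most, hence 64J + 80. -/
theorem spec_trialLoop (hL : Layout S core num w data L A D) {rank : W → ℕ} {J : ℕ}
    (hS : S.Efficient rank J) {r : W} (hr : S.final r) (m : ℕ) (v : W) (hv : rank v < m)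
    (reg mem : ℕ → ℕ) (q : ℕ) (hLq : L ≤ q) (hq : q + m * J + 1 < 2 ^ w)
    (hmem : ∀ a < L, mem a = data a) (hc : Consts reg D (A r))
    (h8 : reg 8 = A v) (h9 : reg 9 = q) (h10 : reg 10 = 0)
    (φ : List W → List ℕ → ℝ≥0∞) (T : ℝ≥0∞)
    (hK : ∀ a ∈ (S.reach m v r).support, ∀ (reg' mem' : ℕ → ℕ),
      (∀ i, i < 8 ∨ 17 < i → reg' i = reg i) → (∀ a < q, mem' a = mem a) →
      Holds mem' q (a.map A) → reg' 9 = q + a.length →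
      Spec w N 0 ⟨K, reg', mem', o⟩ (φ a) T) :
    Spec w N 0 ⟨trialLoop :: K, reg, mem, o⟩
      (fun x => (S.reach m v r).expect fun a => φ a x) (T + m * (64 * J + 80 : ℕ)) := by
  have hLw := hL.L_lt
  induction m generalizing v reg mem q φ with
  | zero => exact absurd hv (by omega)
  | succ m ih =>
    obtain ⟨p, len, hp, hlen, hple, hscr⟩ := hL.exists_script v
    obtain ⟨hlenr, hentry⟩ := hscr r
    have hJq : q + J + 1 < 2 ^ w := by nlinarith
    set T₁ : ℝ≥0∞ := T + m * (64 * J + 80 : ℕ) with hT₁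
    set ψ : List (Option W) → List ℕ → ℝ≥0∞ := fun tr x =>
      (if S.final v then PMF.pure tr.reduceOption
      else (S.reach m (Scheme.endpoint v tr) r).map (tr.reduceOption ++ ·)).expect fun a => φ a x
      with hψ
    -- Failed trials return to the head of the loop with other scratch registers and other memory
    -- from q on, so the repeated state is a class of configurations rather than a single one.
    have key := spec_reject (w := w) (N := N) (n := 32 * J + 40)
      (fun c => ∃ reg' mem' : ℕ → ℕ, c = ⟨trialLoop :: K, reg', mem', o⟩ ∧
        (∀ i, i < 8 ∨ 17 < i → reg' i = reg i) ∧ (∀ a < q, mem' a = mem a) ∧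
        reg' 8 = A v ∧ reg' 9 = q ∧ reg' 10 = 0)
      (S.trial v r) (Scheme.succ v) (hS.exists_succ v r hr) (hS.half_le v r hr) ψ T₁ ?_
      ⟨trialLoop :: K, reg, mem, o⟩
      ⟨reg, mem, rfl, fun _ _ => rfl, fun _ _ => rfl, h8, h9, h10⟩
    · refine key.weaken (fun x => ?_) ?_
      · simp only [Scheme.reach, PMF.expect_bind]
        rw [hS.condTrial_eq v r hr]
      · rw [hT₁]
        push_cast
        ring_nf
        rfl
    · intro ν' T' hrep φ' t hφs hφn hts htn c hcrep
      obtain ⟨reg', mem', rfl, hreg', hmem', h8', h9', h10'⟩ := hcrep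
      have hc' := hc.congr hreg'
      have hAv := hL.A_add_le v
      have hDlt := hL.D_lt
      have hAD := hL.A_lt v
      have hdata : ∀ a < L, mem' a = data a := fun a ha => (hmem' a (by omega)).trans (hmem a ha)
      refine Spec.fuel (n := (13 + 1 + 32 * (S.script v r).length) + 14) ?_ ?_
      swap
      · have := hS.length_le v r
        omega
      refine spec_loop_pos (by rw [h10', hc'.r2]; simp) ?_
      refine spec_add (x := A v) (y := 0) (by simp [h8']) (by simp [hc'.r31]) (by omega) ?_
      refine spec_add (x := q) (y := 0) (by simp [h9']) (by simp [hc'.r31]) (by omega) ?_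
      refine spec_add (x := A v) (y := 2) (by simp [h8']) (by simp [hc'.r3]) (by omega) ?_
      refine spec_read (x := A v + 2) (y := p) (by simp) (by rw [hdata _ (by omega), hp]) ?_
      refine spec_add (x := A v) (y := 3) (by simp [h8']) (by simp [hc'.r4]) (by omega) ?_
      refine spec_read (x := A v + 3) (y := p + 3 * len) (by simp)
        (by rw [hdata _ (by omega), hlen]) ?_
      refine spec_block_cons ?_
      refine spec_stepLoop (q₀ := q) (mem₀ := mem') (J := J) hL hLq hJq hdata
        (reg₀ := reg') hc' (p := p) (by rw [hlenr]; exact hple) hentry (hS.script_ne_nil v r)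
        (hS.length_le v r) 0 (S.script v r) rfl _ mem' (some v) φ' t ?_ (fun _ _ => rfl)
        (Nat.zero_le _) (by simp) (by simp [hlenr]) (by simp) (by simp) ?_
      · intro i hi
        simp [show i ≠ 11 by omega, show i ≠ 12 by omega, show i ≠ 13 by omega,
          show i ≠ 14 by omega, show i ≠ 15 by omega]
      intro tr htr reg₁ mem₁ hreg₁ hmem₁ hh hlast hend
      simp only [add_zero] at hmem₁ hh hend
      have hc₁ := hc'.congr fun i hi => hreg₁ i (by omega)
      by_cases hs : tr ∈ Scheme.succ v
      · have he := Scheme.some_endpoint hs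
        set y := Scheme.endpoint v tr with hy
        have hred := S.map_some_reduceOption htr hs
        have htrlen : tr.reduceOption.length = tr.length := by
          conv_rhs => rw [← hred]
          simp
        have hJtr : tr.length ≤ J := by
          rw [S.length_of_mem_traceLaw htr]
          exact hS.length_le v r
        have htrc : tr ∈ (S.condTrial v r).support := by
          rw [hS.condTrial_eq v r hr]
          exact (PMF.mem_support_filter_iff _).2 ⟨hs, htr⟩
        rw [map_elim_eq hred] at hh
        rw [hφs tr hs, hts tr hs]
        rw [← he] at hlast
        refine spec_block_cons (spec_ite_pos
          (by rw [hlast, hc₁.r6]; exact hL.A_lt y) ?_)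
        refine spec_add (x := A v) (y := 4) (by simp [hreg₁, h8']) (by simp [hc₁.r5]) (by omega) ?_
        refine spec_read (x := A v + 4) (y := if S.final v then 1 else 0) (by simp)
          (by rw [hmem₁ _ (by omega), hdata _ (by omega), hL.final_eq]) ?_
        refine spec_add (x := A y) (y := 0) (by simp [hlast]) (by simp [hc₁.r31])
          (by have := hL.A_lt y; omega) ?_
        refine spec_add (x := q + tr.length) (y := 0) (by simp [hend]) (by simp [hc₁.r31])
          (by omega) ?_
        refine spec_block_nil (spec_block_nil ?_)
        by_cases hf : S.final v
        · refine spec_loop_neg (by simp [hf, hc₁.r2]) ?_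
          have : ψ tr = φ tr.reduceOption := by
            funext x
            simp only [hψ, hf, if_true, PMF.expect_pure]
          rw [this]
          refine (hK tr.reduceOption ?_ _ mem₁ ?_ ?_ hh ?_).weaken (fun _ => le_rfl) ?_
          · simp only [Scheme.reach, PMF.mem_support_bind_iff]
            exact ⟨tr, htrc, by simp [hf]⟩
          · intro i hi
            simp [show i ≠ 8 by omega, show i ≠ 9 by omega, show i ≠ 10 by omega,
              show i ≠ 15 by omega, hreg₁ i (by omega), hreg' i hi]
          · intro a ha
            rw [hmem₁ a ha, hmem' a ha]
          · simp [htrlen]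
          · rw [hT₁]
            simp only [Nat.cast_zero, add_zero]
            exact le_self_add
        · have : ψ tr = fun x => (S.reach m y r).expect
              fun a => φ (tr.reduceOption ++ a) x := by
            funext x
            simp only [hψ, hf, if_false, PMF.expect_map, Bool.false_eq_true]
            rfl
          rw [this]
          have hrank : rank y < rank v := hS.rank_lt v r (by simpa using hf) tr htr hs
          refine Spec.fuel (n := 0) ?_ (Nat.zero_le _)
          refine ih y (by omega) _ mem₁ (q + tr.length) (by omega) (by nlinarith)
            (fun a ha => (hmem₁ a (by omega)).trans (hdata a ha)) ?_ (by simp) (by simp)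
            (by simp [hf]) (fun a => φ (tr.reduceOption ++ a)) ?_
          · refine hc₁.congr fun i hi => ?_
            simp [show i ≠ 8 by omega, show i ≠ 9 by omega, show i ≠ 10 by omega,
              show i ≠ 15 by omega]
          · intro a ha reg₂ mem₂ hreg₂ hmem₂ hh₂ h9₂
            refine hK (tr.reduceOption ++ a) ?_ reg₂ mem₂ ?_ ?_ ?_ ?_
            · simp only [Scheme.reach, PMF.mem_support_bind_iff]
              refine ⟨tr, htrc, ?_⟩
              rw [if_neg hf, PMF.mem_support_map_iff]
              exact ⟨a, ha, rfl⟩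
            · intro i hi
              rw [hreg₂ i hi]
              simp [show i ≠ 8 by omega, show i ≠ 9 by omega, show i ≠ 10 by omega,
                show i ≠ 15 by omega, hreg₁ i (by omega), hreg' i hi]
            · intro b hb
              rw [hmem₂ b (by omega), hmem₁ b hb, hmem' b hb]
            · rw [List.map_append, holds_append]
              refine ⟨hh.congr fun b _ hb => hmem₂ b ?_, ?_⟩
              · simpa [htrlen] using hb
              · simpa [htrlen] using hh₂
            · rw [h9₂, List.length_append, htrlen]
              ring
      · have hnone : tr.getLastD (some v) = none := by
          by_contra hcon
          exact hs hcon
        rw [hnone] at hlast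
        rw [hφn tr hs, htn tr hs]
        refine spec_block_cons (spec_ite_neg (by rw [hlast, hc₁.r6]; simp) ?_)
        refine spec_skip (spec_block_nil ?_)
        refine Spec.fuel (n := 0) (hrep _ ⟨reg₁, mem₁, rfl, ?_, ?_, ?_, ?_, ?_⟩) (Nat.zero_le _)
        · intro i hi
          rw [hreg₁ i (by omega), hreg' i hi]
        · intro a ha
          rw [hmem₁ a ha, hmem' a ha]
        · rw [hreg₁ 8 (by simp), h8']
        · rw [hreg₁ 9 (by simp), h9']
        · rw [hreg₁ 10 (by simp), h10']

end WordRAM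


/-! ## Loop erasure -/

section EraseLoops

variable {W : Type*} [DecidableEq W]

/-- Shorten a walk to a path, by jumping from each vertex to its last occurrence. -/
def eraseLoops : List W → List W
  | [] => []
  | v :: l => v :: eraseLoops (l.rtakeWhile (· ≠ v))
termination_by l => l.length
decreasing_by
  exact Nat.lt_succ_of_le (List.rtakeWhile_suffix _ _).length_le

theorem eraseLoops_subset (l : List W) : eraseLoops l ⊆ l := by
  induction h : l.length using Nat.strong_induction_on generalizing l with
  | _ n ih =>
    cases l with
    | nil => simp [eraseLoops]
    | cons v l =>
      have hle := (List.rtakeWhile_suffix (· ≠ v) l).length_le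
      have := ih (l.rtakeWhile (· ≠ v)).length (by simp at h; omega) _ rfl
      rw [eraseLoops]
      exact List.cons_subset_cons _ (List.Subset.trans this (List.rtakeWhile_suffix _ _).subset)

theorem nodup_eraseLoops (l : List W) : (eraseLoops l).Nodup := by
  induction h : l.length using Nat.strong_induction_on generalizing l with
  | _ n ih =>
    cases l with
    | nil => simp [eraseLoops]
    | cons v l =>
      have hle := (List.rtakeWhile_suffix (· ≠ v) l).length_le
      have := ih (l.rtakeWhile (· ≠ v)).length (by simp at h; omega) _ rfl
      rw [eraseLoops, List.nodup_cons]
      refine ⟨fun hv => ?_, this⟩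
      have := List.mem_rtakeWhile_imp (eraseLoops_subset _ hv)
      simp at this

theorem head?_eraseLoops (l : List W) : (eraseLoops l).head? = l.head? := by
  cases l <;> simp [eraseLoops]

theorem rtakeWhile_cases (v : W) (l : List W) :
    (v ∉ l ∧ l.rtakeWhile (· ≠ v) = l) ∨ ∃ l₁, l = l₁ ++ v :: l.rtakeWhile (· ≠ v) := by
  induction l using List.reverseRecOn with
  | nil => simp
  | append_singleton l a ih =>
    rw [List.rtakeWhile_concat]
    by_cases ha : a = v
    · right
      exact ⟨l, by simp [ha]⟩
    · rcases ih with ⟨h1, h2⟩ | ⟨l₁, h⟩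
      · left
        simp only [List.mem_append, List.mem_singleton]
        refine ⟨by tauto, ?_⟩
        simp [ha] at h2 ⊢
        exact h2
      · right
        refine ⟨l₁, ?_⟩
        conv_lhs => rw [h]
        simp [ha]

theorem rtakeWhile_append_cons (v : W) (l₁ l₂ : List W) :
    (l₁ ++ v :: l₂).rtakeWhile (· ≠ v) = l₂.rtakeWhile (· ≠ v) := by
  induction l₂ using List.reverseRecOn with
  | nil => simp
  | append_singleton l a ih =>
    rw [show l₁ ++ v :: (l ++ [a]) = (l₁ ++ v :: l) ++ [a] by simp, List.rtakeWhile_concat,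
      List.rtakeWhile_concat, ih]

/-- The erased list is a chain for `R` if the list is one for the reflexive closure of `R`. -/
theorem isChain_eraseLoops {R : W → W → Prop} (l : List W)
    (hl : l.IsChain fun a b => a = b ∨ R a b) : (eraseLoops l).IsChain R := by
  induction h : l.length using Nat.strong_induction_on generalizing l with
  | _ n ih =>
    cases l with
    | nil => simp [eraseLoops]
    | cons v l =>
      have hle := (List.rtakeWhile_suffix (· ≠ v) l).length_le
      -- From the last occurrence of v on, the walk is a suffix of the original one. So the step out
      -- of v is a step of the walk, and it is not a repetition since v does not occur again.
      have hsuf : (v :: l.rtakeWhile (· ≠ v)) <:+ v :: l := by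
        rcases rtakeWhile_cases v l with ⟨h1, h2⟩ | ⟨l₁, h1⟩
        · rw [h2]
        · exact ⟨v :: l₁, by rw [List.cons_append, ← h1]⟩
      have hchain := hl.suffix hsuf
      have := ih (l.rtakeWhile (· ≠ v)).length (by simp at h; omega) _ hchain.tail rfl
      rw [eraseLoops]
      rw [List.isChain_cons]
      refine ⟨fun y hy => ?_, this⟩
      rw [head?_eraseLoops] at hy
      have h1 := (List.isChain_cons.1 hchain).1 y hy
      have h2 := List.mem_rtakeWhile_imp (List.mem_of_mem_head? hy)
      simp at h2
      exact h1.resolve_left fun h => h2 h.symm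

theorem getLast?_eraseLoops (l : List W) : (eraseLoops l).getLast? = l.getLast? := by
  induction h : l.length using Nat.strong_induction_on generalizing l with
  | _ n ih =>
    cases l with
    | nil => simp [eraseLoops]
    | cons v l =>
      have hle := (List.rtakeWhile_suffix (· ≠ v) l).length_le
      have := ih (l.rtakeWhile (· ≠ v)).length (by simp at h; omega) _ rfl
      rw [eraseLoops, List.getLast?_cons, this]
      rcases rtakeWhile_cases v l with ⟨h1, h2⟩ | ⟨l₁, h1⟩
      · rw [h2, List.getLast?_cons]
      · conv_rhs => rw [h1, ← List.cons_append, List.getLast?_append, List.getLast?_cons]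
        simp

theorem length_eraseLoops_le (l : List W) : (eraseLoops l).length ≤ l.length :=
  (nodup_eraseLoops l).length_le_of_subset (eraseLoops_subset l)

end EraseLoops

/-! ### Joining the two halves of a walk and printing the loop-erased path. -/

namespace WordRAM

variable {w N n : ℕ} {ν : List ℕ → ℝ≥0∞} {T : ℝ≥0∞} {K : List Prog} {reg mem : ℕ → ℕ} {o : List ℕ}
variable {W : Type*} {S : Scheme W} {core : List W} {num : W → ℕ} {data : ℕ → ℕ} {L D : ℕ}
  {A : W → ℕ}

/-- Append the reverse of the second buffer to the first one. -/
def copyLoop : Prog := .loop 21 9 <| .block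
  [.bin .sub 9 9 2, .load 15 9, .store 23 15, .bin .add 23 23 2]

/-- Store the last occurrence of each vertex. -/
def lastLoop : Prog := .loop 15 23 <| .block
  [.load 16 15, .bin .add 16 16 2, .store 16 15, .bin .add 15 15 2]

/-- Output the path. -/
def printLoop : Prog := .loop 15 23 <| .block
  [.load 16 15, .load 17 16, .out 17, .bin .add 16 16 2, .load 15 16, .bin .add 15 15 2]

/-- The second buffer is read from its end. The hypothesis `hB` keeps the copy below it, so nothing
unread is overwritten. -/
theorem spec_copyLoop {B e : ℕ} (b : List ℕ) (reg mem : ℕ → ℕ) (hB : e + b.length ≤ B)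
    (hw : B + b.length < 2 ^ w) (h2 : reg 2 = 1) (h21 : reg 21 = B) (h9 : reg 9 = B + b.length)
    (h23 : reg 23 = e) (hb : Holds mem B b)
    (hK : ∀ reg' mem' : ℕ → ℕ, (∀ i, i ≠ 9 → i ≠ 15 → i ≠ 23 → reg' i = reg i) →
      reg' 23 = e + b.length → (∀ a < e, mem' a = mem a) → Holds mem' e b.reverse →
      Spec w N n ⟨K, reg', mem', o⟩ ν T) :
    Spec w N (n + 10 * b.length + 1) ⟨copyLoop :: K, reg, mem, o⟩ ν T := by
  induction b using List.reverseRecOn generalizing reg mem e with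
  | nil =>
    refine spec_loop_neg (by rw [h9, h21]; simp) ?_
    exact hK reg mem (fun _ _ _ _ => rfl) (by simpa using h23) (fun _ _ => rfl) trivial
  | append_singleton b a ih =>
    rw [holds_append] at hb
    obtain ⟨hb, ha, -⟩ := hb
    simp only [List.length_append, List.length_singleton] at hB hw h9 hK ⊢
    rw [show n + 10 * (b.length + 1) + 1 = n + 10 * b.length + 1 + 10 by ring]
    refine spec_loop_pos (by rw [h9, h21]; omega) ?_
    refine spec_sub (x := B + (b.length + 1)) (y := 1) (by simp [h9]) (by simp [h2]) ?_
    refine spec_read (x := B + b.length) (y := a) (by simp) ha ?_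
    refine spec_write (x := e) (y := a) (by simp [h23]) (by simp) ?_
    refine spec_add (x := e) (y := 1) (by simp [h23]) (by simp [h2]) (by omega) ?_
    refine spec_block_nil ?_
    refine ih (e := e + 1) _ _ (by omega) (by omega) (by simp [h2]) (by simp [h21])
      (by simp) (by simp)
      (hb.congr fun c h1 h2 => Function.update_of_ne (by omega) _ _) ?_
    intro reg' mem' hreg' h23' hmem' hh
    refine hK reg' mem' ?_ (by rw [h23']; ring) ?_ ?_
    · intro i h1 h2 h3
      rw [hreg' i h1 h2 h3]
      simp [h1, h2, h3]
    · intro c hc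
      rw [hmem' c (by omega), Function.update_of_ne (by omega)]
    · rw [List.reverse_append]
      exact ⟨by rw [hmem' e (by omega), Function.update_self], hh⟩

/-- The loop invariant `hlast` describes the recorded last occurrence of v by the number of entries
after it. That number is the length of `rtakeWhile`, the list on which `eraseLoops` recurses. -/
theorem spec_lastLoop [DecidableEq W] (hL : Layout S core num w data L A D) {B : ℕ} (hB : L ≤ B)
    (x : List W) (hw : B + x.length < 2 ^ w) (l₁ l₂ : List W) (hx : x = l₁ ++ l₂)
    (reg mem : ℕ → ℕ) (h2 : reg 2 = 1) (h15 : reg 15 = B + l₁.length)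
    (h23 : reg 23 = B + x.length) (hmem : ∀ a < L, (∀ v, a ≠ A v + 1) → mem a = data a)
    (hold : Holds mem B (x.map A))
    (hlast : ∀ v ∈ l₁, mem (A v + 1) + 1 + (l₁.rtakeWhile (· ≠ v)).length = B + l₁.length)
    (hK : ∀ reg' mem' : ℕ → ℕ, (∀ i, i ≠ 15 → i ≠ 16 → reg' i = reg i) →
      (∀ a < L, (∀ v, a ≠ A v + 1) → mem' a = data a) → Holds mem' B (x.map A) →
      (∀ v ∈ x, mem' (A v + 1) + 1 + (x.rtakeWhile (· ≠ v)).length = B + x.length) →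
      Spec w N n ⟨K, reg', mem', o⟩ ν T) :
    Spec w N (n + 10 * l₂.length + 1) ⟨lastLoop :: K, reg, mem, o⟩ ν T := by
  have hLw := hL.L_lt
  induction l₂ generalizing l₁ reg mem with
  | nil =>
    obtain rfl : x = l₁ := by simpa using hx
    refine spec_loop_neg (by rw [h15, h23]; simp) ?_
    exact hK reg mem (fun _ _ _ => rfl) hmem hold hlast
  | cons v l₂ ih =>
    have hlen : x.length = l₁.length + (l₂.length + 1) := by simp [hx]
    have hv : mem (B + l₁.length) = A v := by
      have := hold
      rw [hx, List.map_append, holds_append, List.length_map, List.map_cons] at this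
      exact this.2.1
    have hAv := hL.A_add_le v
    rw [show n + 10 * (v :: l₂).length + 1 = n + 10 * l₂.length + 1 + 10 by
      simp only [List.length_cons]; ring]
    refine spec_loop_pos (by rw [h15, h23]; omega) ?_
    refine spec_read (x := B + l₁.length) (y := A v) (by simp [h15]) hv ?_
    refine spec_add (x := A v) (y := 1) (by simp) (by simp [h2]) (by omega) ?_
    refine spec_write (x := A v + 1) (y := B + l₁.length) (by simp) (by simp [h15]) ?_
    refine spec_add (x := B + l₁.length) (y := 1) (by simp [h15]) (by simp [h2]) (by omega) ?_
    refine spec_block_nil ?_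
    refine ih (l₁ ++ [v]) (by simp [hx]) _ _ (by simp [h2]) (by simp; ring) (by simp [h23])
      ?_ ?_ ?_ ?_
    · intro a ha h
      rw [Function.update_of_ne (h v), hmem a ha h]
    · exact hold.congr fun a h1 _ => Function.update_of_ne (by omega) _ _
    · intro u hu
      rw [List.rtakeWhile_concat]
      by_cases huv : u = v
      · subst huv
        simp
        ring
      · have hul : u ∈ l₁ := by simpa [huv] using hu
        have := hlast u hul
        rw [Function.update_of_ne]
        · simp [Ne.symm huv] at this ⊢
          omega
        · intro h
          exact huv (hL.A_inj u v (by omega))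
    · intro reg' mem' hreg'
      refine hK reg' mem' fun i h1 h2 => ?_
      rw [hreg' i h1 h2]
      simp [h1, h2]

theorem spec_printLoop [DecidableEq W] (hL : Layout S core num w data L A D) {B : ℕ}
    (x : List W) (hw : B + x.length < 2 ^ w) (m : ℕ) (l₁ l₂ : List W) (hx : x = l₁ ++ l₂)
    (hm : l₂.length ≤ m) (reg mem : ℕ → ℕ) (h2 : reg 2 = 1) (h15 : reg 15 = B + l₁.length)
    (h23 : reg 23 = B + x.length) (hmem : ∀ a < L, (∀ v, a ≠ A v + 1) → mem a = data a)
    (hold : Holds mem B (x.map A))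
    (hlast : ∀ v ∈ x, mem (A v + 1) + 1 + (x.rtakeWhile (· ≠ v)).length = B + x.length) :
    Spec w N (14 * m + 2) ⟨[printLoop, .block []], reg, mem, o⟩
      (fun l => if l = o ++ (eraseLoops l₂).map num then 1 else 0) 0 := by
  have hLw := hL.L_lt
  induction m generalizing l₁ l₂ reg o with
  | zero =>
    obtain rfl : l₂ = [] := List.eq_nil_of_length_eq_zero (by omega)
    refine spec_loop_neg (by rw [h15, h23, hx]; simp) ?_
    simp only [eraseLoops, List.map_nil, List.append_nil]
    exact spec_block_nil (spec_halt _ _ _ _ _ _ _)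
  | succ m ih =>
    cases l₂ with
    | nil =>
      refine spec_loop_neg (by rw [h15, h23, hx]; simp) ?_
      simp only [eraseLoops, List.map_nil, List.append_nil]
      exact spec_block_nil (spec_halt _ _ _ _ _ _ _)
    | cons v l₂ =>
      have hlen : x.length = l₁.length + (l₂.length + 1) := by simp [hx]
      have hv : mem (B + l₁.length) = A v := by
        have := hold
        rw [hx, List.map_append, holds_append, List.length_map, List.map_cons] at this
        exact this.2.1
      have hAv := hL.A_add_le v
      have hl := hlast v (by simp [hx])
      -- The last occurrence of v in the whole walk is also the last one in the rest, so the
      -- recorded address leads to the tail on which `eraseLoops` recurses.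
      rw [hx, rtakeWhile_append_cons, ← hx] at hl
      have hsuf := List.rtakeWhile_suffix (· ≠ v) l₂
      have hsl := hsuf.length_le
      obtain ⟨l₃, hl₃⟩ := hsuf
      have hl₃len : l₃.length + (l₂.rtakeWhile (· ≠ v)).length = l₂.length := by
        conv_rhs => rw [← hl₃]
        simp
      rw [show 14 * (m + 1) + 2 = 14 * m + 2 + 14 by ring]
      refine spec_loop_pos (by rw [h15, h23]; omega) ?_
      refine spec_read (x := B + l₁.length) (y := A v) (by simp [h15]) hv ?_
      refine spec_read (x := A v) (y := num v) (by simp)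
        (by rw [hmem _ (by omega) fun u h => hL.A_add_one_ne u v h.symm, hL.num_eq]) ?_
      refine spec_print (x := num v) (by simp) ?_
      refine spec_add (x := A v) (y := 1) (by simp) (by simp [h2]) (by omega) ?_
      refine spec_read (x := A v + 1) (y := mem (A v + 1)) (by simp) rfl ?_
      refine spec_add (x := mem (A v + 1)) (y := 1) (by simp) (by simp [h2]) (by omega) ?_
      refine spec_block_nil ?_
      have := ih (l₁ ++ v :: l₃) (l₂.rtakeWhile (· ≠ v)) (by rw [hx, List.append_assoc, List.cons_append, hl₃])
        (by simp at hm; omega) (o := o ++ [num v])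
        (reg := Function.update (Function.update (Function.update (Function.update (Function.update
          reg 16 (A v)) 17 (num v)) 16 (A v + 1)) 15 (mem (A v + 1))) 15 (mem (A v + 1) + 1))
        (by simp [h2]) (by simp; omega) (by simp [h23])
      rw [eraseLoops, List.map_cons]
      simp only [List.append_assoc, List.cons_append, List.nil_append] at this
      exact this

end WordRAM

/-! ### The complete sampling program. -/

namespace WordRAM

variable {w N n : ℕ} {ν : List ℕ → ℝ≥0∞} {T : ℝ≥0∞} {K : List Prog} {reg mem : ℕ → ℕ} {o : List ℕ}
variable {W : Type*} {S : Scheme W} {core : List W} {num : W → ℕ} {data : ℕ → ℕ} {L D : ℕ}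
  {A : W → ℕ}

/-- The sampling program: choose a random element of the core, walk to it from both sides, and
output the walk without its loops. -/
def sampler : Prog := .block
  -- The header cells 0, …, 5 hold the address of the dead record, the size of the core minus 1, the
  -- addresses of the tables of core vertices and of all vertices, and the starts of the two
  -- buffers.
  [.const 2 1, .const 3 2, .const 4 3, .const 5 4, .load 6 31, .load 15 2, .rand 15 15, .load 16 3,
    .bin .add 15 15 16, .load 7 15, .load 16 4, .bin .add 0 0 16, .load 0 0, .bin .add 1 1 16,
    .load 1 1, .load 20 5, .const 16 5, .load 21 16,
    .bin .add 8 0 31, .bin .add 9 20 31, .store 9 8, .bin .add 9 9 2, .bin .add 10 31 31, trialLoop,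
    .bin .add 23 9 31,
    .bin .add 8 1 31, .bin .add 9 21 31, .store 9 8, .bin .add 9 9 2, .bin .add 10 31 31, trialLoop,
    copyLoop, .bin .add 15 20 31, lastLoop, .bin .add 15 20 31, printLoop]

theorem Spec.toZero {c : Config} (h : Spec w N n c ν T) : Spec w N 0 c ν (T + n) :=
  h.weaken (fun _ => le_rfl) (by simp)

theorem spec_draw {r a y : ℕ} {ν : ℕ → List ℕ → ℝ≥0∞} {T : ℝ≥0∞} {ps : List Prog}
    (ha : reg a = y)
    (h : ∀ x ≤ y, Spec w N n ⟨.block ps :: K, Function.update reg r x, mem, o⟩ (ν x) T) :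
    Spec w N (n + 2) ⟨.block (.rand r a :: ps) :: K, reg, mem, o⟩
      (fun l => (unif y).expect fun x => ν x l) T := by
  subst ha
  have := spec_rand (T := fun _ => T) h
  rw [PMF.expect_const] at this
  exact spec_block_cons this

theorem Scheme.Efficient.length_le_of_mem {rank : W → ℕ} {J m : ℕ} (hS : S.Efficient rank J)
    {r v : W} (hr : S.final r) {a : List W} (ha : a ∈ (S.reach m v r).support) :
    (v :: a).length ≤ m * J + 1 := by
  simpa using hS.length_of_mem_reach hr ha

/-- The gap between the buffers in `hB₂` is twice the size of a half walk, because the second half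
is finally appended to the first. -/
theorem spec_sampler [DecidableEq W] (hL : Layout S core num w data L A D) {rank : W → ℕ} {J : ℕ}
    (hS : S.Efficient rank J) (hcore : core ≠ []) (hfin : ∀ r ∈ core, S.final r) (m : ℕ)
    (hm : ∀ v, rank v < m) (h6 : 6 < 2 ^ w) (hB₁ : L ≤ data 4)
    (hB₂ : data 4 + 2 * (m * J + 2) ≤ data 5) (hB₃ : data 5 + (m * J + 2) < 2 ^ w)
    (s t : W) (reg : ℕ → ℕ) (h0 : reg 0 = num s) (h1 : reg 1 = num t) (h31 : reg 31 = 0) :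
    Spec w N 0 ⟨[sampler], reg, data, []⟩
      (fun l => (S.walkLaw core m s t).expect fun x => if l = (eraseLoops x).map num then 1 else 0)
      ((2 * (m * (64 * J + 80)) + 60 * (m * J + 2) + 100 : ℕ)) := by
  have hLw := hL.L_lt
  have hpos : 0 < core.length := List.length_pos_iff.2 hcore
  obtain ⟨hd0, hd1, hL6⟩ := hL.header
  obtain ⟨hs1, hs2⟩ := hL.index_eq s
  obtain ⟨ht1, ht2⟩ := hL.index_eq t
  set c : ℝ≥0∞ := (m : ℝ≥0∞) * (64 * J + 80 : ℕ) with hc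
  suffices h : Spec w N (100 + 60 * (m * J + 2)) ⟨[sampler], reg, data, []⟩
      (fun l => (S.walkLaw core m s t).expect fun x => if l = (eraseLoops x).map num then 1 else 0)
      (c + c) by
    refine h.weaken (fun _ => le_rfl) (le_of_eq ?_)
    rw [hc]
    push_cast
    ring
  simp only [Scheme.walkLaw, PMF.expect_bind, PMF.expect_map]
  refine Spec.fuel (n := 100 + 60 * (m * J + 2)) ?_ (by omega)
  rw [show 100 + 60 * (m * J + 2) = (60 * (m * J + 2) + 52) + 48 by ring]
  refine spec_lit (by omega) (spec_lit (by omega) (spec_lit (by omega) (spec_lit (by omega) ?_)))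
  refine spec_read (x := 0) (y := D) (by simp [h31]) hd0 ?_
  refine spec_read (x := 1) (y := core.length - 1) (by simp) hd1 ?_
  refine spec_draw (y := core.length - 1) (by simp) ?_
  intro x hx
  have hxl : x < core.length := by omega
  obtain ⟨hc1, hc2⟩ := hL.core_eq x hxl
  have hr : S.final core[x] := hfin _ (List.getElem_mem hxl)
  rw [List.getD_eq_getElem _ _ hxl]
  set r := core[x] with hrdef
  refine spec_read (x := 2) (y := data 2) (by simp) rfl ?_
  refine spec_add (x := x) (y := data 2) (by simp) (by simp) (by omega) ?_
  refine spec_read (x := x + data 2) (y := A r) (by simp) hc2 ?_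
  refine spec_read (x := 3) (y := data 3) (by simp) rfl ?_
  refine spec_add (x := num s) (y := data 3) (by simp [h0]) (by simp) (by omega) ?_
  refine spec_read (x := num s + data 3) (y := A s) (by simp) hs2 ?_
  refine spec_add (x := num t) (y := data 3) (by simp [h1]) (by simp) (by omega) ?_
  refine spec_read (x := num t + data 3) (y := A t) (by simp) ht2 ?_
  refine spec_read (x := 4) (y := data 4) (by simp) rfl ?_
  refine spec_lit (by omega) ?_
  refine spec_read (x := 5) (y := data 5) (by simp) rfl ?_
  have hAs := hL.A_add_le s
  have hAt := hL.A_add_le t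
  refine spec_add (x := A s) (y := 0) (by simp) (by simp [h31]) (by omega) ?_
  refine spec_add (x := data 4) (y := 0) (by simp) (by simp [h31]) (by omega) ?_
  refine spec_write (x := data 4) (y := A s) (by simp) (by simp) ?_
  refine spec_add (x := data 4) (y := 1) (by simp) (by simp) (by omega) ?_
  refine spec_add (x := 0) (y := 0) (by simp [h31]) (by simp [h31]) (by omega) ?_
  refine spec_block_cons ?_
  have hmJ : m * J + 2 < 2 ^ w := by omega
  refine Spec.weaken (n := 0) (T := (c + ((60 * (m * J + 2) + 40 : ℕ) : ℝ≥0∞)) + c)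
    (spec_trialLoop (r := r) hL hS hr m s (hm s) _ _ (data 4 + 1) (by omega) (by omega) ?_
      ⟨by simp, by simp, by simp, by simp, by simp, by simp, by simp [h31]⟩ (by simp) (by simp)
      (by simp) (fun a l => (S.reach m t r).expect fun b =>
        if l = (eraseLoops (s :: a ++ (t :: b).reverse)).map num then 1 else 0) _ ?_)
    (fun _ => le_rfl) ?_
  · intro a ha
    rw [Function.update_of_ne (by omega)]
  swap
  · push_cast
    ring_nf
    gcongr
    norm_num
  intro a ha reg₁ mem₁ hreg₁ hmem₁ hh₁ h9₁
  have hla := Scheme.Efficient.length_le_of_mem hS hr ha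
  simp only [List.length_cons] at hla
  refine Spec.toZero ?_
  rw [show 60 * (m * J + 2) + 40 = (60 * (m * J + 2) + 27) + 13 by ring]
  have e31 : reg₁ 31 = 0 := by rw [hreg₁ 31 (by simp)]; simp [h31]
  have e2 : reg₁ 2 = 1 := by rw [hreg₁ 2 (by simp)]; simp
  have e21 : reg₁ 21 = data 5 := by rw [hreg₁ 21 (by simp)]; simp
  have e20 : reg₁ 20 = data 4 := by rw [hreg₁ 20 (by simp)]; simp
  have e1 : reg₁ 1 = A t := by rw [hreg₁ 1 (by simp)]; simp
  have hmem₁L : ∀ a < L, mem₁ a = data a := fun a ha => by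
    rw [hmem₁ a (by omega), Function.update_of_ne (by omega)]
  refine spec_add (x := data 4 + 1 + a.length) (y := 0) (by simp [h9₁]) (by simp [e31])
    (by omega) ?_
  refine spec_add (x := A t) (y := 0) (by simp [e1]) (by simp [e31]) (by omega) ?_
  refine spec_add (x := data 5) (y := 0) (by simp [e21]) (by simp [e31]) (by omega) ?_
  refine spec_write (x := data 5) (y := A t) (by simp) (by simp) ?_
  refine spec_add (x := data 5) (y := 1) (by simp) (by simp [e2]) (by omega) ?_
  refine spec_add (x := 0) (y := 0) (by simp [e31]) (by simp [e31]) (by omega) ?_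
  refine spec_block_cons ?_
  refine Spec.weaken (n := 0) (T := ((60 * (m * J + 2) + 27 : ℕ) : ℝ≥0∞) + c)
    (spec_trialLoop (r := r) hL hS hr m t (hm t) _ _ (data 5 + 1) (by omega) (by omega) ?_
      ⟨by simp [e2], by simp [hreg₁], by simp [hreg₁], by simp [hreg₁], by simp [hreg₁],
        by simp [hreg₁], by simp [e31]⟩ (by simp) (by simp)
      (by simp) (fun b l =>
        if l = (eraseLoops (s :: a ++ (t :: b).reverse)).map num then 1 else 0) _ ?_)
    (fun _ => le_rfl) ?_
  · intro a ha
    rw [Function.update_of_ne (by omega), hmem₁L a ha]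
  swap
  · rw [Nat.cast_zero, add_zero, add_comm]
  intro b hb reg₂ mem₂ hreg₂ hmem₂ hh₂ h9₂
  have hlb := Scheme.Efficient.length_le_of_mem hS hr hb
  simp only [List.length_cons] at hlb
  rw [← zero_add ((60 * (m * J + 2) + 27 : ℕ) : ℝ≥0∞)]
  refine Spec.toZero ?_
  have f2 : reg₂ 2 = 1 := by rw [hreg₂ 2 (by simp)]; simp [e2]
  have f31 : reg₂ 31 = 0 := by rw [hreg₂ 31 (by simp)]; simp [e31]
  have f20 : reg₂ 20 = data 4 := by rw [hreg₂ 20 (by simp)]; simp [e20]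
  have f21 : reg₂ 21 = data 5 := by rw [hreg₂ 21 (by simp)]; simp [e21]
  have f23 : reg₂ 23 = data 4 + 1 + a.length := by rw [hreg₂ 23 (by simp)]; simp
  set x := s :: a ++ (t :: b).reverse with hx
  have hxlen : x.length = a.length + b.length + 2 := by simp [hx]; ring
  have hxs : Holds mem₂ (data 4) ((s :: a).map A) := by
    refine ⟨?_, ?_⟩
    · rw [hmem₂ _ (by omega), Function.update_of_ne (by omega), hmem₁ _ (by omega),
        Function.update_self]
    · refine hh₁.congr fun i hi1 hi2 => ?_
      rw [List.length_map] at hi2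
      rw [hmem₂ _ (by omega), Function.update_of_ne (by omega)]
  have hxt : Holds mem₂ (data 5) ((t :: b).map A) :=
    ⟨by rw [hmem₂ _ (by omega), Function.update_self], hh₂⟩
  refine Spec.fuel (n := (14 * (m * J + 2) * 2 + 1 + 4 + 10 * x.length + 1 + 1 + 2 +
    10 * ((t :: b).map A).length + 1 + 1)) ?_ (by simp only [List.length_map, List.length_cons]; omega)
  refine spec_block_cons ?_
  refine spec_copyLoop (B := data 5) (e := data 4 + 1 + a.length) ((t :: b).map A) reg₂ mem₂
    (by simp only [List.length_map, List.length_cons]; omega)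
    (by simp only [List.length_map, List.length_cons]; omega) f2 f21
    (by simp only [List.length_map, List.length_cons]; omega) f23 hxt ?_
  intro reg₃ mem₃ hreg₃ h23₃ hmem₃ hh₃
  have g2 : reg₃ 2 = 1 := by rw [hreg₃ 2 (by simp) (by simp) (by simp), f2]
  have g31 : reg₃ 31 = 0 := by rw [hreg₃ 31 (by simp) (by simp) (by simp), f31]
  have g20 : reg₃ 20 = data 4 := by rw [hreg₃ 20 (by simp) (by simp) (by simp), f20]
  simp only [List.length_map, List.length_cons] at h23₃
  refine spec_add (x := data 4) (y := 0) (by simp [g20]) (by simp [g31]) (by omega) ?_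
  refine spec_block_cons ?_
  have hx₃ : Holds mem₃ (data 4) (x.map A) := by
    rw [hx, List.map_append, holds_append, List.map_reverse]
    refine ⟨hxs.congr fun i hi1 hi2 => hmem₃ i ?_, ?_⟩
    · simp only [List.length_map, List.length_cons] at hi2
      omega
    · simpa [add_assoc, add_comm, add_left_comm] using hh₃
  refine spec_lastLoop hL (B := data 4) hB₁ x (by omega) [] x rfl _ mem₃ (by simp [g2]) (by simp)
    (by simp; omega) ?_ hx₃ (by simp) ?_
  · intro i hi _
    rw [hmem₃ i (by omega), hmem₂ i (by omega), Function.update_of_ne (by omega), hmem₁L i hi]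
  intro reg₄ mem₄ hreg₄ hmem₄ hh₄ hlast₄
  refine spec_add (x := data 4) (y := 0) (by simp [hreg₄, g20]) (by simp [hreg₄, g31])
    (by omega) ?_
  refine spec_block_cons ?_
  have := spec_printLoop (N := N) hL (B := data 4) x (by omega) (2 * (m * J + 2)) [] x rfl (by omega)
    (Function.update reg₄ 15 (data 4 + 0)) mem₄ (by simp [hreg₄, g2]) (by simp)
    (by simp [hreg₄]; omega) hmem₄ hh₄ hlast₄ (o := [])
  rw [List.nil_append] at this
  refine Spec.fuel this ?_
  omega

end WordRAM


/-! ## Storing a scheme -/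

namespace WordRAM

section Store

variable {W : Type*} [Fintype W] (S : Scheme W) (num : W ≃ Fin (Fintype.card W)) (core : List W)
  (entries : W → List (List ℕ ⊕ ℕ)) (goal : W → ℕ → ℕ) (G Q J K B : ℕ)

/-- The size of a record. -/
def recSize : ℕ := 5 + G + Q + 3 * J + K * J

/-- The address of the record of `v`. -/
def addr (v : W) : ℕ := 6 + 2 * Fintype.card W + recSize G Q J K * num v

/-- The address of the record for undefined positions. -/
def deadAddr (W : Type*) [Fintype W] (G Q J K : ℕ) : ℕ :=
  6 + 2 * Fintype.card W + recSize G Q J K * Fintype.card W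

/-- The size of the data structure. -/
def storeSize (W : Type*) [Fintype W] (G Q J K : ℕ) : ℕ :=
  6 + 2 * Fintype.card W + recSize G Q J K * (Fintype.card W + 1)

/-- The three words describing the `j`-th random choice of a trial from `v`. -/
def entryWord (v : W) (j i : ℕ) : ℕ :=
  match (entries v)[j]? with
  | some (.inl l) => [l.length - 1, addr num G Q J K v + (5 + G + Q + 3 * J + K * j), 0].getD i 0
  -- A single choice, stored as goal code g in the record of the target, after its five fixed words.
  | some (.inr g) => [0, 5 + g, 1].getD i 0
  | none => 0

/-- The words of the record of `v`. -/
def field (v : W) (o : ℕ) : ℕ :=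
  -- A record consists of five fixed words (number, scratch cell, both ends of the script, final
  -- flag), G goal codes, the results of the moves at the offsets given by their codes, three words
  -- per choice, and the lists of codes.
  if o < 5 then
    [(num v : ℕ), 0, addr num G Q J K v + (5 + G + Q),
      addr num G Q J K v + (5 + G + Q) + 3 * (entries v).length,
      if S.final v then 1 else 0].getD o 0
  else if o < 5 + G then goal v (o - 5)
  else if o < 5 + G + Q then (S.move v o).elim (deadAddr W G Q J K) (addr num G Q J K)
  else if o < 5 + G + Q + 3 * J then
    entryWord num entries G Q J K v ((o - (5 + G + Q)) / 3) ((o - (5 + G + Q)) % 3)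
  else
    match (entries v)[(o - (5 + G + Q + 3 * J)) / K]? with
    | some (.inl l) => l.getD ((o - (5 + G + Q + 3 * J)) % K) 0
    | _ => 0

/-- The word at address `a`. -/
def storeWord (a : ℕ) : ℕ :=
  if a < 6 then
    [deadAddr W G Q J K, core.length - 1, 6 + Fintype.card W, 6, storeSize W G Q J K, B].getD a 0
  else if a < 6 + Fintype.card W then 6 + 2 * Fintype.card W + recSize G Q J K * (a - 6)
  else if a < 6 + 2 * Fintype.card W then
    (core.map (addr num G Q J K)).getD (a - (6 + Fintype.card W)) 0
  else if h : (a - (6 + 2 * Fintype.card W)) / recSize G Q J K < Fintype.card W then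
    field S num entries goal G Q J K (num.symm ⟨_, h⟩)
      ((a - (6 + 2 * Fintype.card W)) % recSize G Q J K)
  -- All words of the dead record are its own address, so every move from it stays there.
  else deadAddr W G Q J K

theorem storeWord_record {v : W} {o : ℕ} (ho : o < recSize G Q J K) :
    storeWord S num core entries goal G Q J K B (addr num G Q J K v + o) =
      field S num entries goal G Q J K v o := by
  have h1 : addr num G Q J K v + o - (6 + 2 * Fintype.card W) =
      recSize G Q J K * (num v : ℕ) + o := by
    unfold addr
    omega
  have h2 : (recSize G Q J K * (num v : ℕ) + o) / recSize G Q J K = num v := by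
    rw [Nat.mul_add_div (by omega), Nat.div_eq_of_lt ho, add_zero]
  have h3 : (recSize G Q J K * (num v : ℕ) + o) % recSize G Q J K = o := by
    rw [Nat.mul_add_mod, Nat.mod_eq_of_lt ho]
  have h4 : 6 + 2 * Fintype.card W ≤ addr num G Q J K v + o := by
    unfold addr
    omega
  unfold storeWord
  rw [if_neg (by omega), if_neg (by omega), if_neg (by omega)]
  simp only [h1, h2, h3, Fin.eta, Equiv.symm_apply_apply]
  rw [dif_pos (num v).2]

theorem storeWord_dead {o : ℕ} (ho : o < recSize G Q J K) :
    storeWord S num core entries goal G Q J K B (deadAddr W G Q J K + o) =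
      deadAddr W G Q J K := by
  have h1 : deadAddr W G Q J K + o - (6 + 2 * Fintype.card W) =
      recSize G Q J K * Fintype.card W + o := by
    unfold deadAddr
    omega
  have h2 : (recSize G Q J K * Fintype.card W + o) / recSize G Q J K = Fintype.card W := by
    rw [Nat.mul_add_div (by omega), Nat.div_eq_of_lt ho, add_zero]
  have h4 : 6 + 2 * Fintype.card W ≤ deadAddr W G Q J K + o := by
    unfold deadAddr
    omega
  unfold storeWord
  rw [if_neg (by omega), if_neg (by omega), if_neg (by omega)]
  simp only [h1, h2, lt_irrefl, dite_false]

theorem addr_add_lt {v : W} {o : ℕ} (ho : o < recSize G Q J K) :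
    addr num G Q J K v + o < deadAddr W G Q J K := by
  unfold addr deadAddr
  have := (num v).2
  have : recSize G Q J K * (num v + 1) ≤ recSize G Q J K * Fintype.card W :=
    Nat.mul_le_mul_left _ this
  rw [mul_add] at this
  omega

theorem deadAddr_add_lt {o : ℕ} (ho : o < recSize G Q J K) :
    deadAddr W G Q J K + o < storeSize W G Q J K := by
  unfold storeSize deadAddr
  rw [mul_add]
  omega

/-- By `hcode`, codes are exactly offsets in the table of moves. The hypothesis `hw` makes the
stored words and the two buffers behind them addressable. -/
theorem exists_layout (m w : ℕ)
    (hscript : ∀ v r, S.script v r = (entries v).map (Sum.elim id fun i => [goal r i]))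
    (hlen : ∀ v, (entries v).length ≤ J)
    (hcode : ∀ v r, ∀ l ∈ S.script v r, ∀ c ∈ l, 5 + G ≤ c ∧ c < 5 + G + Q)
    (hK : ∀ v, ∀ l, Sum.inl l ∈ entries v → l.length ≤ K)
    (hG : ∀ v, ∀ i, Sum.inr i ∈ entries v → i < G)
    (hcore : core.length ≤ Fintype.card W)
    (hw : storeSize W G Q J K + 3 * (m * J + 2) < 2 ^ w) :
    ∃ data : List ℕ, data.length = storeSize W G Q J K ∧ (∀ x ∈ data, x < 2 ^ w) ∧
      (∃ A D, Layout S core (fun v => (num v : ℕ)) w (fun a => data.getD a 0)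
        (storeSize W G Q J K) A D) ∧
      data.getD 4 0 = storeSize W G Q J K ∧
      data.getD 5 0 = storeSize W G Q J K + 2 * (m * J + 2) := by
  set L := storeSize W G Q J K with hLdef
  set X := storeWord S num core entries goal G Q J K (L + 2 * (m * J + 2)) with hX
  -- Reduction modulo 2^w makes the bound on the words immediate; the words that the layout speaks
  -- of are small enough not to be changed by it.
  refine ⟨(List.range L).map fun a => X a % 2 ^ w, by simp, ?_, ?_⟩
  · intro x hx
    obtain ⟨a, -, rfl⟩ := List.mem_map.1 hx
    exact Nat.mod_lt _ (by positivity)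
  have hget : ∀ a < L, X a < 2 ^ w →
      ((List.range L).map fun a => X a % 2 ^ w).getD a 0 = X a := by
    intro a ha hlt
    rw [List.getD_eq_getElem _ _ (by simpa using ha)]
    simp [Nat.mod_eq_of_lt hlt]
  have hn : Fintype.card W ≤ L := by rw [hLdef, storeSize]; omega
  have h6L : 6 ≤ L := by rw [hLdef, storeSize]; omega
  have hrec5 : 5 ≤ recSize G Q J K := by unfold recSize; omega
  have hDL : deadAddr W G Q J K < L := by
    simpa using deadAddr_add_lt (W := W) G Q J K (o := 0) (by omega)
  have hAL : ∀ v o, o < recSize G Q J K → addr num G Q J K v + o < L := fun v o ho =>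
    (addr_add_lt num G Q J K ho).trans hDL
  have hrecget : ∀ v o, o < recSize G Q J K → ∀ y, field S num entries goal G Q J K v o = y →
      y < 2 ^ w → ((List.range L).map fun a => X a % 2 ^ w).getD (addr num G Q J K v + o) 0 = y := by
    intro v o ho y hy hlt
    have := storeWord_record S num core entries goal G Q J K (L + 2 * (m * J + 2)) (v := v) ho
    rw [hget _ (hAL v o ho) (by rw [hX, this, hy]; exact hlt), hX, this, hy]
  have hhead : ∀ a < 6, ∀ y, [deadAddr W G Q J K, core.length - 1, 6 + Fintype.card W, 6, L,
      L + 2 * (m * J + 2)].getD a 0 = y → y < 2 ^ w →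
      ((List.range L).map fun a => X a % 2 ^ w).getD a 0 = y := by
    intro a ha y hy hlt
    have : X a = y := by rw [hX, storeWord, if_pos ha]; exact hy
    rw [hget a (by omega) (this ▸ hlt), this]
  have hLn : 6 + 2 * Fintype.card W ≤ L := by rw [hLdef, storeSize]; omega
  refine ⟨⟨addr num G Q J K, deadAddr W G Q J K, ?_⟩, hhead 4 (by simp) _ rfl (by omega),
    hhead 5 (by simp) _ rfl (by omega)⟩
  have hA0 : ∀ v, addr num G Q J K v < deadAddr W G Q J K := fun v => by
    simpa using addr_add_lt num G Q J K (o := 0) (v := v) (by omega)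
  have hlast : ∀ v, 3 * (entries v).length ≤ 3 * J := fun v => by have := hlen v; omega
  refine ⟨by omega, hA0, hDL, ?_, ?_, ?_, ?_, ?_, ?_, ?_, ?_, ?_, ?_⟩
  · intro u v h
    unfold addr at h
    have : recSize G Q J K * (num u : ℕ) = recSize G Q J K * (num v : ℕ) := by omega
    exact num.injective (Fin.ext (Nat.eq_of_mul_eq_mul_left (by omega) this))
  · intro u v h
    unfold addr at h
    have h1 : recSize G Q J K * (num u : ℕ) + 1 = recSize G Q J K * (num v : ℕ) := by omega
    have : (recSize G Q J K * (num u : ℕ) + 1) % recSize G Q J K = 1 := by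
      rw [Nat.mul_add_mod, Nat.mod_eq_of_lt (by omega)]
    rw [h1, Nat.mul_mod_right] at this
    omega
  · exact fun v => hAL v 4 (by omega)
  · intro v
    exact hrecget v 0 (by omega) _ rfl (by have := (num v).2; simp; omega)
  · intro v
    refine hrecget v 4 (by omega) _ ?_ ?_
    · simp [field]
    · split_ifs <;> omega
  · intro v
    have hrec : 5 + G + Q + 3 * (entries v).length ≤ recSize G Q J K := by
      have := hlast v
      unfold recSize
      omega
    have hend : addr num G Q J K v + recSize G Q J K ≤ deadAddr W G Q J K := by
      have := addr_add_lt num G Q J K (v := v) (o := recSize G Q J K - 1) (by omega)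
      omega
    refine ⟨addr num G Q J K v + (5 + G + Q), (entries v).length,
      hrecget v 2 (by omega) _ (by simp [field]) (by omega),
      hrecget v 3 (by omega) _ (by simp [field]) (by omega), by omega, fun r => ?_⟩
    have hl : (S.script v r).length = (entries v).length := by simp [hscript]
    refine ⟨hl, fun j hj => ?_⟩
    rw [hl] at hj
    have hj3 : 5 + G + Q + 3 * j + 3 ≤ 5 + G + Q + 3 * J := by have := hlen v; omega
    have hfield : ∀ i < 3, field S num entries goal G Q J K v (5 + G + Q + 3 * j + i) =
        entryWord num entries G Q J K v j i := by
      intro i hi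
      rw [field, if_neg (by omega), if_neg (by omega), if_neg (by omega), if_pos (by omega)]
      congr 1 <;> omega
    have hrec3 : 5 + G + Q + 3 * j + 3 ≤ recSize G Q J K := by unfold recSize; omega
    have hsj : (S.script v r)[j]'(by omega) = Sum.elim id (fun i => [goal r i]) (entries v)[j] := by
      simp [hscript]
    have hcj := hcode v r _ (List.getElem_mem (by omega : j < (S.script v r).length))
    have hKJ : K * j + K ≤ K * J := by
      have : j + 1 ≤ J := by have := hlen v; omega
      calc K * j + K = K * (j + 1) := by ring
        _ ≤ K * J := Nat.mul_le_mul_left _ this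
    have hentry : ∀ i < 3, ∀ y, entryWord num entries G Q J K v j i = y → y < 2 ^ w →
        ((List.range L).map fun a => X a % 2 ^ w).getD
          (addr num G Q J K v + (5 + G + Q) + 3 * j + i) 0 = y := by
      intro i hi y hy hlt
      have := hrecget v (5 + G + Q + 3 * j + i) (by omega) y (by rw [hfield i hi, hy]) hlt
      rw [← this]
      congr 1
      ring
    have hmem : (entries v)[j] ∈ entries v := List.getElem_mem hj
    rw [hsj] at hcj ⊢
    cases he : (entries v)[j] with
    | inl l =>
      rw [he] at hmem hcj
      have hlK := hK v l hmem
      have hw0 : ∀ i, entryWord num entries G Q J K v j i =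
          [l.length - 1, addr num G Q J K v + (5 + G + Q + 3 * J + K * j), 0].getD i 0 := by
        intro i
        simp [entryWord, List.getElem?_eq_getElem hj, he]
      have hKw : K * j + K < recSize G Q J K := by unfold recSize; omega
      refine ⟨_, _, hentry 0 (by simp) (l.length - 1) (by simp [hw0]) (by omega),
        hentry 1 (by simp) _ rfl ?_, hentry 2 (by simp) _ rfl ?_, ?_, ?_⟩
      · simp only [hw0, List.getD_cons_succ, List.getD_cons_zero]
        have := hAL v (5 + G + Q + 3 * J + K * j)
        unfold recSize at *
        omega
      · simp [hw0]
      · simp [hw0]; omega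
      · intro x hx
        simp only [hw0, List.getD_cons_succ, List.getD_cons_zero, zero_mul, add_zero]
        simp only [Sum.elim_inl, id_eq] at hx hcj ⊢
        have ho : 5 + G + Q + 3 * J + K * j + x < recSize G Q J K := by
          unfold recSize
          omega
        have hcx := hcj l[x] (List.getElem_mem hx)
        have := hrecget v _ ho l[x] ?_ ?_
        · rw [show x + (addr num G Q J K v + (5 + G + Q + 3 * J + K * j)) =
            addr num G Q J K v + (5 + G + Q + 3 * J + K * j + x) by ring]
          exact ⟨hAL v _ ho, this⟩
        · rw [field, if_neg (by omega), if_neg (by omega), if_neg (by omega), if_neg (by omega)]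
          rw [show 5 + G + Q + 3 * J + K * j + x - (5 + G + Q + 3 * J) = K * j + x by omega,
            Nat.mul_add_div (by omega), Nat.div_eq_of_lt (by omega), add_zero, Nat.mul_add_mod,
            Nat.mod_eq_of_lt (by omega), List.getElem?_eq_getElem hj, he]
          exact List.getD_eq_getElem _ _ hx
        · have := hAL v (5 + G + Q - 1) (by unfold recSize; omega)
          omega
    | inr g =>
      rw [he] at hmem hcj
      have hg := hG v g hmem
      have hw0 : ∀ i, entryWord num entries G Q J K v j i = [0, 5 + g, 1].getD i 0 := by
        intro i
        simp [entryWord, List.getElem?_eq_getElem hj, he]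
      have h5g : 5 + g < recSize G Q J K := by unfold recSize; omega
      refine ⟨_, _, hentry 0 (by simp) 0 (by simp [hw0]) (by omega),
        hentry 1 (by simp) _ rfl ?_, hentry 2 (by simp) _ rfl ?_, ?_, ?_⟩
      · have := hAL v _ h5g
        simp [hw0]
        omega
      · simp only [hw0, List.getD_cons_succ, List.getD_cons_zero]; omega
      · have := hA0 r
        simp [hw0]
        omega
      · intro x hx
        simp only [Sum.elim_inr, List.length_singleton, Nat.lt_one_iff] at hx hcj ⊢
        subst hx
        have hcx := hcj (goal r g) (by simp)
        simp only [hw0, List.getD_cons_succ, List.getD_cons_zero, one_mul, zero_add]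
        have := hrecget r _ h5g (goal r g) ?_ ?_
        · rw [add_comm (5 + g)]
          exact ⟨hAL r _ h5g, by simpa using this⟩
        · rw [field, if_neg (by omega), if_pos (by omega)]
          congr 1
          omega
        · have := hAL v (5 + G + Q - 1) (by unfold recSize; omega)
          omega
  · intro v r l hl c hc o
    obtain ⟨h1, h2⟩ := hcode v r l hl c hc
    have hcr : c < recSize G Q J K := by unfold recSize; omega
    cases o with
    | none =>
      simp only [Option.elim_none, Scheme.moveO, Option.bind_none]
      have := storeWord_dead S num core entries goal G Q J K (L + 2 * (m * J + 2)) hcr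
      rw [add_comm]
      have hlt := deadAddr_add_lt (W := W) G Q J K hcr
      exact ⟨hlt, by rw [hget _ hlt (by rw [hX, this]; omega), hX, this]⟩
    | some y =>
      simp only [Option.elim_some, Scheme.moveO, Option.bind_some]
      rw [add_comm]
      refine ⟨hAL y c hcr, hrecget y c hcr _ ?_ ?_⟩
      · rw [field, if_neg (by omega), if_neg (by omega), if_pos h2]
      · cases S.move y c with
        | none => simp only [Option.elim_none]; omega
        | some z => have := hA0 z; simp only [Option.elim_some]; omega
  · exact ⟨hhead 0 (by simp) _ rfl (by omega), hhead 1 (by simp) _ rfl (by omega), h6L⟩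
  · intro i hi
    have h2 : ((List.range L).map fun a => X a % 2 ^ w).getD 2 0 = 6 + Fintype.card W :=
      hhead 2 (by simp) _ rfl (by omega)
    simp only [h2]
    have hx : X (i + (6 + Fintype.card W)) = addr num G Q J K core[i] := by
      rw [hX, storeWord, if_neg (by omega), if_neg (by omega), if_pos (by omega),
        Nat.add_sub_cancel, List.getD_eq_getElem _ _ (by simpa using hi), List.getElem_map]
    refine ⟨by omega, ?_⟩
    have := hA0 core[i]
    rw [hget _ (by omega) (by rw [hx]; omega), hx]
  · intro v
    have h3 : ((List.range L).map fun a => X a % 2 ^ w).getD 3 0 = 6 :=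
      hhead 3 (by simp) _ rfl (by omega)
    have hv := (num v).2
    simp only [h3]
    have hx : X (num v + 6) = addr num G Q J K v := by
      rw [hX, storeWord, if_neg (by omega), if_pos (by omega), Nat.add_sub_cancel]
      rfl
    refine ⟨by omega, ?_⟩
    have := hA0 v
    rw [hget _ (by omega) (by rw [hx]; omega), hx]

end Store

end WordRAM


/-! ## Semi-hypercubes in terms of vertices -/

namespace SemiHypercube

variable {k d : ℕ}

/-- The strings `u` and `v` agree on their first `l` digits. -/
def Agree (l : ℕ) (u v : Fin d → Fin k) : Prop := ∀ i : Fin d, i.1 < l → u i = v i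

theorem Agree.refl (l : ℕ) (u : Fin d → Fin k) : Agree l u u := fun _ _ => rfl

theorem Agree.symm {l : ℕ} {u v : Fin d → Fin k} (h : Agree l u v) : Agree l v u :=
  fun i hi => (h i hi).symm

theorem Agree.trans {l : ℕ} {u v x : Fin d → Fin k} (h : Agree l u v) (h' : Agree l v x) :
    Agree l u x := fun i hi => (h i hi).trans (h' i hi)

theorem Agree.mono {l l' : ℕ} {u v : Fin d → Fin k} (h : Agree l u v) (hl : l' ≤ l) :
    Agree l' u v := fun i hi => h i (by omega)

theorem Agree.succ {l : Fin d} {u v : Fin d → Fin k} (h : Agree l u v) (hl : u l = v l) :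
    Agree (l + 1) u v := fun i hi => by
  rcases Nat.lt_succ_iff_lt_or_eq.1 hi with h1 | h1
  · exact h i h1
  · rw [Fin.ext h1]
    exact hl

theorem agree_zero (u v : Fin d → Fin k) : Agree 0 u v := fun _ h => absurd h (Nat.not_lt_zero _)

theorem Agree.eq {l : ℕ} {u v : Fin d → Fin k} (h : Agree l u v) (hl : d ≤ l) : u = v :=
  funext fun i => h i (by omega)

open scoped Classical in
/-- The cluster of the prefix of length `l` of `v`. -/
noncomputable def cl (V : Finset (Fin d → Fin k)) (v : Fin d → Fin k) (l : ℕ) : Finset V :=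
  Finset.univ.filter fun u => Agree l u.1 v

theorem mem_cl {V : Finset (Fin d → Fin k)} {v : Fin d → Fin k} {l : ℕ} {u : V} :
    u ∈ cl V v l ↔ Agree l u.1 v := by
  simp [cl]

/-- The cluster of the prefix of length `l` of `v` is too small to be solid. -/
def Crit (τ : ℝ) (V : Finset (Fin d → Fin k)) (v : Fin d → Fin k) (l : ℕ) : Prop :=
  ((cl V v l).card : ℝ) < (1 - τ) * (k : ℝ) ^ (d - l)

open scoped Classical in
/-- The digits of the solid children of the prefix of length `l` of `v`. -/
noncomputable def sol (τ : ℝ) (V : Finset (Fin d → Fin k)) (v : Fin d → Fin k) (l : Fin d) :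
    Finset (Fin k) :=
  Finset.univ.filter fun i => ∃ u : V, Agree l u.1 v ∧ u.1 l = i ∧ ¬ Crit τ V u.1 (l + 1)

theorem mem_sol {τ : ℝ} {V : Finset (Fin d → Fin k)} {v : Fin d → Fin k} {l : Fin d} {i : Fin k} :
    i ∈ sol τ V v l ↔ ∃ u : V, Agree l u.1 v ∧ u.1 l = i ∧ ¬ Crit τ V u.1 (l + 1) := by
  simp [sol]

open scoped Classical in
/-- A semi-hypercube with small `τ` and large `k`, in terms of its vertices:
`nb y l x` is the vertex of `[k]^d` that is reached
from `y` by changing the digit with index `l` to `x`. -/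
structure Cube (τ : ℝ) (V : Finset (Fin d → Fin k)) (G : SimpleGraph V)
    (nb : (Fin d → Fin k) → Fin d → Fin k → (Fin d → Fin k)) : Prop where
  tau_pos : 0 < τ
  d_pos : 0 < d
  tau_le : τ ≤ 1 / (27 * (d : ℝ))
  le_k : 27 * 2 ^ d ≤ k
  agree_nb : ∀ y (l : Fin d) x, Agree l (nb y l x) y
  nb_apply : ∀ y l x, nb y l x l = x
  nb_nb : ∀ y l x, nb (nb y l x) l (y l) = y
  adj_nb : ∀ (y z : V) l x, nb y l x = z → y = z ∨ G.Adj y z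
  exists_nb : ∀ y z : V, G.Adj y z → ∃ l x, nb y l x = z
  crit_unique : ∀ (u v : V) (l : Fin d), Agree l u.1 v.1 → Crit τ V u.1 (l + 1) →
    Crit τ V v.1 (l + 1) → u.1 l = v.1 l
  -- The degree condition in complementary form: at most a tenth of the pairs of a vertex of the
  -- critical child and a solid digit lack their edge.
  crit_degree : ∀ (v : V) (l : Fin d), Crit τ V v.1 (l + 1) →
    10 * (((cl V v.1 (l + 1)) ×ˢ (sol τ V v.1 l)).filter fun p => nb p.1 l p.2 ∉ V).card ≤
      (sol τ V v.1 l).card * (cl V v.1 (l + 1)).card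

theorem take_ofFn_eq_iff (l : ℕ) (u v : Fin d → Fin k) :
    (List.ofFn u).take l = (List.ofFn v).take l ↔ Agree l u v := by
  constructor
  · intro h i hi
    have h1 := congrArg (fun L => L[i.1]?) h
    simpa [List.getElem?_take, hi, i.2] using h1
  · intro h
    apply List.ext_getElem
    · simp
    · intro i h1 h2
      simp only [List.getElem_take, List.getElem_ofFn]
      simp only [List.length_take, List.length_ofFn] at h1
      exact h ⟨i, by omega⟩ (by simp; omega)

theorem take_prefix_iff (l : ℕ) (hl : l ≤ d) (u v : Fin d → Fin k) :
    (List.ofFn v).take l <+: List.ofFn u ↔ Agree l u v := by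
  rw [List.prefix_iff_eq_take]
  simp only [List.length_take, List.length_ofFn, min_eq_left hl]
  rw [take_ofFn_eq_iff]
  exact ⟨Agree.symm, Agree.symm⟩

theorem take_append_singleton (l : Fin d) (v : Fin d → Fin k) (i : Fin k) :
    (List.ofFn v).take l ++ [i] = (List.ofFn (Function.update v l i)).take (l + 1) := by
  have h1 : (List.ofFn v).take l = (List.ofFn (Function.update v l i)).take l := by
    rw [take_ofFn_eq_iff]
    intro j hj
    rw [Function.update_of_ne (Fin.ne_of_lt hj)]
  rw [h1, List.take_add_one]
  simp

theorem append_singleton_prefix_iff (l : Fin d) (u v : Fin d → Fin k) (i : Fin k) :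
    ((List.ofFn v).take l ++ [i]) <+: List.ofFn u ↔ Agree l u v ∧ u l = i := by
  rw [take_append_singleton, take_prefix_iff _ l.2]
  constructor
  · intro h
    refine ⟨fun j hj => ?_, ?_⟩
    · rw [h j (by omega), Function.update_of_ne (Fin.ne_of_lt hj)]
    · rw [h l (by omega), Function.update_self]
  · rintro ⟨h, rfl⟩
    refine Agree.succ (fun j hj => ?_) (by simp)
    rw [h j hj, Function.update_of_ne (Fin.ne_of_lt hj)]

theorem cluster_take (V : Finset (Fin d → Fin k)) (v : Fin d → Fin k) (l : ℕ) (hl : l ≤ d) :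
    cluster V ((List.ofFn v).take l) = cl V v l := by
  ext u
  rw [mem_cl]
  simp [cluster, take_prefix_iff l hl]

theorem isCritical_take_iff {τ : ℝ} {V : Finset (Fin d → Fin k)} {v : Fin d → Fin k} {l : ℕ}
    (hl : l ≤ d) :
    IsCritical τ V ((List.ofFn v).take l) ↔ 0 < (cl V v l).card ∧ Crit τ V v l := by
  simp [IsCritical, Crit, cluster_take V v l hl, min_eq_left hl]

theorem cl_congr {V : Finset (Fin d → Fin k)} {u v : Fin d → Fin k} {l : ℕ} (h : Agree l u v) :
    cl V u l = cl V v l := by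
  ext x
  rw [mem_cl, mem_cl]
  exact ⟨fun h' => h'.trans h, fun h' => h'.trans h.symm⟩

theorem Crit.congr {τ : ℝ} {V : Finset (Fin d → Fin k)} {u v : Fin d → Fin k} {l : ℕ}
    (h : Agree l u v) (hu : Crit τ V u l) : Crit τ V v l := by
  rwa [Crit, ← cl_congr h]

theorem self_mem_cl {V : Finset (Fin d → Fin k)} (v : V) (l : ℕ) : v ∈ cl V v.1 l :=
  mem_cl.2 (Agree.refl _ _)

theorem cl_card_pos {V : Finset (Fin d → Fin k)} (v : V) (l : ℕ) : 0 < (cl V v.1 l).card :=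
  Finset.card_pos.2 ⟨v, self_mem_cl v l⟩

theorem isCritical_append_iff {τ : ℝ} {V : Finset (Fin d → Fin k)} {v : Fin d → Fin k} {l : Fin d}
    {i : Fin k} : IsCritical τ V ((List.ofFn v).take l ++ [i]) ↔
      ∃ u : V, Agree l u.1 v ∧ u.1 l = i ∧ Crit τ V u.1 (l + 1) := by
  rw [take_append_singleton, isCritical_take_iff l.2]
  constructor
  · rintro ⟨h1, h2⟩
    obtain ⟨u, hu⟩ := Finset.card_pos.1 h1
    rw [mem_cl] at hu
    refine ⟨u, fun j hj => ?_, ?_, h2.congr hu.symm⟩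
    · rw [hu j (by omega), Function.update_of_ne (Fin.ne_of_lt hj)]
    · rw [hu l (by omega), Function.update_self]
  · rintro ⟨u, h1, h2, h3⟩
    have h : Agree (l + 1) u.1 (Function.update v l i) := by
      refine Agree.succ (fun j hj => ?_) (by simpa using h2)
      rw [h1 j hj, Function.update_of_ne (Fin.ne_of_lt hj)]
    exact ⟨Finset.card_pos.2 ⟨u, mem_cl.2 h⟩, h3.congr h⟩

theorem numSolid_take {τ : ℝ} {V : Finset (Fin d → Fin k)} {v : Fin d → Fin k} {l : Fin d} :
    numSolid τ V ((List.ofFn v).take l) = (sol τ V v l).card := by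
  classical
  unfold numSolid
  congr 1
  ext i
  simp only [mem_sol, Finset.mem_filter, isCritical_append_iff]
  have hne : (cluster V ((List.ofFn v).take l ++ [i])).Nonempty ↔
      ∃ u : V, Agree l u.1 v ∧ u.1 l = i := by
    constructor
    · rintro ⟨u, hu⟩
      simp only [cluster, Finset.mem_filter, append_singleton_prefix_iff] at hu
      exact ⟨u, hu.2⟩
    · rintro ⟨u, hu⟩
      refine ⟨u, ?_⟩
      simp only [cluster, Finset.mem_filter, append_singleton_prefix_iff]
      exact ⟨Finset.mem_univ _, hu⟩
  rw [hne]
  constructor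
  · rintro ⟨-, ⟨u, h1, h2⟩, h3⟩
    exact ⟨u, h1, h2, fun h => h3 ⟨u, h1, h2, h⟩⟩
  · rintro ⟨u, h1, h2, h3⟩
    refine ⟨Finset.mem_univ _, ⟨u, h1, h2⟩, ?_⟩
    rintro ⟨u', h1', h2', h3'⟩
    exact h3 (h3'.congr (Agree.succ (h1'.trans h1.symm) (h2'.trans h2.symm)))

theorem IsFull.existsUnique {G₀ : SimpleGraph (Fin d → Fin k)} (h : IsFull k d G₀)
    (y : Fin d → Fin k) (l : Fin d) (x : Fin k) (hx : y l ≠ x) :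
    ∃! v, (Agree l v y ∧ v l = x) ∧ G₀.Adj y v := by
  have := h.2.2 ((List.ofFn y).take l) (by simp) (y l) x hx y
    ((append_singleton_prefix_iff l y y (y l)).2 ⟨Agree.refl _ _, rfl⟩)
  simpa only [append_singleton_prefix_iff] using this

open scoped Classical in
/-- The vertex that is reached from `y` by changing the digit with index `l` to `x`. -/
noncomputable def IsFull.nb {G₀ : SimpleGraph (Fin d → Fin k)} (h : IsFull k d G₀)
    (y : Fin d → Fin k) (l : Fin d) (x : Fin k) : Fin d → Fin k :=
  if hx : y l = x then y else (h.existsUnique y l x hx).choose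

section IsFull

variable {G₀ : SimpleGraph (Fin d → Fin k)} (h : IsFull k d G₀)

theorem IsFull.nb_self (y : Fin d → Fin k) (l : Fin d) : h.nb y l (y l) = y := by
  simp [IsFull.nb]

theorem IsFull.nb_spec {y : Fin d → Fin k} {l : Fin d} {x : Fin k} (hx : y l ≠ x) :
    (Agree l (h.nb y l x) y ∧ h.nb y l x l = x) ∧ G₀.Adj y (h.nb y l x) := by
  rw [IsFull.nb, dif_neg hx]
  exact (h.existsUnique y l x hx).choose_spec.1

theorem IsFull.eq_nb {y z : Fin d → Fin k} {l : Fin d} (hz : Agree l z y) (hzl : y l ≠ z l)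
    (hadj : G₀.Adj y z) : h.nb y l (z l) = z :=
  (h.existsUnique y l (z l) hzl).unique (h.nb_spec hzl) ⟨⟨hz, rfl⟩, hadj⟩

theorem IsFull.agree_nb (y : Fin d → Fin k) (l : Fin d) (x : Fin k) : Agree l (h.nb y l x) y := by
  by_cases hx : y l = x
  · rw [← hx, h.nb_self]
    exact Agree.refl _ _
  · exact (h.nb_spec hx).1.1

theorem IsFull.nb_apply (y : Fin d → Fin k) (l : Fin d) (x : Fin k) : h.nb y l x l = x := by
  by_cases hx : y l = x
  · rw [← hx, h.nb_self]
  · exact (h.nb_spec hx).1.2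

theorem IsFull.nb_nb (y : Fin d → Fin k) (l : Fin d) (x : Fin k) :
    h.nb (h.nb y l x) l (y l) = y := by
  by_cases hx : y l = x
  · subst hx
    rw [h.nb_self, h.nb_self]
  · refine h.eq_nb (h.agree_nb y l x).symm ?_ (h.nb_spec hx).2.symm
    rw [h.nb_apply]
    exact Ne.symm hx

end IsFull

/-- An edge belongs to the first digit in which its ends differ. This makes it a change of that
digit in the sense of `IsFull.nb`. -/
theorem IsSemiHypercube.exists_cube {τ : ℝ} {V : Finset (Fin d → Fin k)} {G : SimpleGraph V}
    (hG : IsSemiHypercube τ V G) (hτ : τ ≤ 1 / (27 * (d : ℝ))) (hk : 27 * 2 ^ d ≤ k) :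
    ∃ nb, Cube τ V G nb := by
  classical
  obtain ⟨G₀, h, rfl⟩ := hG.induced
  have hex : ∀ y z : Fin d → Fin k, G₀.Adj y z → ∃ l : Fin d, Agree l z y ∧ y l ≠ z l := by
    intro y z hadj
    have hne : ∃ i : ℕ, ∃ hi : i < d, y ⟨i, hi⟩ ≠ z ⟨i, hi⟩ := by
      by_contra! hcon
      exact hadj.ne (funext fun i => hcon i i.2)
    obtain ⟨hi, hd⟩ := Nat.find_spec hne
    refine ⟨⟨Nat.find hne, hi⟩, fun j hj => ?_, hd⟩
    have := Nat.find_min hne hj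
    push Not at this
    exact (this j.2).symm
  refine ⟨h.nb, hG.tau_pos, h.2.1, hτ, hk, h.agree_nb, h.nb_apply, h.nb_nb, ?_, ?_, ?_, ?_⟩
  · rintro y z l x hz
    by_cases hx : y.1 l = x
    · left
      rw [← hx, h.nb_self] at hz
      exact Subtype.ext hz
    · right
      have := (h.nb_spec hx).2
      rw [hz] at this
      exact this
  · intro y z hadj
    obtain ⟨l, h1, h2⟩ := hex y.1 z.1 hadj
    exact ⟨l, z.1 l, h.eq_nb h1 h2 hadj⟩
  · intro u v l huv hu hv
    refine hG.critical_unique ((List.ofFn v.1).take l) (by simp) (u.1 l) (v.1 l) ?_ ?_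
    · exact isCritical_append_iff.2 ⟨u, huv, rfl, hu⟩
    · exact isCritical_append_iff.2 ⟨v, Agree.refl _ _, rfl, hv⟩
  · intro v l hv
    have key := hG.critical_degree ((List.ofFn v.1).take l) (by simp) (v.1 l)
      (isCritical_append_iff.2 ⟨v, Agree.refl _ _, rfl, hv⟩)
    rw [numSolid_take, take_append_singleton, Function.update_eq_self, cluster_take _ _ _ l.2,
      cluster_take _ _ _ (by omega)] at key
    set A := cl V v.1 (l + 1) with hA
    set S := sol τ V v.1 l with hS
    -- An edge that leaves the critical child ends in a solid sibling, because only one child is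
    -- critical. So it is determined by its start and a solid digit.
    have hle : ((G₀.comap Subtype.val).interedges A (cl V v.1 l \ A)).card ≤
        ((A ×ˢ S).filter fun p => h.nb p.1 l p.2 ∈ V).card := by
      have hpair : ∀ e ∈ (G₀.comap (Subtype.val : V → _)).interedges A (cl V v.1 l \ A),
          h.nb e.1 l (e.2.1 l) = e.2 ∧ e.1 ∈ A ∧ e.2.1 l ∈ S := by
        rintro ⟨u, z⟩ he
        rw [SimpleGraph.mem_interedges_iff, Finset.mem_sdiff] at he
        obtain ⟨hu, ⟨hz1, hz2⟩, hadj⟩ := he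
        rw [hA, mem_cl] at hu hz2
        rw [mem_cl] at hz1
        have hz3 : z.1 l ≠ v.1 l := fun hcon => hz2 (hz1.succ hcon)
        have hul : u.1 l = v.1 l := hu l (by omega)
        refine ⟨h.eq_nb (hz1.trans (hu.mono (by omega)).symm) ?_ hadj, ?_, ?_⟩
        · rw [hul]
          exact hz3.symm
        · rw [hA, mem_cl]; exact hu
        · rw [hS, mem_sol]
          refine ⟨z, hz1, rfl, fun hc => hz3 ?_⟩
          refine hG.critical_unique ((List.ofFn v.1).take l) (by simp) _ _ ?_ ?_
          · exact isCritical_append_iff.2 ⟨z, hz1, rfl, hc⟩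
          · exact isCritical_append_iff.2 ⟨v, Agree.refl _ _, rfl, hv⟩
      refine Finset.card_le_card_of_injOn (fun e => (e.1, e.2.1 l)) ?_ ?_
      · intro e he
        obtain ⟨h1, h2, h3⟩ := hpair e he
        simp only [Finset.coe_filter, Finset.mem_product, Set.mem_ofPred_eq]
        refine ⟨⟨h2, h3⟩, ?_⟩
        rw [h1]
        exact e.2.2
      · intro e he e' he' heq
        obtain ⟨h1, -, -⟩ := hpair e he
        obtain ⟨h1', -, -⟩ := hpair e' he'
        simp only [Prod.mk.injEq] at heq
        refine Prod.ext heq.1 (Subtype.ext ?_)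
        rw [← h1, ← h1', heq.1, heq.2]
    have hsum := Finset.card_filter_add_card_filter_not (s := A ×ˢ S)
      (fun p => h.nb p.1 l p.2 ∈ V)
    rw [Finset.card_product] at hsum
    have h2 : (9 / 10 : ℝ) * S.card * A.card ≤
        (((A ×ˢ S).filter fun p => h.nb p.1 l p.2 ∈ V).card : ℝ) :=
      key.le.trans (by exact_mod_cast hle)
    have h3 : ((((A ×ˢ S).filter fun p => h.nb p.1 l p.2 ∈ V).card : ℝ)) +
        (((A ×ˢ S).filter fun p => h.nb p.1 l p.2 ∉ V).card : ℝ) = A.card * S.card := by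
      exact_mod_cast hsum
    have h4 : (10 : ℝ) * (((A ×ˢ S).filter fun p => h.nb p.1 l p.2 ∉ V).card : ℝ) ≤
        S.card * A.card := by
      nlinarith
    exact_mod_cast h4

end SemiHypercube

namespace SemiHypercube

variable {k d : ℕ} {τ : ℝ} {V : Finset (Fin d → Fin k)} {G : SimpleGraph V}
  {nb : (Fin d → Fin k) → Fin d → Fin k → (Fin d → Fin k)}

/-! ### Cluster sizes -/

open scoped Classical in
/-- The strings that agree with `v` on the first `l` digits. -/
noncomputable def fullCl (v : Fin d → Fin k) (l : ℕ) : Finset (Fin d → Fin k) :=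
  Finset.univ.filter fun u => Agree l u v

theorem mem_fullCl {u v : Fin d → Fin k} {l : ℕ} : u ∈ fullCl v l ↔ Agree l u v := by
  simp [fullCl]

theorem card_fullCl (v : Fin d → Fin k) (l : ℕ) : (fullCl v l).card = k ^ (d - l) := by
  classical
  have h : fullCl v l = Fintype.piFinset fun i : Fin d => if i.1 < l then {v i} else Finset.univ := by
    ext u
    rw [mem_fullCl, Fintype.mem_piFinset]
    refine forall_congr' fun i => ?_
    by_cases hi : i.1 < l <;> simp [hi]
  rw [h, Fintype.card_piFinset]
  have : ∀ i : Fin d, (if i.1 < l then ({v i} : Finset (Fin k)) else Finset.univ).card =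
      if i.1 < l then 1 else k := fun i => by split_ifs <;> simp
  simp_rw [this]
  rw [Finset.prod_ite, Finset.prod_const_one, one_mul, Finset.prod_const]
  congr 1
  have h1 : (Finset.univ.filter fun i : Fin d => i.1 < l).card = min d l := Fin.card_filter_val_lt
  have h2 := Finset.card_filter_add_card_filter_not (s := (Finset.univ : Finset (Fin d)))
    (fun i : Fin d => i.1 < l)
  rw [Finset.card_univ, Fintype.card_fin, h1] at h2
  omega

theorem card_cl_eq (v : Fin d → Fin k) (l : ℕ) [DecidablePred (· ∈ V)] :
    (cl V v l).card = ((fullCl v l).filter (· ∈ V)).card := by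
  refine Finset.card_bij (fun u _ => u.1) ?_ (fun _ _ _ _ h => Subtype.ext h) ?_
  · intro u hu
    rw [Finset.mem_filter, mem_fullCl]
    exact ⟨mem_cl.1 hu, u.2⟩
  · intro u hu
    rw [Finset.mem_filter, mem_fullCl] at hu
    exact ⟨⟨u, hu.2⟩, mem_cl.2 hu.1, rfl⟩

theorem card_cl_le (v : Fin d → Fin k) (l : ℕ) : (cl V v l).card ≤ k ^ (d - l) := by
  classical
  rw [card_cl_eq, ← card_fullCl v l]
  exact Finset.card_filter_le _ _

open scoped Classical in
/-- The strings with the prefix of length `l` of `v` that are not in `V`. -/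
noncomputable def missing (V : Finset (Fin d → Fin k)) (v : Fin d → Fin k) (l : ℕ) :
    Finset (Fin d → Fin k) :=
  (fullCl v l).filter (· ∉ V)

theorem mem_missing {v z : Fin d → Fin k} {l : ℕ} :
    z ∈ missing V v l ↔ Agree l z v ∧ z ∉ V := by
  simp [missing, mem_fullCl]

theorem card_missing_le {v : Fin d → Fin k} {l : ℕ} (h : ¬ Crit τ V v l) :
    ((missing V v l).card : ℝ) ≤ τ * (k : ℝ) ^ (d - l) := by
  classical
  have h1 := Finset.card_filter_add_card_filter_not (s := fullCl v l) (· ∈ V)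
  rw [card_fullCl, ← card_cl_eq] at h1
  have h2 : ((cl V v l).card : ℝ) + (missing V v l).card = (k : ℝ) ^ (d - l) := by
    exact_mod_cast h1
  rw [Crit, not_lt] at h
  linarith

theorem Cube.tau_lt_one (H : Cube τ V G nb) : τ < 1 := by
  refine lt_of_le_of_lt H.tau_le ?_
  have : (1 : ℝ) ≤ d := by exact_mod_cast H.d_pos
  rw [div_lt_one (by positivity)]
  linarith

theorem Cube.k_pos (H : Cube τ V G nb) : 0 < k :=
  lt_of_lt_of_le (by positivity) H.le_k

/-- On level d a single vertex already fills its cluster, and τ > 0. -/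
theorem Cube.not_crit_d (H : Cube τ V G nb) (v : V) {l : ℕ} (hl : d ≤ l) :
    ¬ Crit τ V v.1 l := by
  have h1 := cl_card_pos v l
  have h2 : (1 : ℝ) ≤ (cl V v.1 l).card := by exact_mod_cast h1
  rw [Crit, Nat.sub_eq_zero_of_le hl]
  have := H.tau_pos
  intro h
  nlinarith

/-- The levels below `l` on which the cluster of `v` is critical. -/
noncomputable def critSet (τ : ℝ) (V : Finset (Fin d → Fin k)) (v : Fin d → Fin k) (l : ℕ) :
    Finset ℕ :=
  open scoped Classical in (Finset.Ioc l d).filter fun j => Crit τ V v j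

theorem mem_critSet {v : Fin d → Fin k} {l j : ℕ} :
    j ∈ critSet τ V v l ↔ (l < j ∧ j ≤ d) ∧ Crit τ V v j := by
  simp [critSet]

open scoped Classical in
/-- The vertices of a cluster that are on at least `c` critical levels below. -/
noncomputable def manyCrit (τ : ℝ) (V : Finset (Fin d → Fin k)) (v : Fin d → Fin k) (l c : ℕ) :
    Finset V :=
  (cl V v l).filter fun u => c ≤ (critSet τ V u.1 l).card

theorem mem_manyCrit {v : Fin d → Fin k} {l c : ℕ} {u : V} :
    u ∈ manyCrit τ V v l c ↔ Agree l u.1 v ∧ c ≤ (critSet τ V u.1 l).card := by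
  simp [manyCrit, mem_cl]

theorem critSet_succ (v : Fin d → Fin k) (l : Fin d) :
    (critSet τ V v l).card ≤ (critSet τ V v (l + 1)).card + 1 ∧
      (¬ Crit τ V v (l + 1) → critSet τ V v l = critSet τ V v (l + 1)) := by
  classical
  constructor
  · have : critSet τ V v l ⊆ insert (l.1 + 1) (critSet τ V v (l + 1)) := by
      intro j hj
      rw [Finset.mem_insert]
      rw [mem_critSet] at hj ⊢
      by_cases h : j = l.1 + 1
      · exact Or.inl h
      · exact Or.inr ⟨⟨by omega, hj.1.2⟩, hj.2⟩
    exact (Finset.card_le_card this).trans (Finset.card_insert_le _ _)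
  · intro h
    ext j
    rw [mem_critSet, mem_critSet]
    constructor
    · rintro ⟨⟨h1, h2⟩, h3⟩
      have : j ≠ l.1 + 1 := by rintro rfl; exact h h3
      exact ⟨⟨by omega, h2⟩, h3⟩
    · rintro ⟨⟨h1, h2⟩, h3⟩
      exact ⟨⟨by omega, h2⟩, h3⟩

/-- Being on a given critical level confines a vertex to one of k children and so costs a factor k;
the set of critical levels can be chosen in 2^n ways. In the induction, the vertices of the only
critical child need one critical level fewer, while those of the at most k other children still need
all of them. The factor k^c on the left avoids division, as c may exceed n. -/
theorem Cube.card_manyCrit_mul_le (H : Cube τ V G nb) (n l : ℕ) (hn : l + n = d)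
    (v : Fin d → Fin k) (c : ℕ) :
    (manyCrit τ V v l c).card * k ^ c ≤ 2 ^ n * k ^ n := by
  classical
  have hle : ∀ c, (manyCrit τ V v l c).card ≤ k ^ n := fun c => by
    refine (Finset.card_filter_le _ _).trans ?_
    have := card_cl_le (V := V) v l
    rwa [show d - l = n by omega] at this
  induction n generalizing l v c with
  | zero =>
    cases c with
    | zero => simpa using hle 0
    | succ c =>
      have : manyCrit τ V v l (c + 1) = ∅ := by
        rw [Finset.eq_empty_iff_forall_notMem]
        intro u hu
        have h1 := (mem_manyCrit.1 hu).2
        obtain ⟨j, hj⟩ := Finset.card_pos.1 (Nat.lt_of_lt_of_le (Nat.succ_pos c) h1)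
        rw [mem_critSet] at hj
        omega
      simp [this]
  | succ n ih =>
    cases c with
    | zero =>
      rw [pow_zero, mul_one]
      exact (hle 0).trans (Nat.le_mul_of_pos_left _ (by positivity))
    | succ c =>
      set l' : Fin d := ⟨l, by omega⟩ with hl'
      have ih' : ∀ v c, (manyCrit τ V v (l + 1) c).card * k ^ c ≤ 2 ^ n * k ^ n := fun v c =>
        ih (l + 1) (by omega) v c fun c => by
          refine (Finset.card_filter_le _ _).trans ?_
          have := card_cl_le (V := V) v (l + 1)
          rwa [show d - (l + 1) = n by omega] at this
      set A := (manyCrit τ V v l (c + 1)).filter fun u => Crit τ V u.1 (l + 1) with hA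
      set B := (manyCrit τ V v l (c + 1)).filter fun u => ¬ Crit τ V u.1 (l + 1) with hB
      have hAB : A.card + B.card = (manyCrit τ V v l (c + 1)).card :=
        Finset.card_filter_add_card_filter_not _
      have hAle : A.card * k ^ c ≤ 2 ^ n * k ^ n := by
        rcases A.eq_empty_or_nonempty with hem | ⟨u₀, hu₀⟩
        · simp [hem]
        · refine le_trans (Nat.mul_le_mul_right _ (Finset.card_le_card ?_)) (ih' u₀.1 c)
          intro u hu
          rw [hA, Finset.mem_filter, mem_manyCrit] at hu hu₀
          have hag : Agree l' u.1 u₀.1 := hu.1.1.trans hu₀.1.1.symm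
          have := H.crit_unique u u₀ l' hag hu.2 hu₀.2
          refine mem_manyCrit.2 ⟨hag.succ this, ?_⟩
          have := (critSet_succ (τ := τ) (V := V) u.1 l').1
          have := hu.1.2
          simp only [hl'] at *
          omega
      have hBle : B.card * k ^ (c + 1) ≤ k * (2 ^ n * k ^ n) := by
        have hsub : B ⊆ (Finset.univ : Finset (Fin k)).biUnion fun i =>
            manyCrit τ V (Function.update v l' i) (l + 1) (c + 1) := by
          intro u hu
          rw [hB, Finset.mem_filter, mem_manyCrit] at hu
          rw [Finset.mem_biUnion]
          refine ⟨u.1 l', Finset.mem_univ _, mem_manyCrit.2 ⟨?_, ?_⟩⟩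
          · refine Agree.succ (l := l') (fun j hj => ?_) (by simp)
            rw [hu.1.1 j hj, Function.update_of_ne (Fin.ne_of_lt hj)]
          · have := (critSet_succ (τ := τ) (V := V) u.1 l').2 hu.2
            rw [← this]
            exact hu.1.2
        have h1 := (Finset.card_le_card hsub).trans Finset.card_biUnion_le
        calc B.card * k ^ (c + 1)
            ≤ (∑ i : Fin k, (manyCrit τ V (Function.update v l' i) (l + 1) (c + 1)).card) *
              k ^ (c + 1) := Nat.mul_le_mul_right _ h1
          _ = ∑ i : Fin k, (manyCrit τ V (Function.update v l' i) (l + 1) (c + 1)).card *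
              k ^ (c + 1) := Finset.sum_mul _ _ _
          _ ≤ ∑ _i : Fin k, 2 ^ n * k ^ n := Finset.sum_le_sum fun i _ => ih' _ _
          _ = k * (2 ^ n * k ^ n) := by simp
      calc (manyCrit τ V v l (c + 1)).card * k ^ (c + 1)
          = k * (A.card * k ^ c) + B.card * k ^ (c + 1) := by rw [← hAB]; ring
        _ ≤ k * (2 ^ n * k ^ n) + k * (2 ^ n * k ^ n) :=
            add_le_add (Nat.mul_le_mul_left _ hAle) hBle
        _ = 2 ^ (n + 1) * k ^ (n + 1) := by ring

/-- At most one nonempty child is not solid; it accounts for the additional 1. -/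
theorem Cube.card_cl_le_sol (H : Cube τ V G nb) (v : Fin d → Fin k) (l : Fin d) :
    (cl V v l).card ≤ ((sol τ V v l).card + 1) * k ^ (d - (l + 1)) := by
  classical
  set D := (cl V v l).image fun u => u.1 l with hD
  have h1 : (cl V v l).card ≤ k ^ (d - (l + 1)) * D.card := by
    refine Finset.card_le_mul_card_image (cl V v l) _ fun i hi => ?_
    obtain ⟨u, hu, rfl⟩ := Finset.mem_image.1 hi
    refine (Finset.card_le_card ?_).trans (card_cl_le (V := V) u.1 (l + 1))
    intro x hx
    rw [Finset.mem_filter, mem_cl] at hx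
    rw [mem_cl] at hu ⊢
    exact (hx.1.trans hu.symm).succ hx.2
  have h2 : D.card ≤ (sol τ V v l).card + 1 := by
    have h3 : (D \ sol τ V v l).card ≤ 1 := by
      rw [Finset.card_le_one]
      have aux : ∀ i ∈ D \ sol τ V v l, ∃ u : V, Agree l u.1 v ∧ u.1 l = i ∧
          Crit τ V u.1 (l + 1) := by
        intro i hi
        rw [Finset.mem_sdiff, hD, Finset.mem_image, mem_sol] at hi
        obtain ⟨⟨u, hu, rfl⟩, hi⟩ := hi
        rw [mem_cl] at hu
        refine ⟨u, hu, rfl, ?_⟩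
        by_contra hc
        exact hi ⟨u, hu, rfl, hc⟩
      intro i hi j hj
      obtain ⟨u, hu1, rfl, hu2⟩ := aux i hi
      obtain ⟨u', hu1', rfl, hu2'⟩ := aux j hj
      exact H.crit_unique u u' l (hu1.trans hu1'.symm) hu2 hu2'
    have h4 := Finset.card_le_card_sdiff_add_card (s := D) (t := sol τ V v l)
    omega
  calc (cl V v l).card ≤ k ^ (d - (l + 1)) * D.card := h1
    _ ≤ k ^ (d - (l + 1)) * ((sol τ V v l).card + 1) := Nat.mul_le_mul_left _ h2
    _ = _ := mul_comm _ _

/-! ### The levels of a vertex -/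

/-- The prefix of length `l` of `v` has a solid child. -/
def HasSol (τ : ℝ) (V : Finset (Fin d → Fin k)) (v : Fin d → Fin k) (l : ℕ) : Prop :=
  ∃ u : V, Agree l u.1 v ∧ ¬ Crit τ V u.1 (l + 1)

theorem HasSol.congr {u v : Fin d → Fin k} {l : ℕ} (h : Agree l u v) (hu : HasSol τ V u l) :
    HasSol τ V v l := by
  obtain ⟨x, h1, h2⟩ := hu
  exact ⟨x, h1.trans h, h2⟩

theorem HasSol.sol_nonempty {v : Fin d → Fin k} {l : Fin d} (h : HasSol τ V v l) :
    (sol τ V v l).Nonempty := by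
  obtain ⟨x, h1, h2⟩ := h
  exact ⟨x.1 l, mem_sol.2 ⟨x, h1, rfl, h2⟩⟩

/-- The length of the shortest prefix with a solid child. -/
noncomputable def top (τ : ℝ) (V : Finset (Fin d → Fin k)) : ℕ :=
  sInf {l | ∃ v : V, HasSol τ V v.1 l}

theorem Cube.hasSol_pred (H : Cube τ V G nb) (v : V) : HasSol τ V v.1 (d - 1) := by
  refine ⟨v, Agree.refl _ _, ?_⟩
  exact H.not_crit_d v (by omega)

theorem Cube.top_lt (H : Cube τ V G nb) (v : V) : top τ V < d := by
  have : top τ V ≤ d - 1 := Nat.sInf_le ⟨v, H.hasSol_pred v⟩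
  have := H.d_pos
  omega

/-- Above the top no nonempty child is solid, so all are critical and there is only one on each
level. -/
theorem Cube.agree_top (H : Cube τ V G nb) (u v : V) : Agree (top τ V) u.1 v.1 := by
  have htop := H.top_lt v
  have : ∀ l ≤ top τ V, Agree l u.1 v.1 := by
    intro l
    induction l with
    | zero => intro _; exact agree_zero _ _
    | succ l ih =>
      intro hl
      have hag := ih (by omega)
      have hns : ∀ x : V, Crit τ V x.1 (l + 1) := by
        intro x
        by_contra hx
        exact Nat.notMem_of_lt_sInf (s := {l | ∃ v : V, HasSol τ V v.1 l}) hl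
          ⟨x, x, Agree.refl _ _, hx⟩
      exact Agree.succ (l := ⟨l, by omega⟩) hag
        (H.crit_unique u v ⟨l, by omega⟩ hag (hns u) (hns v))
  exact this _ le_rfl

theorem Cube.hasSol_top (H : Cube τ V G nb) (v : V) : HasSol τ V v.1 (top τ V) := by
  obtain ⟨u, hu⟩ := Nat.sInf_mem (s := {l | ∃ v : V, HasSol τ V v.1 l}) ⟨_, v, H.hasSol_pred v⟩
  exact hu.congr (H.agree_top u v)

theorem Cube.cl_top (H : Cube τ V G nb) (v : V) : cl V v.1 (top τ V) = Finset.univ :=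
  Finset.eq_univ_of_forall fun u => mem_cl.2 (H.agree_top u v)

open scoped Classical in
/-- The largest level below the top on which the cluster of `v` is critical. -/
noncomputable def base (τ : ℝ) (V : Finset (Fin d → Fin k)) (v : Fin d → Fin k) : ℕ :=
  Nat.findGreatest (fun l => l = top τ V ∨ top τ V < l ∧ Crit τ V v l) d

open scoped Classical in
/-- The largest level above the base on which the cluster of `v` has a solid child. -/
noncomputable def hopLevel (τ : ℝ) (V : Finset (Fin d → Fin k)) (v : Fin d → Fin k) : ℕ :=
  Nat.findGreatest (fun l => l < base τ V v ∧ HasSol τ V v l) d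

/-- No cluster of `v` below the top is critical. -/
def Final (τ : ℝ) (V : Finset (Fin d → Fin k)) (v : Fin d → Fin k) : Prop :=
  base τ V v = top τ V

theorem Cube.base_spec (H : Cube τ V G nb) (v : V) :
    base τ V v.1 = top τ V ∨ top τ V < base τ V v.1 ∧ Crit τ V v.1 (base τ V v.1) := by
  classical
  exact Nat.findGreatest_spec (P := fun l => l = top τ V ∨ top τ V < l ∧ Crit τ V v.1 l)
    (H.top_lt v).le (Or.inl rfl)

theorem Cube.top_le_base (H : Cube τ V G nb) (v : V) : top τ V ≤ base τ V v.1 := by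
  rcases H.base_spec v with h | h
  · exact h.ge
  · exact h.1.le

theorem Cube.not_crit_of_base_lt (H : Cube τ V G nb) (v : V) {l : ℕ} (hl : base τ V v.1 < l) :
    ¬ Crit τ V v.1 l := by
  classical
  rcases le_or_gt l d with hd | hd
  · have := Nat.findGreatest_is_greatest hl hd
    have h1 := H.top_le_base v
    intro hc
    exact this (Or.inr ⟨by omega, hc⟩)
  · exact H.not_crit_d v hd.le

theorem Cube.base_lt (H : Cube τ V G nb) (v : V) : base τ V v.1 < d := by
  rcases H.base_spec v with h | h
  · rw [h]
    exact H.top_lt v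
  · by_contra hcon
    exact H.not_crit_d v (not_lt.1 hcon) h.2

theorem Cube.hasSol_base (H : Cube τ V G nb) (v : V) : HasSol τ V v.1 (base τ V v.1) :=
  ⟨v, Agree.refl _ _, H.not_crit_of_base_lt v (Nat.lt_succ_self _)⟩

theorem Cube.final_iff (H : Cube τ V G nb) (v : V) :
    Final τ V v.1 ↔ critSet τ V v.1 (top τ V) = ∅ := by
  constructor
  · intro h
    rw [Finset.eq_empty_iff_forall_notMem]
    intro j hj
    rw [mem_critSet] at hj
    rw [Final] at h
    exact H.not_crit_of_base_lt v (by omega) hj.2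
  · intro h
    rcases H.base_spec v with h' | ⟨h1, h2⟩
    · exact h'
    · have := mem_critSet.2 ⟨⟨h1, (H.base_lt v).le⟩, h2⟩
      simp [h] at this

section Nonfinal

variable (H : Cube τ V G nb) {v : V} (hv : ¬ Final τ V v.1)
include H hv

theorem Cube.top_lt_base : top τ V < base τ V v.1 :=
  lt_of_le_of_ne (H.top_le_base v) (Ne.symm hv)

theorem Cube.crit_base : Crit τ V v.1 (base τ V v.1) :=
  ((H.base_spec v).resolve_left hv).2

theorem Cube.hopLevel_spec : hopLevel τ V v.1 < base τ V v.1 ∧ HasSol τ V v.1 (hopLevel τ V v.1) := by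
  classical
  exact Nat.findGreatest_spec (P := fun l => l < base τ V v.1 ∧ HasSol τ V v.1 l)
    (H.top_lt v).le ⟨H.top_lt_base hv, H.hasSol_top v⟩

theorem Cube.top_le_hopLevel : top τ V ≤ hopLevel τ V v.1 := by
  classical
  exact Nat.le_findGreatest (P := fun l => l < base τ V v.1 ∧ HasSol τ V v.1 l)
    (H.top_lt v).le ⟨H.top_lt_base hv, H.hasSol_top v⟩

theorem Cube.hopLevel_lt : hopLevel τ V v.1 < d :=
  (H.hopLevel_spec hv).1.trans (H.base_lt v)

omit hv in
theorem Cube.not_hasSol {l : ℕ} (h1 : hopLevel τ V v.1 < l) (h2 : l < base τ V v.1) :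
    ¬ HasSol τ V v.1 l := fun h => by
  classical
  exact Nat.findGreatest_is_greatest h1 (h2.trans (H.base_lt v)).le ⟨h2, h⟩

-- Strictly between the hop level and the base no prefix of v has a solid child, so each has only
-- its critical child. The critical child on level `hopLevel + 1` is therefore the base cluster
-- itself.
omit hv in
theorem Cube.agree_base {u : V} (hu : Agree (hopLevel τ V v.1 + 1) u.1 v.1) :
    Agree (base τ V v.1) u.1 v.1 := by
  have hbase := H.base_lt v
  have : ∀ l, hopLevel τ V v.1 < l → l ≤ base τ V v.1 → Agree l u.1 v.1 := by
    intro l hl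
    induction l, hl using Nat.le_induction with
    | base => intro _; exact hu
    | succ l hl ih =>
      intro hle
      have hag := ih (by omega)
      have hns : ∀ x : V, Agree l x.1 v.1 → Crit τ V x.1 (l + 1) := by
        intro x hx
        by_contra hcx
        exact H.not_hasSol hl (by omega) ⟨x, hx, hcx⟩
      exact Agree.succ (l := ⟨l, by omega⟩) hag
        (H.crit_unique u v ⟨l, by omega⟩ hag (hns u hag) (hns v (Agree.refl _ _)))
  rcases le_or_gt (base τ V v.1) (hopLevel τ V v.1 + 1) with h | h
  · exact hu.mono h
  · exact this _ (by omega) le_rfl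

omit hv in
theorem Cube.cl_eq_cl_base {l : ℕ} (h1 : hopLevel τ V v.1 < l) (h2 : l ≤ base τ V v.1) :
    cl V v.1 l = cl V v.1 (base τ V v.1) := by
  ext u
  rw [mem_cl, mem_cl]
  exact ⟨fun h => H.agree_base (h.mono h1), fun h => h.mono h2⟩

/-- The cluster is the same set as the base cluster, but it is measured against a larger full size.
-/
theorem Cube.crit_of_hopLevel_lt {l : ℕ} (h1 : hopLevel τ V v.1 < l) (h2 : l ≤ base τ V v.1) :
    Crit τ V v.1 l := by
  rw [Crit, H.cl_eq_cl_base h1 h2]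
  refine lt_of_lt_of_le (H.crit_base hv) ?_
  have hk : (1 : ℝ) ≤ k := by exact_mod_cast H.k_pos
  have := H.tau_lt_one
  exact mul_le_mul_of_nonneg_left (pow_le_pow_right₀ hk (by omega)) (by linarith)

end Nonfinal

end SemiHypercube

namespace SemiHypercube

variable {k d : ℕ} {τ : ℝ} {V : Finset (Fin d → Fin k)} {G : SimpleGraph V}
  {nb : (Fin d → Fin k) → Fin d → Fin k → (Fin d → Fin k)}

/-! ### The number of final vertices -/

open scoped Classical in
/-- The final vertices. -/
noncomputable def coreSet (τ : ℝ) (V : Finset (Fin d → Fin k)) : Finset V :=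
  Finset.univ.filter fun v => Final τ V v.1

theorem mem_coreSet {v : V} : v ∈ coreSet τ V ↔ Final τ V v.1 := by simp [coreSet]

theorem Cube.tau_le' (H : Cube τ V G nb) : d * τ ≤ 1 / 27 := by
  have hd : (1 : ℝ) ≤ d := by exact_mod_cast H.d_pos
  calc (d : ℝ) * τ ≤ d * (1 / (27 * d)) := mul_le_mul_of_nonneg_left H.tau_le (by linarith)
    _ = 1 / 27 := by field_simp

theorem Cube.tau_le_const (H : Cube τ V G nb) : τ ≤ 1 / 27 := by
  have hd : (1 : ℝ) ≤ d := by exact_mod_cast H.d_pos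
  have := H.tau_le'
  have := H.tau_pos
  nlinarith

/-- A solid child of the top prefix has at least (26/27)k^n vertices, at most k^n/27 of which are on
a further critical level, as 27 · 2^n ≤ k. This leaves (25/27)k^n final vertices in each of the |S|
≥ 1 solid children, against |V| ≤ (|S| + 1)k^n. -/
theorem Cube.card_le_coreSet (H : Cube τ V G nb) :
    Fintype.card V ≤ 3 * (coreSet τ V).card := by
  classical
  rcases isEmpty_or_nonempty V with he | ⟨⟨v⟩⟩
  · simp
  set l : Fin d := ⟨top τ V, H.top_lt v⟩ with hl
  set n := d - (l.1 + 1) with hn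
  have hln : l.1 + 1 + n = d := by have := l.2; omega
  set S := sol τ V v.1 l with hS
  have hk : (0 : ℝ) < (k : ℝ) ^ n := by
    have := H.k_pos
    positivity
  have hchild : ∀ i ∈ S, (25 / 27 : ℝ) * (k : ℝ) ^ n ≤
      ((coreSet τ V).filter fun u => u.1 l = i).card := by
    intro i hi
    obtain ⟨u, hu1, rfl, hu2⟩ := mem_sol.1 hi
    have hsub : cl V u.1 (l + 1) \ manyCrit τ V u.1 (l + 1) 1 ⊆
        (coreSet τ V).filter fun x => x.1 l = u.1 l := by
      intro x hx
      rw [Finset.mem_sdiff, mem_cl, mem_manyCrit, not_and, not_le, Nat.lt_one_iff] at hx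
      obtain ⟨hx1, hx2⟩ := hx
      rw [Finset.mem_filter, mem_coreSet, H.final_iff]
      refine ⟨?_, hx1 l (by omega)⟩
      have := (critSet_succ (τ := τ) (V := V) x.1 l).2 (fun hc => hu2 (hc.congr hx1))
      have h3 := Finset.card_eq_zero.1 (hx2 hx1)
      rw [← this] at h3
      exact h3
    have h1 := Finset.le_card_sdiff (manyCrit τ V u.1 (l + 1) 1) (cl V u.1 (l + 1))
    have h2 := Finset.card_le_card hsub
    have h3 := H.card_manyCrit_mul_le n (l + 1) hln u.1 1
    have h4 : 27 * (manyCrit τ V u.1 (l + 1) 1).card ≤ k ^ n := by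
      have h5 : 27 * 2 ^ n ≤ k :=
        (Nat.mul_le_mul_left _ (Nat.pow_le_pow_right (by norm_num) (by omega))).trans H.le_k
      have hp : 0 < 2 ^ n := by positivity
      rw [pow_one] at h3
      refine Nat.le_of_mul_le_mul_left (c := 2 ^ n) ?_ hp
      calc 2 ^ n * (27 * (manyCrit τ V u.1 (l + 1) 1).card)
          = (manyCrit τ V u.1 (l + 1) 1).card * (27 * 2 ^ n) := by ring
        _ ≤ _ := (Nat.mul_le_mul_left _ h5).trans h3
    rw [Crit, not_lt] at hu2
    have h6 := H.tau_le_const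
    have h7 : (27 : ℝ) * (manyCrit τ V u.1 (l + 1) 1).card ≤ (k : ℝ) ^ n := by exact_mod_cast h4
    have h8 : ((cl V u.1 (l + 1)).card : ℝ) - (manyCrit τ V u.1 (l + 1) 1).card ≤
        ((coreSet τ V).filter fun x => x.1 l = u.1 l).card := by
      have : (cl V u.1 (l + 1)).card ≤ (manyCrit τ V u.1 (l + 1) 1).card +
        ((coreSet τ V).filter fun x => x.1 l = u.1 l).card := by omega
      rw [sub_le_iff_le_add']
      exact_mod_cast this
    rw [← hn] at hu2
    nlinarith
  have h1 : (S.card : ℝ) * (25 / 27 * (k : ℝ) ^ n) ≤ (coreSet τ V).card := by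
    calc (S.card : ℝ) * (25 / 27 * (k : ℝ) ^ n) = ∑ _i ∈ S, (25 / 27 : ℝ) * (k : ℝ) ^ n := by
          rw [Finset.sum_const, nsmul_eq_mul]
      _ ≤ ∑ i ∈ S, (((coreSet τ V).filter fun u => u.1 l = i).card : ℝ) :=
          Finset.sum_le_sum hchild
      _ = ((∑ i ∈ S, ((coreSet τ V).filter fun u => u.1 l = i).card : ℕ) : ℝ) := by push_cast; rfl
      _ ≤ (coreSet τ V).card := by
          have hle : ∑ i ∈ S, ((coreSet τ V).filter fun u => u.1 l = i).card ≤
              (coreSet τ V).card := by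
            rw [← Finset.card_biUnion]
            · exact Finset.card_le_card
                (Finset.biUnion_subset.2 fun i _ => Finset.filter_subset _ _)
            · intro i _ j _ hij
              rw [Function.onFun, Finset.disjoint_left]
              intro u hu hu'
              rw [Finset.mem_filter] at hu hu'
              exact hij (hu.2.symm.trans hu'.2)
          exact_mod_cast hle
  have h2 := H.card_cl_le_sol v.1 l
  rw [show cl V v.1 l = Finset.univ from H.cl_top v, Finset.card_univ, ← hn] at h2
  have h3 : 1 ≤ S.card := Finset.card_pos.2 (H.hasSol_top v).sol_nonempty
  have h4 : (Fintype.card V : ℝ) ≤ (S.card + 1) * (k : ℝ) ^ n := by exact_mod_cast h2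
  have h5 : (1 : ℝ) ≤ S.card := by exact_mod_cast h3
  have h6 : (Fintype.card V : ℝ) ≤ 3 * (coreSet τ V).card := by nlinarith
  exact_mod_cast h6

/-! ### The rank -/

/-- The sum of the dimensions of the critical clusters of `v` below the top. -/
noncomputable def rank (τ : ℝ) (V : Finset (Fin d → Fin k)) (v : Fin d → Fin k) : ℕ :=
  ∑ l ∈ critSet τ V v (top τ V), (d - l)

theorem rank_le (v : Fin d → Fin k) : rank τ V v ≤ d ^ 2 := by
  have h1 : (critSet τ V v (top τ V)).card ≤ d := by
    have : critSet τ V v (top τ V) ⊆ Finset.Ioc (top τ V) d := fun j hj => by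
      rw [mem_critSet] at hj
      exact Finset.mem_Ioc.2 hj.1
    have := Finset.card_le_card this
    rw [Nat.card_Ioc] at this
    omega
  calc rank τ V v ≤ ∑ _l ∈ critSet τ V v (top τ V), d := Finset.sum_le_sum fun l _ => Nat.sub_le _ _
    _ = (critSet τ V v (top τ V)).card * d := by rw [Finset.sum_const, smul_eq_mul]
    _ ≤ d * d := Nat.mul_le_mul_right _ h1
    _ = d ^ 2 := (sq d).symm

/-- The elements of A outside the interval exceed h and weigh less than d - h, while the elements of
the interval outside A weigh at least d - h. The latter are at least as many, and p + 1 is one of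
them. -/
theorem sum_sub_lt_of_card_le {A : Finset ℕ} {p h d : ℕ} (hp : p < h) (hd : h < d)
    (hA : ∀ j ∈ A, p + 1 < j) (hc : A.card ≤ h - p) :
    ∑ l ∈ A, (d - l) < ∑ l ∈ Finset.Ioc p h, (d - l) := by
  set I := Finset.Ioc p h with hI
  have hcI : I.card = h - p := Nat.card_Ioc _ _
  have h1 : ∑ l ∈ A \ I, (d - l) ≤ (A \ I).card * (d - h - 1) := by
    rw [← smul_eq_mul]
    refine Finset.sum_le_card_nsmul _ _ _ fun l hl => ?_
    rw [Finset.mem_sdiff, hI, Finset.mem_Ioc] at hl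
    have := hA l hl.1
    omega
  have h2 : (I \ A).card * (d - h) ≤ ∑ l ∈ I \ A, (d - l) := by
    rw [← smul_eq_mul]
    refine Finset.card_nsmul_le_sum _ _ _ fun l hl => ?_
    rw [Finset.mem_sdiff, hI, Finset.mem_Ioc] at hl
    omega
  have h3 : 0 < (I \ A).card := Finset.card_pos.2 ⟨p + 1, by
    rw [Finset.mem_sdiff, hI, Finset.mem_Ioc]
    exact ⟨by omega, fun h => by simpa using hA _ h⟩⟩
  have h4 : (A \ I).card ≤ (I \ A).card := by
    have h5 := Finset.card_sdiff_add_card_inter A I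
    have h6 := Finset.card_sdiff_add_card_inter I A
    rw [Finset.inter_comm] at h6
    omega
  have h5 := Finset.sum_inter_add_sum_sdiff A I fun l => d - l
  have h6 := Finset.sum_inter_add_sum_sdiff I A fun l => d - l
  rw [Finset.inter_comm] at h6
  have h7 : (A \ I).card * (d - h - 1) < (I \ A).card * (d - h) := by
    calc (A \ I).card * (d - h - 1) ≤ (I \ A).card * (d - h - 1) := Nat.mul_le_mul_right _ h4
      _ < (I \ A).card * (d - h) := Nat.mul_lt_mul_of_pos_left (by omega) h3
  omega

open scoped Classical in
/-- For `y` in the cluster of the base of `v` and the hop level `p` of `v`, this is the base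
of `v`. -/
noncomputable def hopEnd (τ : ℝ) (V : Finset (Fin d → Fin k)) (y : Fin d → Fin k) (p : ℕ) : ℕ :=
  sInf {l | p < l ∧ HasSol τ V y l}

section Nonfinal

variable (H : Cube τ V G nb) {v : V} (hv : ¬ Final τ V v.1)
include H hv

/-- A stored move may depend on the position and the code only, not on the start v of the trial. So
the base of v, needed for rejecting hops, is recovered from the current position and the hop level.
-/
theorem Cube.hopEnd_eq {y : Fin d → Fin k} (hy : Agree (base τ V v.1) y v.1) :
    hopEnd τ V y (hopLevel τ V v.1) = base τ V v.1 := by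
  refine le_antisymm (Nat.sInf_le ⟨(H.hopLevel_spec hv).1, (H.hasSol_base v).congr hy.symm⟩) ?_
  refine le_csInf ⟨_, (H.hopLevel_spec hv).1, (H.hasSol_base v).congr hy.symm⟩ ?_
  rintro l ⟨h1, h2⟩
  by_contra hcon
  exact H.not_hasSol h1 (not_le.1 hcon) (h2.congr (hy.mono (by omega)))

/-- With p and b the hop level and the base of v, the critical levels up to p are common to v and w.
Beyond p, all of p + 1, …, b are critical for v, whereas w has at most b - p critical levels, all
greater than p + 1. -/
theorem Cube.rank_lt {w : V} (hw : Agree (hopLevel τ V v.1) w.1 v.1)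
    (hc : ¬ Crit τ V w.1 (hopLevel τ V v.1 + 1))
    (hcard : (critSet τ V w.1 (hopLevel τ V v.1 + 1)).card ≤
      base τ V v.1 - hopLevel τ V v.1) : rank τ V w.1 < rank τ V v.1 := by
  classical
  set p := hopLevel τ V v.1 with hp
  set h := base τ V v.1 with hh
  have hph : p < h := (H.hopLevel_spec hv).1
  have hhd : h < d := H.base_lt v
  have htp : top τ V ≤ p := H.top_le_hopLevel hv
  have hsplit : ∀ u : Fin d → Fin k, critSet τ V u (top τ V) =
      (critSet τ V u (top τ V)).filter (· ≤ p) ∪ critSet τ V u p := by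
    intro u
    ext j
    rw [Finset.mem_union, Finset.mem_filter, mem_critSet, mem_critSet]
    constructor
    · intro hj
      by_cases hjp : j ≤ p
      · exact Or.inl ⟨hj, hjp⟩
      · exact Or.inr ⟨⟨by omega, hj.1.2⟩, hj.2⟩
    · rintro (hj | hj)
      · exact hj.1
      · exact ⟨⟨by omega, hj.1.2⟩, hj.2⟩
  have hdisj : ∀ u : Fin d → Fin k, Disjoint ((critSet τ V u (top τ V)).filter (· ≤ p))
      (critSet τ V u p) := by
    intro u
    rw [Finset.disjoint_left]
    intro j hj hj'
    rw [Finset.mem_filter] at hj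
    rw [mem_critSet] at hj'
    omega
  have hlow : (critSet τ V w.1 (top τ V)).filter (· ≤ p) =
      (critSet τ V v.1 (top τ V)).filter (· ≤ p) := by
    ext j
    rw [Finset.mem_filter, Finset.mem_filter, mem_critSet, mem_critSet]
    constructor
    · rintro ⟨⟨h1, h2⟩, h3⟩
      exact ⟨⟨h1, h2.congr (hw.mono h3)⟩, h3⟩
    · rintro ⟨⟨h1, h2⟩, h3⟩
      exact ⟨⟨h1, h2.congr (hw.mono h3).symm⟩, h3⟩
  have hA : critSet τ V w.1 p = critSet τ V w.1 (p + 1) :=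
    (critSet_succ w.1 ⟨p, H.hopLevel_lt hv⟩).2 hc
  have hI : Finset.Ioc p h ⊆ critSet τ V v.1 p := by
    intro j hj
    rw [Finset.mem_Ioc] at hj
    exact mem_critSet.2 ⟨⟨hj.1, by omega⟩, H.crit_of_hopLevel_lt hv hj.1 hj.2⟩
  rw [rank, rank, hsplit w.1, hsplit v.1, Finset.sum_union (hdisj _), Finset.sum_union (hdisj _),
    hlow, hA]
  refine Nat.add_lt_add_left (lt_of_lt_of_le ?_ (Finset.sum_le_sum_of_subset hI)) _
  refine sum_sub_lt_of_card_le hph hhd (fun j hj => ?_) hcard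
  exact (mem_critSet.1 hj).1.1

end Nonfinal

end SemiHypercube


/-! ## The position during a trial -/

namespace Scheme

open WordRAM

variable {W : Type*} (S : Scheme W)

/-- The position after random moves from the given lists. -/
noncomputable def endLaw : List (List ℕ) → Option W → PMF (Option W)
  | [], o => PMF.pure o
  | l :: ls, o => (S.stepLaw l o).bind (endLaw ls)

theorem endLaw_append (ls ls' : List (List ℕ)) (o : Option W) :
    S.endLaw (ls ++ ls') o = (S.endLaw ls o).bind (S.endLaw ls') := by
  induction ls generalizing o with
  | nil => simp [endLaw]
  | cons l ls ih =>
    rw [List.cons_append, endLaw, endLaw, PMF.bind_bind]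
    congr 1
    exact funext ih

theorem endLaw_concat (ls : List (List ℕ)) (l : List ℕ) (o : Option W) :
    S.endLaw (ls ++ [l]) o = (S.endLaw ls o).bind (S.stepLaw l) := by
  rw [endLaw_append]
  congr 1
  ext1 o'
  simp [endLaw]

theorem expect_traceLaw_getLastD (ls : List (List ℕ)) (o : Option W) (φ : Option W → ℝ≥0∞) :
    (S.traceLaw ls o).expect (fun tr => φ (tr.getLastD o)) = (S.endLaw ls o).expect φ := by
  induction ls generalizing o with
  | nil => simp [traceLaw, endLaw, PMF.expect_pure]
  | cons l ls ih =>
    simp only [traceLaw, endLaw, PMF.expect_bind, PMF.expect_map, List.getLastD_cons, ih]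

open scoped Classical in
/-- The number of occurrences of an element in a list. -/
noncomputable def occ {α : Type*} (y : α) (l : List α) : ℝ≥0∞ :=
  (l.map fun a => if a = y then 1 else 0).sum

theorem occ_nil {α : Type*} (y : α) : occ y [] = 0 := by simp [occ]

open scoped Classical in
theorem occ_cons {α : Type*} (y a : α) (l : List α) :
    occ y (a :: l) = occ y l + if a = y then 1 else 0 := by
  simp [occ, add_comm]

theorem occ_append {α : Type*} (y : α) (l l' : List α) : occ y (l ++ l') = occ y l + occ y l' := by
  simp [occ]

theorem occ_reverse {α : Type*} (y : α) (l : List α) : occ y l.reverse = occ y l := by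
  rw [occ, List.map_reverse, List.sum_reverse, occ]

theorem occ_map_some {α : Type*} (y : α) (l : List α) : occ (some y) (l.map some) = occ y l := by
  classical
  induction l with
  | nil => simp [occ]
  | cons a l ih => 
    rw [List.map_cons, occ_cons, occ_cons, ih]
    congr 1
    by_cases h : a = y
    · rw [h, if_pos rfl, if_pos rfl]
    · rw [if_neg h, if_neg (by simpa using h)]

theorem one_le_occ {α : Type*} {y : α} {l : List α} (h : y ∈ l) : 1 ≤ occ y l := by
  induction l with
  | nil => simp at h
  | cons a l ih =>
    rw [occ_cons]
    rcases List.mem_cons.1 h with rfl | h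
    · simp
    · exact (ih h).trans le_self_add

theorem expect_traceLaw_occ (ls : List (List ℕ)) (o : Option W) (y : W) :
    (S.traceLaw ls o).expect (fun tr => occ (some y) tr) =
      ∑ i ∈ Finset.range ls.length, S.endLaw (ls.take (i + 1)) o (some y) := by
  classical
  induction ls generalizing o with
  | nil => simp [traceLaw, PMF.expect_pure, occ_nil]
  | cons l ls ih =>
    rw [List.length_cons, Finset.sum_range_succ']
    simp only [traceLaw, PMF.expect_bind, PMF.expect_map, occ_cons,
      PMF.expect_add, ih, List.take_succ_cons, endLaw, List.take_zero]
    congr 1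
    · rw [PMF.expect_finsetSum]
      refine Finset.sum_congr rfl fun i _ => ?_
      rw [PMF.bind_apply]
      rfl
    · rw [PMF.bind_apply]
      simp only [PMF.expect_const]
      refine tsum_congr fun o' => ?_
      by_cases h : o' = some y
      · subst h; simp
      · simp [PMF.pure_apply, h, Ne.symm h]

theorem mem_endLaw_of_mem_traceLaw {ls : List (List ℕ)} {o : Option W} {tr : List (Option W)}
    (h : tr ∈ (S.traceLaw ls o).support) : tr.getLastD o ∈ (S.endLaw ls o).support := by
  induction ls generalizing o tr with
  | nil => simp [traceLaw] at h; simp [h, endLaw]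
  | cons l ls ih =>
    simp only [traceLaw, PMF.mem_support_bind_iff, PMF.mem_support_map_iff] at h
    obtain ⟨o', ho', tr', h', rfl⟩ := h
    rw [List.getLastD_cons]
    simp only [endLaw, PMF.mem_support_bind_iff]
    exact ⟨o', ho', ih h'⟩

theorem mem_stepLaw {l : List ℕ} (hl : l ≠ []) {o o' : Option W} :
    o' ∈ (S.stepLaw l o).support ↔ ∃ c ∈ l, o' = S.moveO o c := by
  have hpos : 0 < l.length := List.length_pos_iff.2 hl
  simp only [stepLaw, PMF.mem_support_map_iff, mem_support_unif]
  constructor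
  · rintro ⟨x, hx, rfl⟩
    have hx' : x < l.length := by omega
    refine ⟨l[x], List.getElem_mem hx', ?_⟩
    simp [List.getD_eq_getElem?_getD, hx']
  · rintro ⟨c, hc, rfl⟩
    obtain ⟨x, hx, rfl⟩ := List.getElem_of_mem hc
    exact ⟨x, by omega, by simp [List.getD_eq_getElem?_getD, hx]⟩

theorem expect_unif_getD {α : Type*} {L : List α} (hL : L ≠ []) (a : α) (φ : α → ℝ≥0∞) :
    (unif (L.length - 1)).expect (fun x => φ (L.getD x a)) =
      (L.length : ℝ≥0∞)⁻¹ * (L.map φ).sum := by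
  have hpos : 0 < L.length := List.length_pos_iff.2 hL
  have h1 : (unif (L.length - 1)).expect (fun x => φ (L.getD x a)) =
      ∑ x ∈ Finset.range L.length, (L.length : ℝ≥0∞)⁻¹ * φ (L.getD x a) := by
    unfold PMF.expect unif
    rw [tsum_eq_sum (s := Finset.range L.length)]
    · refine Finset.sum_congr rfl fun x hx => ?_
      rw [PMF.uniformOfFinset_apply_of_mem _ (by rw [Nat.sub_add_cancel hpos]; exact hx),
        Finset.card_range, Nat.sub_add_cancel hpos]
    · intro x hx
      rw [PMF.uniformOfFinset_apply_of_notMem _ (by rw [Nat.sub_add_cancel hpos]; exact hx),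
        zero_mul]
  rw [h1, ← Finset.mul_sum]
  congr 1
  rw [Finset.sum_range, ← List.sum_ofFn]
  congr 1
  apply List.ext_getElem
  · simp
  · intro i h3 h4
    simp only [List.getElem_ofFn, List.getElem_map]
    rw [List.length_map] at h4
    simp [List.getD_eq_getElem?_getD, h4]

theorem expect_stepLaw {ι : Type*} (T : Finset ι) (hT : T.Nonempty) (f : ι → ℕ) (o : Option W)
    (φ : Option W → ℝ≥0∞) :
    (S.stepLaw (T.toList.map f) o).expect φ =
      (T.card : ℝ≥0∞)⁻¹ * ∑ i ∈ T, φ (S.moveO o (f i)) := by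
  rw [stepLaw, PMF.expect_map,
    expect_unif_getD (by simpa using hT.ne_empty) 0 (fun c => φ (S.moveO o c)), List.map_map,
    ← Finset.sum_map_toList, List.length_map, Finset.length_toList]
  rfl

variable [Fintype W] {ι : Type*} (T : Finset ι) (hT : T.Nonempty) (f : ι → ℕ) (p : PMF (Option W))
  {M : ℝ≥0∞} {A : Finset W} (hM : ∀ y, p (some y) ≤ M) (hA : ∀ y, p (some y) ≠ 0 → y ∈ A)
include hT hM hA

/-- A union bound over pairs of a position and a choice. It reduces all estimates on single moves to
counting such pairs. -/
theorem sum_expect_stepLaw_le (φ : Option W → Prop) [DecidablePred φ] :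
    ∑ y : W, p (some y) *
      (S.stepLaw (T.toList.map f) (some y)).expect (fun o => if φ o then 1 else 0) ≤
      (T.card : ℝ≥0∞)⁻¹ * M * ((A ×ˢ T).filter fun e => φ (S.move e.1 (f e.2))).card := by
  classical
  calc _ ≤ ∑ y ∈ A, M * ((T.card : ℝ≥0∞)⁻¹ * ∑ i ∈ T, if φ (S.move y (f i)) then 1 else 0) := by
        rw [← Finset.sum_subset (Finset.subset_univ A)]
        · refine Finset.sum_le_sum fun y _ => ?_
          rw [S.expect_stepLaw T hT]
          exact mul_le_mul' (hM y) le_rfl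
        · intro y _ hy
          have : p (some y) = 0 := by
            by_contra h
            exact hy (hA y h)
          rw [this, zero_mul]
    _ = _ := by
        rw [Finset.card_filter, Nat.cast_sum, Finset.sum_product, Finset.mul_sum]
        refine Finset.sum_congr rfl fun y _ => ?_
        push_cast
        ring

theorem bind_stepLaw_some_le [DecidableEq W] (z : W) :
    (p.bind (S.stepLaw (T.toList.map f))) (some z) ≤
      (T.card : ℝ≥0∞)⁻¹ * M * ((A ×ˢ T).filter fun e => S.move e.1 (f e.2) = some z).card := by
  refine le_trans (le_of_eq ?_) (S.sum_expect_stepLaw_le T hT f p hM hA (· = some z))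
  rw [PMF.bind_apply, tsum_fintype, Fintype.sum_option, stepLaw_none]
  simp only [PMF.apply_eq_expect (S.stepLaw _ _) (some z)]
  simp

theorem bind_stepLaw_none_le [DecidableEq W] :
    (p.bind (S.stepLaw (T.toList.map f))) none ≤ p none +
      (T.card : ℝ≥0∞)⁻¹ * M * ((A ×ˢ T).filter fun e => S.move e.1 (f e.2) = none).card := by
  refine le_trans (le_of_eq ?_)
    (add_le_add le_rfl (S.sum_expect_stepLaw_le T hT f p hM hA (· = none)))
  rw [PMF.bind_apply, tsum_fintype, Fintype.sum_option, stepLaw_none]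
  simp only [PMF.apply_eq_expect (S.stepLaw _ (some _)) none]
  simp

end Scheme

namespace SemiHypercube

variable {k d : ℕ} {τ : ℝ} {V : Finset (Fin d → Fin k)} {G : SimpleGraph V}
  {nb : (Fin d → Fin k) → Fin d → Fin k → (Fin d → Fin k)}

/-! ### The scheme of a semi-hypercube -/

open scoped Classical in
/-- Change the digit with index `l` to `x`. -/
noncomputable def digitMove (V : Finset (Fin d → Fin k))
    (nb : (Fin d → Fin k) → Fin d → Fin k → (Fin d → Fin k)) (y : V) (l : Fin d) (x : Fin k) :
    Option V :=
  if h : nb y.1 l x ∈ V then some ⟨nb y.1 l x, h⟩ else none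

open scoped Classical in
/-- Leave a critical cluster on level `p + 1`, unless the new vertex is on too many critical
levels. -/
noncomputable def hopMove (τ : ℝ) (V : Finset (Fin d → Fin k))
    (nb : (Fin d → Fin k) → Fin d → Fin k → (Fin d → Fin k)) (y : V) (p : Fin d) (x : Fin k) :
    Option V :=
  if (critSet τ V (nb y.1 p x) (p + 1)).card ≤ hopEnd τ V y.1 p - p then digitMove V nb y p x
  else none

/-- The code of the move with digit `x` on level `l`, which is a hop if `d ≤ l`. -/
def moveCode (k d l : ℕ) (x : Fin k) : ℕ := 5 + d + (l * k + x)

/-- The 2dk codes belong to the d levels of digit changes followed by the d levels of hops. Their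
shift by 5 + d makes room for the fixed words and the goal codes of a record. -/
noncomputable def codeMove (τ : ℝ) (V : Finset (Fin d → Fin k))
    (nb : (Fin d → Fin k) → Fin d → Fin k → (Fin d → Fin k)) (y : V) (c : ℕ) : Option V :=
  if h : (c - (5 + d)) / k < d then
    digitMove V nb y ⟨_, h⟩ ⟨(c - (5 + d)) % k, Nat.mod_lt _ (y.1 ⟨_, h⟩).pos⟩
  else if h : (c - (5 + d)) / k - d < d then
    hopMove τ V nb y ⟨_, h⟩ ⟨(c - (5 + d)) % k, Nat.mod_lt _ (y.1 ⟨_, h⟩).pos⟩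
  else none

theorem moveCode_div (l : ℕ) (x : Fin k) : (moveCode k d l x - (5 + d)) / k = l := by
  rw [moveCode, Nat.add_sub_cancel_left, Nat.mul_comm, Nat.mul_add_div x.pos,
    Nat.div_eq_of_lt x.2, add_zero]

theorem moveCode_mod (l : ℕ) (x : Fin k) : (moveCode k d l x - (5 + d)) % k = x := by
  rw [moveCode, Nat.add_sub_cancel_left, Nat.mul_comm, Nat.mul_add_mod, Nat.mod_eq_of_lt x.2]

theorem codeMove_digit (y : V) (l : Fin d) (x : Fin k) :
    codeMove τ V nb y (moveCode k d l x) = digitMove V nb y l x := by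
  simp only [codeMove, moveCode_div, moveCode_mod, l.2, dite_true, Fin.eta]

theorem codeMove_hop (y : V) (l : Fin d) (x : Fin k) :
    codeMove τ V nb y (moveCode k d (d + l) x) = hopMove τ V nb y l x := by
  simp only [codeMove, moveCode_div, moveCode_mod, Nat.add_sub_cancel_left, l.2, dite_true, Fin.eta]
  rw [dif_neg (by omega)]

theorem digitMove_eq_some {y z : V} {l : Fin d} {x : Fin k} :
    digitMove V nb y l x = some z ↔ nb y.1 l x = z := by
  unfold digitMove
  split_ifs with h
  · rw [Option.some_inj, Subtype.ext_iff]
  · refine iff_of_false (by simp) fun hz => h ?_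
    rw [hz]
    exact z.2

theorem digitMove_eq_none {y : V} {l : Fin d} {x : Fin k} :
    digitMove V nb y l x = none ↔ nb y.1 l x ∉ V := by
  unfold digitMove
  split_ifs with h <;> simp [h]

theorem hopMove_eq_some {y z : V} {l : Fin d} {x : Fin k} :
    hopMove τ V nb y l x = some z ↔ nb y.1 l x = z ∧
      (critSet τ V z.1 (l + 1)).card ≤ hopEnd τ V y.1 l - l := by
  unfold hopMove
  split_ifs with h
  · rw [digitMove_eq_some]
    constructor
    · rintro h'
      rw [← h']
      exact ⟨rfl, h⟩
    · exact fun h' => h'.1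
  · refine iff_of_false (by simp) ?_
    rintro ⟨h1, h2⟩
    rw [h1] at h
    exact h h2

theorem hopMove_eq_none {y : V} {l : Fin d} {x : Fin k} :
    hopMove τ V nb y l x = none ↔ nb y.1 l x ∉ V ∨
      hopEnd τ V y.1 l - l < (critSet τ V (nb y.1 l x) (l + 1)).card := by
  unfold hopMove
  split_ifs with h
  · rw [digitMove_eq_none]
    exact ⟨Or.inl, fun h' => h'.resolve_right (by omega)⟩
  · exact iff_of_true rfl (Or.inr (by omega))

open scoped Classical in
/-- The digits among which a trial from `v` chooses on level `l`. -/
noncomputable def digits (τ : ℝ) (V : Finset (Fin d → Fin k)) (v : Fin d → Fin k) (l : Fin d) :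
    Finset (Fin k) :=
  -- The clusters of v on levels larger than the base are not critical, so few of their strings are
  -- missing. The base cluster itself may be critical; there only the solid children are safe.
  if l.1 = base τ V v then sol τ V v l else Finset.univ

noncomputable def digitCodes (τ : ℝ) (V : Finset (Fin d → Fin k)) (v : Fin d → Fin k) (l : ℕ) :
    List ℕ :=
  if h : l < d then (digits τ V v ⟨l, h⟩).toList.map (moveCode k d l) else []

noncomputable def hopCodes (τ : ℝ) (V : Finset (Fin d → Fin k)) (v : Fin d → Fin k) : List ℕ :=
  if h : hopLevel τ V v < d then
    (sol τ V v ⟨_, h⟩).toList.map (moveCode k d (d + hopLevel τ V v)) else []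

def goalCode (r : Fin d → Fin k) (l : ℕ) : ℕ :=
  if h : l < d then moveCode k d l (r ⟨l, h⟩) else 0

/-- The choices of the first `n` moves of a trial from `v`, for `n ≤ d - base τ V v`. -/
noncomputable def upScript (τ : ℝ) (V : Finset (Fin d → Fin k)) (v : Fin d → Fin k) (n : ℕ) :
    List (List ℕ) :=
  (List.range n).map fun i => digitCodes τ V v (d - (i + 1))

/-- The first `n` moves from the top towards `r`. -/
noncomputable def goalScript (τ : ℝ) (V : Finset (Fin d → Fin k)) (r : Fin d → Fin k) (n : ℕ) :
    List (List ℕ) :=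
  (List.range n).map fun i => [goalCode r (top τ V + i)]

-- The lists in `Sum.inl` depend on v alone and are stored with it; `Sum.inr i` is a move dictated
-- by digit i of the target.
open scoped Classical in
noncomputable def entries (τ : ℝ) (V : Finset (Fin d → Fin k)) (v : Fin d → Fin k) :
    List (List ℕ ⊕ ℕ) :=
  (upScript τ V v (d - base τ V v)).map Sum.inl ++
    if Final τ V v then (List.range (d - top τ V)).map fun i => Sum.inr (top τ V + i)
    else [Sum.inl (hopCodes τ V v)]

open scoped Classical in
/-- The scheme by which paths in a semi-hypercube are sampled. -/
noncomputable def scheme (τ : ℝ) (V : Finset (Fin d → Fin k))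
    (nb : (Fin d → Fin k) → Fin d → Fin k → (Fin d → Fin k)) : Scheme V where
  move := codeMove τ V nb
  script v r := (entries τ V v.1).map (Sum.elim id fun i => [goalCode r.1 i])
  final v := decide (Final τ V v.1)

theorem scheme_final (v : V) : (scheme τ V nb).final v ↔ Final τ V v.1 := by
  simp [scheme]

theorem script_of_final {v : V} (hv : Final τ V v.1) (r : V) :
    (scheme τ V nb).script v r =
      upScript τ V v.1 (d - base τ V v.1) ++ goalScript τ V r.1 (d - top τ V) := by
  simp [scheme, entries, hv, goalScript, Function.comp_def]

theorem script_of_not_final {v : V} (hv : ¬ Final τ V v.1) (r : V) :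
    (scheme τ V nb).script v r =
      upScript τ V v.1 (d - base τ V v.1) ++ [hopCodes τ V v.1] := by
  simp [scheme, entries, hv, Function.comp_def]

/-! ### Changing one digit -/

theorem inv_mul_le_ofReal {N m : ℕ} {ε : ℝ} (h : (m : ℝ) ≤ ε * N) (hε : 0 ≤ ε) :
    (N : ℝ≥0∞)⁻¹ * m ≤ ENNReal.ofReal ε := by
  rw [mul_comm, ← div_eq_mul_inv]
  refine ENNReal.div_le_of_le_mul ?_
  rw [← ENNReal.ofReal_natCast, ← ENNReal.ofReal_natCast (n := N), ← ENNReal.ofReal_mul hε]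
  exact ENNReal.ofReal_le_ofReal h

theorem inv_natCast_mul (m n : ℕ) : ((m * n : ℕ) : ℝ≥0∞)⁻¹ = (m : ℝ≥0∞)⁻¹ * (n : ℝ≥0∞)⁻¹ := by
  rw [Nat.cast_mul, ENNReal.mul_inv (Or.inr (ENNReal.natCast_ne_top n))
    (Or.inl (ENNReal.natCast_ne_top m))]

section

variable (H : Cube τ V G nb)
include H

/-- Moving back to the old digit undoes a move, so the result and the old digit determine the start.
All bounds on the spread of positions rest on this. -/
theorem Cube.nb_injective {y y' : V} {l : Fin d} {x x' : Fin k} (h : nb y.1 l x = nb y'.1 l x')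
    (hl : y.1 l = y'.1 l) : (y, x) = (y', x') := by
  have h1 := congrFun h l
  rw [H.nb_apply, H.nb_apply] at h1
  refine Prod.ext (Subtype.ext ?_) h1
  simp only
  rw [← H.nb_nb y.1 l x, h, hl, H.nb_nb]

variable {p : PMF (Option V)} {v : Fin d → Fin k} {l : Fin d} {S' S : Finset (Fin k)} {N : ℕ}
  (hS : S.Nonempty) (hp : ∀ y, p (some y) ≤ (N : ℝ≥0∞)⁻¹)
  (hs : ∀ y, p (some y) ≠ 0 → Agree l y.1 v ∧ y.1 l ∈ S')
include hS hs

theorem Cube.agree_of_digitStep {z : V}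
    (hz : (p.bind ((scheme τ V nb).stepLaw (S.toList.map (moveCode k d l)))) (some z) ≠ 0) :
    Agree l z.1 v ∧ z.1 l ∈ S := by
  have hne : S.toList.map (moveCode k d l) ≠ [] := by simpa using hS.ne_empty
  rw [← PMF.mem_support_iff, PMF.mem_support_bind_iff] at hz
  obtain ⟨o, ho, hz⟩ := hz
  rw [Scheme.mem_stepLaw _ hne] at hz
  obtain ⟨c, hc, hz⟩ := hz
  rw [List.mem_map] at hc
  obtain ⟨x, hx, rfl⟩ := hc
  cases o with
  | none => simp [Scheme.moveO] at hz
  | some y =>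
    have h1 : codeMove τ V nb y (moveCode k d l x) = some z := hz.symm
    rw [codeMove_digit, digitMove_eq_some] at h1
    rw [← h1, H.nb_apply]
    exact ⟨(H.agree_nb _ _ _).trans (hs y ho).1, Finset.mem_toList.1 hx⟩

include hp

/-- For each old digit in `S'` there is at most one position leading to z, and it chooses z with
probability at most 1/(|S| N). On the way up `S'` is a singleton, on the way down `S` is. -/
theorem Cube.digitStep_some_le (z : V) :
    (p.bind ((scheme τ V nb).stepLaw (S.toList.map (moveCode k d l)))) (some z) ≤
      ((S.card * N : ℕ) : ℝ≥0∞)⁻¹ * S'.card := by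
  classical
  set A : Finset V := Finset.univ.filter fun y => Agree l y.1 v ∧ y.1 l ∈ S' with hA
  refine ((scheme τ V nb).bind_stepLaw_some_le S hS _ p hp (A := A)
    (fun y hy => by simpa [hA] using hs y hy) z).trans ?_
  rw [inv_natCast_mul]
  gcongr
  refine Finset.card_le_card_of_injOn (fun e => e.1.1 l) ?_ ?_
  · intro e he
    simp only [Finset.coe_filter, Finset.mem_product, hA, Finset.mem_filter] at he
    exact he.1.1.2.2
  · intro e he e' he' heq
    simp only [Finset.coe_filter, Set.mem_ofPred_eq] at he he'
    have h1 : codeMove τ V nb e.1 (moveCode k d l e.2) = some z := he.2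
    have h2 : codeMove τ V nb e'.1 (moveCode k d l e'.2) = some z := he'.2
    rw [codeMove_digit, digitMove_eq_some] at h1 h2
    exact H.nb_injective (h1.trans h2.symm) heq

/-- A failing pair of position and digit is determined by the old digit and the missing string it
leads to. -/
theorem Cube.digitStep_none_le [DecidablePred fun z : Fin d → Fin k => z l ∈ S] :
    (p.bind ((scheme τ V nb).stepLaw (S.toList.map (moveCode k d l)))) none ≤
      p none + ((S.card * N : ℕ) : ℝ≥0∞)⁻¹ *
        ((S'.card * ((missing V v l).filter fun z => z l ∈ S).card : ℕ) : ℝ≥0∞) := by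
  classical
  set A : Finset V := Finset.univ.filter fun y => Agree l y.1 v ∧ y.1 l ∈ S' with hA
  refine ((scheme τ V nb).bind_stepLaw_none_le S hS _ p hp (A := A)
    (fun y hy => by simpa [hA] using hs y hy)).trans ?_
  rw [inv_natCast_mul, ← Finset.card_product]
  gcongr
  refine Finset.card_le_card_of_injOn (fun e => (e.1.1 l, nb e.1.1 l e.2)) ?_ ?_
  · intro e he
    simp only [Finset.coe_filter, Finset.mem_product, hA, Finset.mem_filter, Set.mem_ofPred_eq] at he
    have h1 : codeMove τ V nb e.1 (moveCode k d l e.2) = none := he.2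
    rw [codeMove_digit, digitMove_eq_none] at h1
    simp only [Finset.coe_product, Set.mem_prod, Finset.mem_coe, Finset.mem_filter, mem_missing,
      H.nb_apply]
    exact ⟨he.1.1.2.2, ⟨(H.agree_nb _ _ _).trans he.1.1.2.1, h1⟩, he.1.2⟩
  · intro e _ e' _ heq
    simp only [Prod.mk.injEq] at heq
    exact H.nb_injective heq.2 heq.1

end

end SemiHypercube

namespace SemiHypercube

variable {k d : ℕ} {τ : ℝ} {V : Finset (Fin d → Fin k)} {G : SimpleGraph V}
  {nb : (Fin d → Fin k) → Fin d → Fin k → (Fin d → Fin k)}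

/-! ### The law of a trial -/

theorem card_missing_filter_le {v : Fin d → Fin k} {l : Fin d} {S : Finset (Fin k)}
    [DecidablePred fun z : Fin d → Fin k => z l ∈ S] (hS : S ⊆ sol τ V v l) :
    (((missing V v l).filter fun z => z l ∈ S).card : ℝ) ≤
      τ * (S.card * (k : ℝ) ^ (d - (l + 1))) := by
  classical
  have hsub : (missing V v l).filter (fun z => z l ∈ S) ⊆
      S.biUnion fun i => missing V (Function.update v l i) (l + 1) := by
    intro z hz
    rw [Finset.mem_filter, mem_missing] at hz
    rw [Finset.mem_biUnion]
    refine ⟨z l, hz.2, mem_missing.2 ⟨Agree.succ (fun j hj => ?_) (by simp), hz.1.2⟩⟩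
    rw [hz.1.1 j hj, Function.update_of_ne (Fin.ne_of_lt hj)]
  have h1 : (((missing V v l).filter fun z => z l ∈ S).card : ℝ) ≤
      ∑ i ∈ S, ((missing V (Function.update v l i) (l + 1)).card : ℝ) := by
    exact_mod_cast (Finset.card_le_card hsub).trans Finset.card_biUnion_le
  refine h1.trans ?_
  calc _ ≤ ∑ _i ∈ S, τ * (k : ℝ) ^ (d - (l + 1)) := by
        refine Finset.sum_le_sum fun i hi => card_missing_le fun hc => ?_
        obtain ⟨u, hu1, rfl, hu2⟩ := mem_sol.1 (hS hi)
        refine hu2 (hc.congr (Agree.succ (fun j hj => ?_) (by simp)))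
        rw [hu1 j hj, Function.update_of_ne (Fin.ne_of_lt hj)]
    _ = _ := by rw [Finset.sum_const, nsmul_eq_mul]; ring

theorem upScript_succ (v : Fin d → Fin k) (n : ℕ) :
    upScript τ V v (n + 1) = upScript τ V v n ++ [digitCodes τ V v (d - (n + 1))] := by
  rw [upScript, upScript, List.range_succ, List.map_append, List.map_singleton]

theorem goalScript_succ (r : Fin d → Fin k) (n : ℕ) :
    goalScript τ V r (n + 1) = goalScript τ V r n ++ [[goalCode r (top τ V + n)]] := by
  rw [goalScript, goalScript, List.range_succ, List.map_append, List.map_singleton]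

/-- The position after the first `n` moves of a trial from `v`. -/
noncomputable def upLaw (τ : ℝ) (V : Finset (Fin d → Fin k))
    (nb : (Fin d → Fin k) → Fin d → Fin k → (Fin d → Fin k)) (v : V) (n : ℕ) : PMF (Option V) :=
  (scheme τ V nb).endLaw (upScript τ V v.1 n) (some v)

theorem upLaw_succ (v : V) (n : ℕ) :
    upLaw τ V nb v (n + 1) =
      (upLaw τ V nb v n).bind ((scheme τ V nb).stepLaw (digitCodes τ V v.1 (d - (n + 1)))) := by
  rw [upLaw, upLaw, upScript_succ, Scheme.endLaw_concat]

/-- The number of equally likely positions on the base of `v`. -/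
noncomputable def spread (τ : ℝ) (V : Finset (Fin d → Fin k)) (v : Fin d → Fin k) : ℕ :=
  if h : base τ V v < d then (sol τ V v ⟨_, h⟩).card * k ^ (d - (base τ V v + 1)) else 0

section

variable (H : Cube τ V G nb) (v : V)
include H

theorem Cube.spread_eq : spread τ V v.1 =
    (sol τ V v.1 ⟨_, H.base_lt v⟩).card * k ^ (d - (base τ V v.1 + 1)) := by
  rw [spread, dif_pos (H.base_lt v)]

/-- There is a solid child and at most one other nonempty child. This 2 enters both the failure
probability of hops and the congestion. -/
theorem Cube.card_cl_base_le : (cl V v.1 (base τ V v.1)).card ≤ 2 * spread τ V v.1 := by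
  have h1 := H.card_cl_le_sol v.1 ⟨_, H.base_lt v⟩
  have h2 : 0 < (sol τ V v.1 ⟨_, H.base_lt v⟩).card :=
    Finset.card_pos.2 (H.hasSol_base v).sol_nonempty
  rw [H.spread_eq v]
  refine h1.trans ?_
  rw [← mul_assoc]
  exact Nat.mul_le_mul_right _ (by omega)

/-- Before digit l is changed it is still that of v, so different pairs of position and new digit
give different results and the point masses shrink by a factor k. At most a fraction τ of the
strings of the larger cluster is missing, since it is not critical. -/
theorem Cube.upLaw_spec (n : ℕ) (hn : n + base τ V v.1 < d) :
    (∀ y, upLaw τ V nb v n (some y) ≤ ((k ^ n : ℕ) : ℝ≥0∞)⁻¹) ∧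
      (∀ y, upLaw τ V nb v n (some y) ≠ 0 → Agree (d - n) y.1 v.1) ∧
      upLaw τ V nb v n none ≤ n * ENNReal.ofReal τ := by
  classical
  induction n with
  | zero =>
    refine ⟨fun y => ?_, fun y hy => ?_, ?_⟩
    · simpa using PMF.coe_le_one _ _
    · simp only [upLaw, upScript, List.range_zero, List.map_nil, Scheme.endLaw, PMF.pure_apply] at hy
      have : y = v := by simpa using hy
      rw [this]
      exact Agree.refl _ _
    · simp [upLaw, upScript, Scheme.endLaw, PMF.pure_apply]
  | succ n ih =>
    obtain ⟨ih1, ih2, ih3⟩ := ih (by omega)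
    have hl : d - (n + 1) < d := by omega
    set l : Fin d := ⟨d - (n + 1), hl⟩ with hldef
    have hcodes : digitCodes τ V v.1 (d - (n + 1)) =
        (Finset.univ : Finset (Fin k)).toList.map (moveCode k d l) := by
      rw [digitCodes, dif_pos hl, digits, if_neg (by simp only; omega)]
    have hk := H.k_pos
    have hne : (Finset.univ : Finset (Fin k)).Nonempty := ⟨⟨0, hk⟩, Finset.mem_univ _⟩
    have hs : ∀ y, upLaw τ V nb v n (some y) ≠ 0 → Agree l y.1 v.1 ∧ y.1 l ∈ ({v.1 l} : Finset _) := by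
      intro y hy
      have := ih2 y hy
      exact ⟨this.mono (by simp only [hldef]; omega), by
        rw [Finset.mem_singleton]; exact this l (by simp only [hldef]; omega)⟩
    rw [upLaw_succ, hcodes]
    have hpow : (Finset.univ : Finset (Fin k)).card * k ^ n = k ^ (n + 1) := by
      rw [Finset.card_univ, Fintype.card_fin, pow_succ, mul_comm]
    refine ⟨fun z => ?_, fun z hz => (H.agree_of_digitStep hne hs hz).1, ?_⟩
    · have := H.digitStep_some_le hne ih1 hs z
      rwa [hpow, Finset.card_singleton, Nat.cast_one, mul_one] at this
    · have h1 := H.digitStep_none_le hne ih1 hs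
      rw [hpow, Finset.card_singleton, one_mul] at h1
      refine h1.trans ?_
      push_cast
      rw [add_mul, one_mul]
      refine add_le_add ih3 ?_
      have h2 := card_missing_le (H.not_crit_of_base_lt v (l := l) (by simp only [hldef]; omega))
      rw [show d - l.1 = n + 1 by simp only [hldef]; omega] at h2
      have h3 := inv_mul_le_ofReal (N := k ^ (n + 1)) (by exact_mod_cast h2) H.tau_pos.le
      rw [Finset.filter_true_of_mem fun z _ => Finset.mem_univ (z l)]
      exact_mod_cast h3

/-- On the base only solid digits are drawn, so the fraction of missing strings is still at most τ
although the base cluster may be critical. -/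
theorem Cube.upLaw_base_spec :
    (∀ y, upLaw τ V nb v (d - base τ V v.1) (some y) ≤ (spread τ V v.1 : ℝ≥0∞)⁻¹) ∧
      (∀ y, upLaw τ V nb v (d - base τ V v.1) (some y) ≠ 0 → Agree (base τ V v.1) y.1 v.1 ∧
        y.1 ⟨_, H.base_lt v⟩ ∈ sol τ V v.1 ⟨_, H.base_lt v⟩) ∧
      upLaw τ V nb v (d - base τ V v.1) none ≤ d * ENNReal.ofReal τ := by
  classical
  have hb := H.base_lt v
  set n := d - (base τ V v.1 + 1) with hn
  obtain ⟨ih1, ih2, ih3⟩ := H.upLaw_spec v n (by omega)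
  set l : Fin d := ⟨base τ V v.1, hb⟩ with hldef
  set S := sol τ V v.1 l with hS
  have hcodes : digitCodes τ V v.1 (d - (n + 1)) = S.toList.map (moveCode k d l) := by
    rw [show d - (n + 1) = base τ V v.1 by omega, digitCodes, dif_pos hb, digits,
      if_pos (by simp only)]
  have hne : S.Nonempty := (H.hasSol_base v).sol_nonempty
  have hs : ∀ y, upLaw τ V nb v n (some y) ≠ 0 → Agree l y.1 v.1 ∧ y.1 l ∈ ({v.1 l} : Finset _) := by
    intro y hy
    have := ih2 y hy
    exact ⟨this.mono (by simp only [hldef]; omega), by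
      rw [Finset.mem_singleton]; exact this l (by simp only [hldef]; omega)⟩
  rw [show d - base τ V v.1 = n + 1 by omega, upLaw_succ, hcodes]
  have hsp : S.card * k ^ n = spread τ V v.1 := by rw [H.spread_eq v]
  refine ⟨fun z => ?_, fun z hz => H.agree_of_digitStep hne hs hz, ?_⟩
  · have := H.digitStep_some_le hne ih1 hs z
    rwa [hsp, Finset.card_singleton, Nat.cast_one, mul_one] at this
  · have h1 := H.digitStep_none_le hne ih1 hs
    rw [hsp, Finset.card_singleton, one_mul] at h1
    refine h1.trans ?_
    have hd : (d : ℝ≥0∞) * ENNReal.ofReal τ =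
        (d - 1 : ℕ) * ENNReal.ofReal τ + ENNReal.ofReal τ := by
      rw [← add_one_mul]
      congr 1
      exact_mod_cast (Nat.sub_add_cancel H.d_pos).symm
    rw [hd]
    refine add_le_add (ih3.trans ?_) ?_
    · gcongr
      omega
    · refine inv_mul_le_ofReal ?_ H.tau_pos.le
      have h2 := card_missing_filter_le (V := V) (v := v.1) (l := l) (S := S)
        Finset.Subset.rfl
      rw [← hsp]
      push_cast
      exact h2

end

section Nonfinal

variable (H : Cube τ V G nb) {v : V} (hv : ¬ Final τ V v.1) (r : V)
include H hv

omit H in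
theorem endLaw_script :
    (scheme τ V nb).endLaw ((scheme τ V nb).script v r) (some v) =
      (upLaw τ V nb v (d - base τ V v.1)).bind ((scheme τ V nb).stepLaw (hopCodes τ V v.1)) := by
  rw [script_of_not_final hv, Scheme.endLaw_concat]
  rfl

theorem Cube.hopCodes_eq : hopCodes τ V v.1 =
    (sol τ V v.1 ⟨_, H.hopLevel_lt hv⟩).toList.map (moveCode k d (d + hopLevel τ V v.1)) := by
  rw [hopCodes, dif_pos (H.hopLevel_lt hv)]

theorem Cube.hop_agree {w : V}
    (hw : (scheme τ V nb).endLaw ((scheme τ V nb).script v r) (some v) (some w) ≠ 0) :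
    Agree (hopLevel τ V v.1) w.1 v.1 ∧ ¬ Crit τ V w.1 (hopLevel τ V v.1 + 1) ∧
      (critSet τ V w.1 (hopLevel τ V v.1 + 1)).card ≤ base τ V v.1 - hopLevel τ V v.1 := by
  obtain ⟨-, hs, -⟩ := H.upLaw_base_spec v
  set p : Fin d := ⟨hopLevel τ V v.1, H.hopLevel_lt hv⟩ with hp
  have hne : (sol τ V v.1 p).Nonempty := (H.hopLevel_spec hv).2.sol_nonempty
  rw [endLaw_script hv, H.hopCodes_eq hv, ← PMF.mem_support_iff, PMF.mem_support_bind_iff] at hw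
  obtain ⟨o, ho, hw⟩ := hw
  rw [Scheme.mem_stepLaw _ (by simpa using hne.ne_empty)] at hw
  obtain ⟨c, hc, hw⟩ := hw
  rw [List.mem_map] at hc
  obtain ⟨x, hx, rfl⟩ := hc
  cases o with
  | none => simp [Scheme.moveO] at hw
  | some y =>
    have h1 : codeMove τ V nb y (moveCode k d (d + p) x) = some w := hw.symm
    rw [codeMove_hop, hopMove_eq_some] at h1
    have hy := (hs y ho).1
    rw [show ((p : ℕ)) = hopLevel τ V v.1 from rfl, H.hopEnd_eq hv hy] at h1
    have hag : Agree (hopLevel τ V v.1) w.1 v.1 := by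
      rw [← h1.1]
      exact (H.agree_nb _ p _).trans (hy.mono (H.hopLevel_spec hv).1.le)
    refine ⟨hag, ?_, h1.2⟩
    obtain ⟨u, hu1, hu2, hu3⟩ := mem_sol.1 (Finset.mem_toList.1 hx)
    refine fun hc => hu3 (hc.congr (Agree.succ (hag.trans hu1.symm) ?_))
    rw [← h1.1, H.nb_apply, hu2]

/-- The whole base cluster has the same digit on the hop level, so at most one pair of position and
digit leads to w. The factor 1/|S| of the choice of the digit is given away. -/
theorem Cube.hop_le (w : V) :
    (scheme τ V nb).endLaw ((scheme τ V nb).script v r) (some v) (some w) ≤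
      (spread τ V v.1 : ℝ≥0∞)⁻¹ := by
  classical
  obtain ⟨hp, hs, -⟩ := H.upLaw_base_spec v
  set p : Fin d := ⟨hopLevel τ V v.1, H.hopLevel_lt hv⟩ with hpdef
  have hne : (sol τ V v.1 p).Nonempty := (H.hopLevel_spec hv).2.sol_nonempty
  rw [endLaw_script hv, H.hopCodes_eq hv]
  refine ((scheme τ V nb).bind_stepLaw_some_le _ hne _ _ hp (A := cl V v.1 (base τ V v.1))
    (fun y hy => mem_cl.2 (hs y hy).1) w).trans ?_
  have hcard : (((cl V v.1 (base τ V v.1)) ×ˢ (sol τ V v.1 p)).filter fun e =>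
      (scheme τ V nb).move e.1 (moveCode k d (d + hopLevel τ V v.1) e.2) = some w).card ≤ 1 := by
    rw [Finset.card_le_one]
    intro e he e' he'
    rw [Finset.mem_filter, Finset.mem_product, mem_cl] at he he'
    have h1 : codeMove τ V nb e.1 (moveCode k d (d + p) e.2) = some w := he.2
    have h2 : codeMove τ V nb e'.1 (moveCode k d (d + p) e'.2) = some w := he'.2
    rw [codeMove_hop, hopMove_eq_some] at h1 h2
    refine H.nb_injective (h1.1.trans h2.1.symm) ?_
    have := (H.hopLevel_spec hv).1
    rw [he.1.1 p this, he'.1.1 p this]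
  have h1 : ((sol τ V v.1 p).card : ℝ≥0∞)⁻¹ ≤ 1 := by
    rw [ENNReal.inv_le_one]
    exact_mod_cast Finset.card_pos.2 hne
  calc _ ≤ 1 * (spread τ V v.1 : ℝ≥0∞)⁻¹ * 1 := by
        gcongr
        exact_mod_cast hcard
    _ = _ := by rw [one_mul, mul_one]

/-- Here 32/135 = 1/5 + 1/27. Missing ends of hops are a tenth of |S||cl|, and |cl| is at most twice
the spread. Rejected ends are on at least c = b - p + 1 critical levels; by
`Cube.card_manyCrit_mul_le` there are at most |S| 2^n k^(n-c) of them, which is at most |S|/27 times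
the spread since 27 · 2^n ≤ k. -/
theorem Cube.hop_none_le :
    (scheme τ V nb).endLaw ((scheme τ V nb).script v r) (some v) none ≤
      d * ENNReal.ofReal τ + ENNReal.ofReal (32 / 135) := by
  classical
  obtain ⟨hp, hs, hnone⟩ := H.upLaw_base_spec v
  set p : Fin d := ⟨hopLevel τ V v.1, H.hopLevel_lt hv⟩ with hpdef
  set b := base τ V v.1 with hb
  have hpb : p.1 < b := (H.hopLevel_spec hv).1
  have hbd : b < d := H.base_lt v
  set S := sol τ V v.1 p with hS
  have hne : S.Nonempty := (H.hopLevel_spec hv).2.sol_nonempty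
  set N := spread τ V v.1 with hN
  rw [endLaw_script hv, H.hopCodes_eq hv]
  refine ((scheme τ V nb).bind_stepLaw_none_le _ hne _ _ hp (A := cl V v.1 b)
    (fun y hy => mem_cl.2 (hs y hy).1)).trans (add_le_add hnone ?_)
  rw [← inv_natCast_mul]
  refine inv_mul_le_ofReal ?_ (by norm_num)
  set B1 := ((cl V v.1 b) ×ˢ S).filter fun e => nb e.1 p e.2 ∉ V with hB1
  set B2 := ((cl V v.1 b) ×ˢ S).filter fun e => nb e.1 p e.2 ∈ V ∧
    b - p < (critSet τ V (nb e.1 p e.2) (p + 1)).card with hB2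
  have hsub : (((cl V v.1 b) ×ˢ S).filter fun e =>
      (scheme τ V nb).move e.1 (moveCode k d (d + hopLevel τ V v.1) e.2) = none) ⊆ B1 ∪ B2 := by
    intro e he
    rw [Finset.mem_filter] at he
    have h1 : codeMove τ V nb e.1 (moveCode k d (d + p) e.2) = none := he.2
    rw [codeMove_hop, hopMove_eq_none] at h1
    rw [Finset.mem_union, hB1, hB2, Finset.mem_filter, Finset.mem_filter]
    have hag := mem_cl.1 (Finset.mem_product.1 he.1).1
    have := H.hopEnd_eq hv hag
    rw [show ((p : ℕ)) = hopLevel τ V v.1 from rfl, this] at h1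
    by_cases hV : nb e.1 p e.2 ∈ V
    · exact Or.inr ⟨he.1, hV, h1.resolve_left (not_not.2 hV)⟩
    · exact Or.inl ⟨he.1, hV⟩
  have h1 : 5 * B1.card ≤ S.card * N := by
    have h2 := H.crit_degree v p (H.crit_of_hopLevel_lt hv (Nat.lt_succ_self _) hpb)
    rw [H.cl_eq_cl_base (Nat.lt_succ_self _) hpb] at h2
    have h3 := H.card_cl_base_le v
    have h4 : S.card * (cl V v.1 b).card ≤ S.card * (2 * N) := Nat.mul_le_mul_left _ h3
    have h5 : 10 * B1.card ≤ S.card * (cl V v.1 b).card := h2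
    nlinarith
  have h2 : 27 * B2.card ≤ S.card * N := by
    set n := d - (p.1 + 1) with hn
    set c := b - p + 1 with hc
    have hle : B2.card ≤ (S.biUnion fun i =>
        manyCrit τ V (Function.update v.1 p i) (p + 1) c).card := by
      refine Finset.card_le_card_of_injOn
        (fun e => if h : nb e.1.1 p e.2 ∈ V then ⟨nb e.1.1 p e.2, h⟩ else v) ?_ ?_
      · intro e he
        rw [Finset.mem_coe, hB2, Finset.mem_filter, Finset.mem_product, mem_cl] at he
        beta_reduce
        rw [dif_pos he.2.1, Finset.mem_coe, Finset.mem_biUnion]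
        refine ⟨e.2, he.1.2, mem_manyCrit.2 ⟨?_, he.2.2⟩⟩
        refine Agree.succ (fun j hj => ?_) ?_
        · rw [Function.update_of_ne (Fin.ne_of_lt hj)]
          exact (H.agree_nb _ p _ j hj).trans (he.1.1 j (by omega))
        · rw [Function.update_self]
          exact H.nb_apply _ _ _
      · intro e he e' he' heq
        rw [Finset.mem_coe, hB2, Finset.mem_filter, Finset.mem_product, mem_cl] at he he'
        simp only [dif_pos he.2.1, dif_pos he'.2.1, Subtype.mk.injEq] at heq
        refine H.nb_injective heq ?_
        rw [he.1.1 p hpb, he'.1.1 p hpb]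
    have hpos : 0 < 2 ^ n * k ^ c := Nat.mul_pos (by positivity) (pow_pos H.k_pos _)
    have h5 : 27 * 2 ^ n ≤ k :=
      (Nat.mul_le_mul_left _ (Nat.pow_le_pow_right (by norm_num) (by omega))).trans H.le_k
    have h6 : B2.card * k ^ c ≤ S.card * (2 ^ n * k ^ n) := by
      calc B2.card * k ^ c ≤ (∑ i ∈ S, (manyCrit τ V (Function.update v.1 p i) (p + 1) c).card) *
            k ^ c := Nat.mul_le_mul_right _ (hle.trans Finset.card_biUnion_le)
        _ = ∑ i ∈ S, (manyCrit τ V (Function.update v.1 p i) (p + 1) c).card * k ^ c :=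
            Finset.sum_mul _ _ _
        _ ≤ ∑ _i ∈ S, 2 ^ n * k ^ n := Finset.sum_le_sum fun i _ =>
            H.card_manyCrit_mul_le n (p + 1) (by omega) _ _
        _ = _ := by rw [Finset.sum_const, smul_eq_mul]
    have h7 : k ^ (d - (b + 1)) ≤ N := by
      rw [hN, H.spread_eq v]
      exact Nat.le_mul_of_pos_left _ (Finset.card_pos.2 (H.hasSol_base v).sol_nonempty)
    refine Nat.le_of_mul_le_mul_right (c := k ^ c) ?_ (pow_pos H.k_pos _)
    calc 27 * B2.card * k ^ c = 27 * (B2.card * k ^ c) := by ring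
      _ ≤ 27 * (S.card * (2 ^ n * k ^ n)) := Nat.mul_le_mul_left _ h6
      _ = S.card * (27 * 2 ^ n * k ^ n) := by ring
      _ ≤ S.card * (k * k ^ n) := Nat.mul_le_mul_left _ (Nat.mul_le_mul_right _ h5)
      _ = S.card * (k ^ (d - (b + 1)) * k ^ c) := by
          rw [← pow_succ', ← pow_add]
          congr 2
          omega
      _ ≤ S.card * (N * k ^ c) := Nat.mul_le_mul_left _ (Nat.mul_le_mul_right _ h7)
      _ = S.card * N * k ^ c := by ring
  have h3 := (Finset.card_le_card hsub).trans (Finset.card_union_le _ _)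
  have h4 : (5 : ℝ) * B1.card ≤ ((S.card * N : ℕ) : ℝ) := by exact_mod_cast h1
  have h5 : (27 : ℝ) * B2.card ≤ ((S.card * N : ℕ) : ℝ) := by exact_mod_cast h2
  refine (Nat.cast_le.2 h3).trans ?_
  push_cast at h4 h5 ⊢
  linarith

end Nonfinal

end SemiHypercube

/-! ### Trials from final vertices and the success probability. -/

namespace SemiHypercube

variable {k d : ℕ} {τ : ℝ} {V : Finset (Fin d → Fin k)} {G : SimpleGraph V}
  {nb : (Fin d → Fin k) → Fin d → Fin k → (Fin d → Fin k)}

section Final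

/-- The position in a trial from `v` after the first `n` moves towards `r`. -/
noncomputable def goalLaw (τ : ℝ) (V : Finset (Fin d → Fin k))
    (nb : (Fin d → Fin k) → Fin d → Fin k → (Fin d → Fin k)) (v r : V) (n : ℕ) : PMF (Option V) :=
  (scheme τ V nb).endLaw (upScript τ V v.1 (d - base τ V v.1) ++ goalScript τ V r.1 n) (some v)

theorem goalLaw_zero (v r : V) : goalLaw τ V nb v r 0 = upLaw τ V nb v (d - base τ V v.1) := by
  simp [goalLaw, upLaw, goalScript]

theorem goalLaw_succ (v r : V) (n : ℕ) : goalLaw τ V nb v r (n + 1) =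
    (goalLaw τ V nb v r n).bind ((scheme τ V nb).stepLaw [goalCode r.1 (top τ V + n)]) := by
  rw [goalLaw, goalLaw, goalScript_succ, ← List.append_assoc, Scheme.endLaw_concat]

variable (H : Cube τ V G nb)
include H

/-- Fixing a digit merges |S'| possible positions into one, which the factor |S'| in the hypothesis
on the point masses compensates. The failure probability is at most τ because no cluster of the
final vertex r below the top is critical. -/
theorem Cube.goal_step {r : V} (hr : Final τ V r.1) {l : Fin d} (hl : top τ V ≤ l)
    {p : PMF (Option V)} {S' : Finset (Fin k)} (hS' : S'.Nonempty)
    (hp : ∀ y, p (some y) ≤ ((S'.card * k ^ (d - (l + 1)) : ℕ) : ℝ≥0∞)⁻¹)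
    (hs : ∀ y, p (some y) ≠ 0 → Agree l y.1 r.1 ∧ y.1 l ∈ S') :
    (∀ z, p.bind ((scheme τ V nb).stepLaw [goalCode r.1 l]) (some z) ≤
      ((k ^ (d - (l + 1)) : ℕ) : ℝ≥0∞)⁻¹) ∧
    (∀ z, p.bind ((scheme τ V nb).stepLaw [goalCode r.1 l]) (some z) ≠ 0 →
      Agree (l + 1) z.1 r.1) ∧
    p.bind ((scheme τ V nb).stepLaw [goalCode r.1 l]) none ≤ p none + ENNReal.ofReal τ := by
  classical
  have hcode : [goalCode r.1 l] = ({r.1 l} : Finset (Fin k)).toList.map (moveCode k d l) := by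
    rw [goalCode, dif_pos l.2, Finset.toList_singleton, List.map_singleton]
  have hc : 0 < S'.card := Finset.card_pos.2 hS'
  have hne : ({r.1 l} : Finset (Fin k)).Nonempty := Finset.singleton_nonempty _
  rw [hcode]
  refine ⟨fun z => ?_, fun z hz => ?_, ?_⟩
  · refine (H.digitStep_some_le hne hp hs z).trans (le_of_eq ?_)
    rw [Finset.card_singleton, one_mul, inv_natCast_mul, mul_right_comm,
      ENNReal.inv_mul_cancel (by exact_mod_cast hc.ne') (ENNReal.natCast_ne_top _), one_mul]
  · have := H.agree_of_digitStep hne hs hz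
    exact this.1.succ (Finset.mem_singleton.1 this.2)
  · refine (H.digitStep_none_le hne hp hs).trans (add_le_add le_rfl ?_)
    rw [Finset.card_singleton, one_mul]
    refine inv_mul_le_ofReal ?_ H.tau_pos.le
    have h1 : (missing V r.1 l).filter (fun z => z l ∈ ({r.1 l} : Finset (Fin k))) ⊆
        missing V r.1 (l + 1) := by
      intro z hz
      rw [Finset.mem_filter, mem_missing, Finset.mem_singleton] at hz
      exact mem_missing.2 ⟨hz.1.1.succ hz.2, hz.1.2⟩
    have hb : base τ V r.1 < l + 1 := by rw [hr]; omega
    have h2 := card_missing_le (H.not_crit_of_base_lt r hb)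
    have h3 : (((missing V r.1 l).filter fun z => z l ∈ ({r.1 l} : Finset (Fin k))).card : ℝ) ≤
        (missing V r.1 (l + 1)).card := by exact_mod_cast Finset.card_le_card h1
    push_cast
    calc (S'.card : ℝ) * _ ≤ S'.card * (τ * (k : ℝ) ^ (d - (l.1 + 1))) := by gcongr; exact h3.trans h2
      _ = _ := by ring

variable {v r : V} (hv : Final τ V v.1) (hr : Final τ V r.1)
include hv hr

/-- The first old digit ranges over the solid children, on which the upward moves have spread the
position; for the later ones all k digits are allowed. -/
theorem Cube.goalLaw_spec (n : ℕ) (hn : top τ V + n < d) :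
    (∀ y, goalLaw τ V nb v r (n + 1) (some y) ≤ ((k ^ (d - (top τ V + n + 1)) : ℕ) : ℝ≥0∞)⁻¹) ∧
      (∀ y, goalLaw τ V nb v r (n + 1) (some y) ≠ 0 → Agree (top τ V + n + 1) y.1 r.1) ∧
      goalLaw τ V nb v r (n + 1) none ≤ d * ENNReal.ofReal τ + (n + 1 : ℕ) * ENNReal.ofReal τ := by
  induction n with
  | zero =>
    obtain ⟨h1, h2, h3⟩ := H.upLaw_base_spec v
    have hbt : base τ V v.1 = top τ V := hv
    have hl : (⟨_, H.base_lt v⟩ : Fin d) = ⟨top τ V, by omega⟩ := Fin.ext hbt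
    rw [goalLaw_succ, goalLaw_zero]
    rw [H.spread_eq v] at h1
    simp only [hl] at h1 h2
    obtain ⟨h4, h5, h6⟩ := H.goal_step (l := ⟨top τ V, by omega⟩) hr le_rfl
      (p := upLaw τ V nb v (d - base τ V v.1)) (S' := sol τ V v.1 ⟨top τ V, by omega⟩)
      (H.hasSol_top v).sol_nonempty (by simpa only [hbt] using h1)
      (fun y hy => ⟨(H.agree_top y r), (h2 y hy).2⟩)
    refine ⟨h4, h5, h6.trans ?_⟩
    rw [zero_add, Nat.cast_one, one_mul]
    exact add_le_add h3 le_rfl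
  | succ n ih =>
    obtain ⟨h1, h2, h3⟩ := ih (by omega)
    have hk := H.k_pos
    obtain ⟨h4, h5, h6⟩ := H.goal_step (l := ⟨top τ V + n + 1, by omega⟩) hr
      (by simp only; omega) (p := goalLaw τ V nb v r (n + 1)) (S' := Finset.univ)
      ⟨⟨0, hk⟩, Finset.mem_univ _⟩
      (fun y => (h1 y).trans (le_of_eq (by
        rw [Finset.card_univ, Fintype.card_fin, ← pow_succ']
        congr 4
        simp only
        omega)))
      (fun y hy => ⟨h2 y hy, Finset.mem_univ _⟩)
    rw [goalLaw_succ]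
    refine ⟨h4, h5, h6.trans ?_⟩
    rw [Nat.cast_succ (n + 1), add_mul _ (1 : ℝ≥0∞), one_mul, ← add_assoc]
    exact add_le_add h3 le_rfl

omit hr in
theorem Cube.endLaw_script_final :
    (scheme τ V nb).endLaw ((scheme τ V nb).script v r) (some v) =
      goalLaw τ V nb v r (d - (top τ V + 1) + 1) := by
  rw [script_of_final hv, goalLaw]
  have := H.top_lt v
  rw [show d - top τ V = d - (top τ V + 1) + 1 by omega]

end Final

section Efficient

variable (H : Cube τ V G nb)
include H

theorem Cube.ofReal_tau_le : d * ENNReal.ofReal τ ≤ ENNReal.ofReal (1 / 27) := by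
  rw [← ENNReal.ofReal_natCast, ← ENNReal.ofReal_mul (by positivity)]
  exact ENNReal.ofReal_le_ofReal H.tau_le'

/-- The failure probability is at most 2/27 from final vertices and 1/27 + 32/135 from the others.
-/
theorem Cube.endLaw_none_le (v : V) {r : V} (hr : Final τ V r.1) :
    (scheme τ V nb).endLaw ((scheme τ V nb).script v r) (some v) none ≤ 2⁻¹ := by
  have h2 : (2 : ℝ≥0∞)⁻¹ = ENNReal.ofReal (1 / 2) := by
    rw [one_div, ENNReal.ofReal_inv_of_pos (by norm_num), ENNReal.ofReal_ofNat]
  by_cases hv : Final τ V v.1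
  · have := H.top_lt v
    obtain ⟨-, -, h⟩ := H.goalLaw_spec hv hr (d - (top τ V + 1)) (by omega)
    rw [H.endLaw_script_final hv]
    refine h.trans ?_
    have h1 : ((d - (top τ V + 1) + 1 : ℕ) : ℝ≥0∞) * ENNReal.ofReal τ ≤ d * ENNReal.ofReal τ := by
      gcongr
      omega
    refine (add_le_add H.ofReal_tau_le (h1.trans H.ofReal_tau_le)).trans ?_
    rw [← ENNReal.ofReal_add (by norm_num) (by norm_num), h2]
    exact ENNReal.ofReal_le_ofReal (by norm_num)
  · refine (H.hop_none_le hv r).trans ?_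
    refine (add_le_add H.ofReal_tau_le le_rfl).trans ?_
    rw [← ENNReal.ofReal_add (by norm_num) (by norm_num), h2]
    exact ENNReal.ofReal_le_ofReal (by norm_num)

omit H in
theorem length_upScript (v : Fin d → Fin k) (n : ℕ) : (upScript τ V v n).length = n := by
  simp [upScript]

omit H in
theorem length_entries_le (v : Fin d → Fin k) (hd : 0 < d) :
    (entries τ V v).length ≤ 2 * d := by
  classical
  rw [entries, List.length_append, List.length_map, length_upScript]
  split_ifs with h
  · rw [List.length_map, List.length_range]
    omega
  · rw [List.length_singleton]
    omega

theorem Cube.ne_nil_of_mem_script (v r : V) {l : List ℕ} (hl : l ∈ (scheme τ V nb).script v r) :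
    l ≠ [] := by
  classical
  have hup : ∀ l ∈ upScript τ V v.1 (d - base τ V v.1), l ≠ [] := by
    intro l hl
    rw [upScript, List.mem_map] at hl
    obtain ⟨i, hi, rfl⟩ := hl
    rw [List.mem_range] at hi
    have hb := H.base_lt v
    rw [digitCodes, dif_pos (by omega)]
    have : (digits τ V v.1 ⟨d - (i + 1), by omega⟩).Nonempty := by
      unfold digits
      split_ifs with h
      · simp only at h
        refine HasSol.sol_nonempty ?_
        simp only [h]
        exact H.hasSol_base v
      · exact ⟨⟨0, H.k_pos⟩, Finset.mem_univ _⟩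
    simpa using this.ne_empty
  by_cases hv : Final τ V v.1
  · rw [script_of_final hv, List.mem_append] at hl
    rcases hl with hl | hl
    · exact hup l hl
    · rw [goalScript, List.mem_map] at hl
      obtain ⟨i, -, rfl⟩ := hl
      simp
  · rw [script_of_not_final hv, List.mem_append, List.mem_singleton] at hl
    rcases hl with hl | rfl
    · exact hup l hl
    · rw [H.hopCodes_eq hv]
      have hne : (sol τ V v.1 ⟨_, H.hopLevel_lt hv⟩).Nonempty :=
        (H.hopLevel_spec hv).2.sol_nonempty
      simpa using hne.ne_empty

omit H in
theorem trial_getLastD (v r : V) (φ : Option V → ℝ≥0∞) :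
    ((scheme τ V nb).trial v r).expect (fun tr => φ (tr.getLastD (some v))) =
      ((scheme τ V nb).endLaw ((scheme τ V nb).script v r) (some v)).expect φ :=
  Scheme.expect_traceLaw_getLastD _ _ _ _

omit H in
theorem endpoint_mem {v r : V} {tr : List (Option V)}
    (htr : tr ∈ ((scheme τ V nb).trial v r).support) (hs : tr ∈ Scheme.succ v) :
    (scheme τ V nb).endLaw ((scheme τ V nb).script v r) (some v)
      (some (Scheme.endpoint v tr)) ≠ 0 := by
  rw [Scheme.some_endpoint hs]
  exact Scheme.mem_endLaw_of_mem_traceLaw _ htr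

theorem Cube.efficient :
    (scheme τ V nb).Efficient (fun v => rank τ V v.1) (2 * d) where
  half_le v r hr := by
    classical
    rw [scheme_final] at hr
    have h1 := PMF.toOuterMeasure_add_compl ((scheme τ V nb).trial v r) (Scheme.succ v)
    have h2 : ((scheme τ V nb).trial v r).toOuterMeasure (Scheme.succ v)ᶜ ≤ 2⁻¹ := by
      refine le_trans (le_of_eq ?_) (H.endLaw_none_le v hr)
      rw [PMF.apply_eq_expect, ← trial_getLastD, PMF.toOuterMeasure_eq_expect]
      congr 1
      funext tr
      simp [Set.indicator_apply, Scheme.succ]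
    by_contra! hcon
    have h3 := ENNReal.add_lt_add_of_lt_of_le (ne_top_of_le_ne_top (by simp) h2) hcon h2
    rw [h1, ENNReal.inv_two_add_inv_two] at h3
    exact lt_irrefl _ h3
  rank_lt v r hv tr htr hs := by
    rw [scheme_final] at hv
    obtain ⟨h1, h2, h3⟩ := H.hop_agree hv r (endpoint_mem htr hs)
    exact H.rank_lt hv h1 h2 h3
  length_le v r := by
    rw [scheme, List.length_map]
    exact length_entries_le _ H.d_pos
  script_ne_nil v r _ hl := H.ne_nil_of_mem_script v r hl

end Efficient

end SemiHypercube


namespace Scheme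

variable {W : Type*} {S : Scheme W} {rank : W → ℕ} {J : ℕ} {r : W}

/-! ### Visits of a random walk -/

open scoped Classical in
/-- The expectation of a function of the next vertex, where the walk ends in final vertices. -/
noncomputable def next (S : Scheme W) (r : W) (g : W → ℝ≥0∞) (v : W) : ℝ≥0∞ :=
  if S.final v then 0 else (S.condTrial v r).expect fun tr => g (endpoint v tr)

/-- The expected sum of `f` over the first `n` vertices of the walk to `r`. -/
noncomputable def visits (S : Scheme W) (r : W) (f : W → ℝ≥0∞) : ℕ → W → ℝ≥0∞
  | 0, _ => 0
  | n + 1, v => f v + S.next r (visits S r f n) v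

theorem next_mono {g g' : W → ℝ≥0∞} (h : ∀ v, g v ≤ g' v) (v : W) : S.next r g v ≤ S.next r g' v := by
  unfold next
  split_ifs
  · exact le_rfl
  · exact PMF.expect_mono fun tr _ => h _

theorem next_add (g g' : W → ℝ≥0∞) (v : W) :
    S.next r (fun w => g w + g' w) v = S.next r g v + S.next r g' v := by
  unfold next
  split_ifs
  · simp
  · exact PMF.expect_add _ _ _

theorem next_sum {ι : Type*} (I : Finset ι) (c : ι → ℝ≥0∞) (g : ι → W → ℝ≥0∞) (v : W) :
    S.next r (fun w => ∑ i ∈ I, c i * g i w) v = ∑ i ∈ I, c i * S.next r (g i) v := by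
  unfold next
  split_ifs
  · simp
  · rw [PMF.expect_finsetSum]
    exact Finset.sum_congr rfl fun i _ => PMF.expect_mul_left _ _ _

/-- The function g is a potential: each visit counted by f is paid for by an expected drop of g, up
to charges to the visits counted by the f' i. The bound follows by summation along the walk. -/
theorem visits_le {ι : Type*} {I : Finset ι} {c : ι → ℝ≥0∞} {f g : W → ℝ≥0∞} {f' : ι → W → ℝ≥0∞}
    (h : ∀ v, f v + S.next r g v ≤ g v + ∑ i ∈ I, c i * f' i v) (n : ℕ) (v : W) :
    S.visits r f n v ≤ g v + ∑ i ∈ I, c i * S.visits r (f' i) n v := by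
  induction n generalizing v with
  | zero => simp [visits]
  | succ n ih =>
    calc S.visits r f (n + 1) v
        ≤ f v + S.next r (fun w => g w + ∑ i ∈ I, c i * S.visits r (f' i) n w) v :=
          add_le_add le_rfl (next_mono ih v)
      _ = f v + S.next r g v + ∑ i ∈ I, c i * S.next r (S.visits r (f' i) n) v := by
          rw [next_add, next_sum, add_assoc]
      _ ≤ g v + ∑ i ∈ I, c i * f' i v + ∑ i ∈ I, c i * S.next r (S.visits r (f' i) n) v :=
          add_le_add (h v) le_rfl
      _ = _ := by
          rw [add_assoc, ← Finset.sum_add_distrib]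
          simp only [visits, mul_add]

theorem visits_zero (n : ℕ) (v : W) : S.visits r (fun _ => 0) n v = 0 := by
  have := visits_le (S := S) (r := r) (I := (∅ : Finset ℕ)) (c := fun _ => 0) (f := fun _ => 0)
    (g := fun _ => 0) (f' := fun _ _ => 0) (fun v => by
      rw [zero_add]
      unfold next
      split_ifs <;> simp [PMF.expect_const]) n v
  simpa using this

open scoped Classical in
theorem visits_eq_sum [Fintype W] (f : W → ℝ≥0∞) (n : ℕ) (v : W) :
    S.visits r f n v = ∑ u, f u * S.visits r (fun w => if w = u then 1 else 0) n v := by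
  induction n generalizing v with
  | zero => simp [visits]
  | succ n ih =>
    simp only [visits, mul_add, Finset.sum_add_distrib, ← next_sum, ← ih]
    simp

theorem Efficient.expect_reach_occ (hS : S.Efficient rank J) (hr : S.final r) (n : ℕ) (v y : W) :
    (S.reach n v r).expect (fun a => occ y a) ≤
      S.visits r (fun u => (S.condTrial u r).expect fun tr => occ (some y) tr) n v := by
  have hcount : ∀ u, ∀ tr ∈ (S.condTrial u r).support, occ y tr.reduceOption ≤ occ (some y) tr := by
    intro u tr htr
    obtain ⟨h1, h2⟩ := hS.mem_condTrial hr htr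
    rw [← occ_map_some, S.map_some_reduceOption h2 h1]
  induction n generalizing v with
  | zero => simp [reach, visits, PMF.expect_pure, occ_nil]
  | succ n ih =>
    rw [reach, PMF.expect_bind, visits, next]
    by_cases hv : S.final v
    · simp only [hv, if_true, PMF.expect_pure, add_zero]
      exact PMF.expect_mono fun tr htr => hcount v tr htr
    · simp only [hv, if_false, PMF.expect_map, occ_append, PMF.expect_add,
        PMF.expect_const, Bool.false_eq_true]
      exact add_le_add (PMF.expect_mono fun tr htr => hcount v tr htr)
        (PMF.expect_mono fun tr _ => ih _)

theorem Efficient.next_le (hS : S.Efficient rank J) (hr : S.final r) (g : W → ℝ≥0∞) (v : W) :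
    S.next r g v ≤
      2 * (S.endLaw (S.script v r) (some v)).expect fun o => o.elim 0 g := by
  unfold next
  split_ifs
  · exact zero_le
  · refine le_trans (le_of_eq ?_) ((hS.condTrial_expect_le (v := v) hr
      (fun tr => (tr.getLastD (some v)).elim 0 g)).trans (le_of_eq ?_))
    · refine PMF.expect_congr fun tr htr => ?_
      rw [← some_endpoint (hS.mem_condTrial hr htr).1]
      rfl
    · rw [trial, expect_traceLaw_getLastD S _ _ fun o => o.elim 0 g]

theorem next_le_one {g : W → ℝ≥0∞} (hg : ∀ v, g v ≤ 1) (v : W) : S.next r g v ≤ 1 := by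
  unfold next
  split_ifs
  · exact zero_le
  · exact PMF.expect_le fun tr _ => hg _

end Scheme

namespace SemiHypercube

variable {k d : ℕ} {τ : ℝ} {V : Finset (Fin d → Fin k)} {G : SimpleGraph V}
  {nb : (Fin d → Fin k) → Fin d → Fin k → (Fin d → Fin k)}

/-! ### Visits of sites -/

/-- The solution of the recursion a_l = 1 + 4 ∑_{i < l} a_i, which governs the visits of sites. -/
theorem sum_four_mul_five_pow (l : ℕ) :
    (1 : ℝ≥0∞) + ∑ i ∈ Finset.range l, 4 * 5 ^ i = 5 ^ l := by
  induction l with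
  | zero => simp
  | succ l ih =>
    rw [Finset.sum_range_succ, ← add_assoc, ih, pow_succ]
    ring

open scoped Classical in
/-- The critical child of the prefix of length `l` of `u`. -/
noncomputable def critCl (τ : ℝ) (V : Finset (Fin d → Fin k)) (u : Fin d → Fin k) (l : ℕ) :
    Finset V :=
  (cl V u l).filter fun v => Crit τ V v.1 (l + 1)

theorem mem_critCl {u : Fin d → Fin k} {l : ℕ} {v : V} :
    v ∈ critCl τ V u l ↔ Agree l v.1 u ∧ Crit τ V v.1 (l + 1) := by
  simp [critCl, mem_cl]

theorem critCl_congr {u v : Fin d → Fin k} {l : ℕ} (h : Agree l u v) :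
    critCl τ V u l = critCl τ V v l := by
  rw [critCl, critCl, cl_congr h]

open scoped Classical in
/-- The indicator of the vertices at which walks hop out of the critical child of the prefix of
length `l` of `u`. -/
noncomputable def site (τ : ℝ) (V : Finset (Fin d → Fin k)) (u : Fin d → Fin k) (l : ℕ) (v : V) :
    ℝ≥0∞ :=
  if ¬ Final τ V v.1 ∧ hopLevel τ V v.1 = l ∧ Agree l v.1 u then 1 else 0

variable (H : Cube τ V G nb)
include H

theorem Cube.critCl_hopLevel {v : V} (hv : ¬ Final τ V v.1) :
    critCl τ V v.1 (hopLevel τ V v.1) = cl V v.1 (base τ V v.1) := by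
  have hlt := (H.hopLevel_spec hv).1
  rw [← H.cl_eq_cl_base (Nat.lt_succ_self _) hlt]
  have hc := H.crit_of_hopLevel_lt hv (Nat.lt_succ_self _) hlt
  ext u
  rw [mem_critCl, mem_cl]
  constructor
  · rintro ⟨h1, h2⟩
    exact Agree.succ (l := ⟨_, H.hopLevel_lt hv⟩) h1
      (H.crit_unique u v ⟨_, H.hopLevel_lt hv⟩ h1 h2 hc)
  · exact fun h => ⟨h.mono (Nat.le_succ _), hc.congr h.symm⟩

theorem Cube.mem_critCl_of_site {u : Fin d → Fin k} {l : ℕ} {v : V} (h : site τ V u l v ≠ 0) :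
    v ∈ critCl τ V u l := by
  classical
  rw [site, ne_eq, ite_eq_right_iff, not_forall] at h
  obtain ⟨⟨h1, rfl, h2⟩, -⟩ := h
  exact mem_critCl.2 ⟨h2, H.crit_of_hopLevel_lt h1 (Nat.lt_succ_self _) (H.hopLevel_spec h1).1⟩

theorem Cube.spread_inv_le_base (v : V) :
    (spread τ V v.1 : ℝ≥0∞)⁻¹ ≤ 2 * ((cl V v.1 (base τ V v.1)).card : ℝ≥0∞)⁻¹ := by
  have h1 : ((cl V v.1 (base τ V v.1)).card : ℝ≥0∞) ≤ 2 * spread τ V v.1 := by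
    exact_mod_cast H.card_cl_base_le v
  calc (spread τ V v.1 : ℝ≥0∞)⁻¹ = 2 * (2 * (spread τ V v.1 : ℝ≥0∞))⁻¹ := by
        rw [ENNReal.mul_inv (Or.inl (by simp)) (Or.inl (by simp)), ← mul_assoc,
          ENNReal.mul_inv_cancel (by simp) (by simp), one_mul]
    _ ≤ _ := by gcongr

theorem Cube.spread_inv_le {v : V} (hv : ¬ Final τ V v.1) :
    (spread τ V v.1 : ℝ≥0∞)⁻¹ ≤
      2 * ((critCl τ V v.1 (hopLevel τ V v.1)).card : ℝ≥0∞)⁻¹ := by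
  rw [H.critCl_hopLevel hv]
  exact H.spread_inv_le_base v

/-- A hop on level l keeps the first l digits, so it leaves the critical child of the prefix of
length l of u. The bound refers to clusters of u only, so that it can be summed over v. -/
theorem Cube.hop_le_sum (v r u : V) (hv : ¬ Final τ V v.1) :
    (scheme τ V nb).endLaw ((scheme τ V nb).script v r) (some v) (some u) ≤
      ∑ l ∈ Finset.range d, 2 * ((critCl τ V u.1 l).card : ℝ≥0∞)⁻¹ * site τ V u.1 l v := by
  classical
  by_cases h : (scheme τ V nb).endLaw ((scheme τ V nb).script v r) (some v) (some u) = 0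
  · rw [h]
    exact zero_le
  have hag := (H.hop_agree hv r h).1
  refine le_trans ?_ (Finset.single_le_sum (fun _ _ => zero_le)
    (Finset.mem_range.2 (H.hopLevel_lt hv)))
  rw [site, if_pos ⟨hv, rfl, hag.symm⟩, mul_one, critCl_congr hag]
  exact (H.hop_le hv r u).trans (H.spread_inv_le hv)

variable {r : V} (hr : Final τ V r.1)
include hr

-- The 4 is a factor 2 for conditioning on success times a factor 2 between the spread and the size
-- of the cluster.
open scoped Classical in
theorem Cube.next_indicator_le {v : V} (hv : ¬ Final τ V v.1) (B : Finset V) :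
    (scheme τ V nb).next r (fun w => if w ∈ B then 1 else 0) v ≤
      4 * B.card * ((critCl τ V v.1 (hopLevel τ V v.1)).card : ℝ≥0∞)⁻¹ ∧
    ((∀ w ∈ B, (scheme τ V nb).endLaw ((scheme τ V nb).script v r) (some v) (some w) = 0) →
      (scheme τ V nb).next r (fun w => if w ∈ B then 1 else 0) v = 0) := by
  have h1 := H.efficient.next_le (scheme_final r |>.2 hr) (fun w => if w ∈ B then 1 else 0) v
  have h2 : ((scheme τ V nb).endLaw ((scheme τ V nb).script v r) (some v)).expect
      (fun o => o.elim 0 fun w => if w ∈ B then (1 : ℝ≥0∞) else 0) =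
      ∑ w ∈ B, (scheme τ V nb).endLaw ((scheme τ V nb).script v r) (some v) (some w) := by
    unfold PMF.expect
    rw [tsum_fintype, Fintype.sum_option]
    simp only [Option.elim, mul_zero, zero_add, mul_ite, mul_one]
    rw [← Finset.sum_filter]
    exact Finset.sum_congr (by ext; simp) fun _ _ => rfl
  rw [h2] at h1
  constructor
  · refine h1.trans ?_
    calc _ ≤ 2 * ∑ _w ∈ B, 2 * ((critCl τ V v.1 (hopLevel τ V v.1)).card : ℝ≥0∞)⁻¹ := by
          gcongr with w
          exact (H.hop_le hv r w).trans (H.spread_inv_le hv)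
      _ = _ := by
          rw [Finset.sum_const, nsmul_eq_mul]
          ring
  · intro h
    rw [Finset.sum_eq_zero h, mul_zero] at h1
    exact le_antisymm h1 zero_le

-- The potential is the indicator of the critical child. Inside it, v hops on level l or on a deeper
-- one, because level l has a solid child. A hop on level l ends outside the critical child, so the
-- visit of the site uses up the potential; deeper hops leave the site uncounted. From outside, the
-- critical child is entered only by a hop on a level l' < l, which is charged to the site of l'.
open scoped Classical in
theorem Cube.site_add_next_le (u : V) {l : ℕ} (hl : HasSol τ V u.1 l) (v : V) :
    site τ V u.1 l v +
      (scheme τ V nb).next r (fun w => if w ∈ critCl τ V u.1 l then 1 else 0) v ≤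
    (if v ∈ critCl τ V u.1 l then 1 else 0) + ∑ l' ∈ Finset.range l,
      4 * (critCl τ V u.1 l).card * ((critCl τ V u.1 l').card : ℝ≥0∞)⁻¹ * site τ V u.1 l' v := by
  by_cases hv : Final τ V v.1
  · have h1 : (scheme τ V nb).next r (fun w => if w ∈ critCl τ V u.1 l then 1 else 0) v = 0 := by
      rw [Scheme.next, if_pos ((scheme_final v).2 hv)]
    rw [h1, site, if_neg (by simp [hv]), zero_add]
    exact zero_le
  obtain ⟨hle, hzero⟩ := H.next_indicator_le hr hv (critCl τ V u.1 l)
  set p := hopLevel τ V v.1 with hp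
  have hpd := H.hopLevel_lt hv
  by_cases hvc : v ∈ critCl τ V u.1 l
  · rw [if_pos hvc]
    obtain ⟨hag, hcr⟩ := mem_critCl.1 hvc
    refine le_trans ?_ le_self_add
    have htop : top τ V ≤ l := Nat.sInf_le ⟨u, hl⟩
    have hbase : l < base τ V v.1 := by
      by_contra hcon
      exact H.not_crit_of_base_lt v (by omega) hcr
    have hlp : l ≤ p := by
      by_contra hcon
      exact H.not_hasSol (not_le.1 hcon) hbase (hl.congr hag.symm)
    rcases hlp.eq_or_lt with rfl | hlp
    · rw [hzero, add_zero, site]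
      · split_ifs <;> simp
      · intro w hw
        by_contra h
        exact (H.hop_agree hv r h).2.1 (mem_critCl.1 hw).2
    · rw [site, if_neg (by rintro ⟨-, h, -⟩; omega), zero_add]
      exact Scheme.next_le_one (fun w => by split_ifs <;> simp) v
  · have hs0 : site τ V u.1 l v = 0 := by
      by_contra h
      exact hvc (H.mem_critCl_of_site h)
    rw [if_neg hvc, hs0, zero_add, zero_add]
    by_cases hex : ∃ w ∈ critCl τ V u.1 l,
      (scheme τ V nb).endLaw ((scheme τ V nb).script v r) (some v) (some w) ≠ 0
    · obtain ⟨w, hw, hne⟩ := hex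
      obtain ⟨hw1, hw2⟩ := mem_critCl.1 hw
      obtain ⟨ha, hc, -⟩ := H.hop_agree hv r hne
      have hpl : p < l := by
        by_contra hcon
        rcases (not_lt.1 hcon).eq_or_lt with h | h
        · rw [h] at hw2
          exact hc hw2
        · exact hvc (mem_critCl.2 ⟨(ha.mono h.le).symm.trans hw1, hw2.congr (ha.mono h)⟩)
      have hag : Agree p v.1 u.1 := ha.symm.trans (hw1.mono hpl.le)
      refine le_trans ?_ (Finset.single_le_sum (fun _ _ => zero_le) (Finset.mem_range.2 hpl))
      rw [site, if_pos ⟨hv, rfl, hag⟩, mul_one, ← critCl_congr hag]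
      exact hle
    · push Not at hex
      rw [hzero hex]
      exact zero_le

open scoped Classical in
theorem Cube.vertex_add_next_le (u v : V) :
    (if v = u then 1 else 0) + (scheme τ V nb).next r (fun w => if w = u then 1 else 0) v ≤
    (if v = u then 1 else 0) + ∑ l' ∈ Finset.range d,
      4 * ((critCl τ V u.1 l').card : ℝ≥0∞)⁻¹ * site τ V u.1 l' v := by
  refine add_le_add le_rfl ?_
  by_cases hv : Final τ V v.1
  · rw [Scheme.next, if_pos ((scheme_final v).2 hv)]
    exact zero_le
  obtain ⟨hle, hzero⟩ := H.next_indicator_le hr hv {u}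
  simp only [Finset.mem_singleton, forall_eq, Finset.card_singleton, Nat.cast_one, mul_one]
    at hle hzero
  by_cases hne : (scheme τ V nb).endLaw ((scheme τ V nb).script v r) (some v) (some u) = 0
  · rw [hzero hne]
    exact zero_le
  · have ha := (H.hop_agree hv r hne).1
    refine le_trans ?_ (Finset.single_le_sum (fun _ _ => zero_le)
      (Finset.mem_range.2 (H.hopLevel_lt hv)))
    rw [site, if_pos ⟨hv, rfl, ha.symm⟩, mul_one, critCl_congr ha]
    exact hle

/-- The potential inequality turns into X_l ≤ K|C_l| + ∑_{l' < l} 4(|C_l|/|C_l'|)X_l' for the visits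
X_l of the site and the sizes |C_l| of the critical children; induction on l gives the factor 5^l. A
level without solid children is nobody's hop level. -/
theorem Cube.sum_visits_site_le {ld : V → ℝ≥0∞} {K : ℝ≥0∞} (hld : ∀ s, ld s ≤ K) (n : ℕ) (u : V)
    (l : ℕ) : ∑ s, ld s * (scheme τ V nb).visits r (site τ V u.1 l) n s ≤
      K * 5 ^ l * (critCl τ V u.1 l).card := by
  classical
  induction l using Nat.strong_induction_on with
  | _ l ih =>
    by_cases hl : HasSol τ V u.1 l
    · calc _ ≤ ∑ s, ld s * ((if s ∈ critCl τ V u.1 l then 1 else 0) + ∑ l' ∈ Finset.range l,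
              4 * (critCl τ V u.1 l).card * ((critCl τ V u.1 l').card : ℝ≥0∞)⁻¹ *
                (scheme τ V nb).visits r (site τ V u.1 l') n s) := by
            gcongr with s
            exact Scheme.visits_le (H.site_add_next_le hr u hl) n s
        _ = ∑ s ∈ critCl τ V u.1 l, ld s + ∑ l' ∈ Finset.range l,
              4 * (critCl τ V u.1 l).card * ((critCl τ V u.1 l').card : ℝ≥0∞)⁻¹ *
                ∑ s, ld s * (scheme τ V nb).visits r (site τ V u.1 l') n s := by
            simp only [mul_add, Finset.sum_add_distrib, Finset.mul_sum]
            congr 1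
            · simp only [mul_ite, mul_one, mul_zero]
              rw [← Finset.sum_filter]
              exact Finset.sum_congr (by ext; simp) fun _ _ => rfl
            · rw [Finset.sum_comm]
              refine Finset.sum_congr rfl fun l' _ => Finset.sum_congr rfl fun s _ => ?_
              ring
        _ ≤ (critCl τ V u.1 l).card * K + ∑ l' ∈ Finset.range l,
              (critCl τ V u.1 l).card * K * (4 * 5 ^ l') := by
            refine add_le_add ?_ (Finset.sum_le_sum fun l' hl' => ?_)
            · rw [← nsmul_eq_mul]
              exact Finset.sum_le_card_nsmul _ _ _ fun s _ => hld s
            · calc _ ≤ 4 * (critCl τ V u.1 l).card * ((critCl τ V u.1 l').card : ℝ≥0∞)⁻¹ *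
                    (K * 5 ^ l' * (critCl τ V u.1 l').card) := by
                    gcongr
                    exact ih l' (Finset.mem_range.1 hl')
                _ = (critCl τ V u.1 l).card * K * (4 * 5 ^ l') *
                    (((critCl τ V u.1 l').card : ℝ≥0∞)⁻¹ * (critCl τ V u.1 l').card) := by ring
                _ ≤ _ := mul_le_of_le_one_right zero_le (ENNReal.inv_mul_le_one _)
        _ = _ := by
            rw [← Finset.mul_sum, ← mul_one_add, sum_four_mul_five_pow]
            ring
    · have h0 : site τ V u.1 l = fun _ => 0 := by
        funext v
        rw [site, if_neg]
        rintro ⟨h1, rfl, h2⟩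
        exact hl ((H.hopLevel_spec h1).2.congr h2)
      rw [h0]
      simp [Scheme.visits_zero]

open scoped Classical in
theorem Cube.sum_visits_vertex_le {ld : V → ℝ≥0∞} {K : ℝ≥0∞} (hld : ∀ s, ld s ≤ K) (n : ℕ) (u : V) :
    ∑ s, ld s * (scheme τ V nb).visits r (fun w => if w = u then 1 else 0) n s ≤ K * 5 ^ d := by
  calc _ ≤ ∑ s, ld s * ((if s = u then 1 else 0) + ∑ l' ∈ Finset.range d,
          4 * ((critCl τ V u.1 l').card : ℝ≥0∞)⁻¹ *
            (scheme τ V nb).visits r (site τ V u.1 l') n s) := by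
        gcongr with s
        exact Scheme.visits_le (H.vertex_add_next_le hr u) n s
    _ = ld u + ∑ l' ∈ Finset.range d, 4 * ((critCl τ V u.1 l').card : ℝ≥0∞)⁻¹ *
            ∑ s, ld s * (scheme τ V nb).visits r (site τ V u.1 l') n s := by
        simp only [mul_add, Finset.sum_add_distrib, Finset.mul_sum]
        congr 1
        · simp
        · rw [Finset.sum_comm]
          refine Finset.sum_congr rfl fun l' _ => Finset.sum_congr rfl fun s _ => ?_
          ring
    _ ≤ K + ∑ l' ∈ Finset.range d, K * (4 * 5 ^ l') := by
        refine add_le_add (hld u) (Finset.sum_le_sum fun l' _ => ?_)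
        calc _ ≤ 4 * ((critCl τ V u.1 l').card : ℝ≥0∞)⁻¹ *
                (K * 5 ^ l' * (critCl τ V u.1 l').card) := by
                gcongr
                exact H.sum_visits_site_le hr hld n u l'
          _ = K * (4 * 5 ^ l') *
                (((critCl τ V u.1 l').card : ℝ≥0∞)⁻¹ * (critCl τ V u.1 l').card) := by ring
          _ ≤ _ := mul_le_of_le_one_right zero_le (ENNReal.inv_mul_le_one _)
    _ = _ := by
        rw [← Finset.mul_sum, ← mul_one_add, sum_four_mul_five_pow]

end SemiHypercube


/-! ### Counting the occurrences of a vertex in traces and walks. -/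

namespace Scheme

variable {W : Type*} (S : Scheme W)

theorem expect_traceLaw_append_occ (ls ls' : List (List ℕ)) (o : Option W) (y : W) :
    (S.traceLaw (ls ++ ls') o).expect (fun tr => occ (some y) tr) =
      ∑ i ∈ Finset.range ls.length, S.endLaw (ls.take (i + 1)) o (some y) +
        ∑ i ∈ Finset.range ls'.length, S.endLaw (ls ++ ls'.take (i + 1)) o (some y) := by
  rw [expect_traceLaw_occ, List.length_append, Finset.sum_range_add]
  congr 1
  · refine Finset.sum_congr rfl fun i hi => ?_
    rw [List.take_append_of_le_length (Finset.mem_range.1 hi)]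
  · refine Finset.sum_congr rfl fun i _ => ?_
    rw [add_assoc, List.take_length_add_append]

theorem expect_walkLaw_occ {T : Finset W} (hT : T.Nonempty) (n : ℕ) (s t y : W) :
    (S.walkLaw T.toList n s t).expect (fun x => occ y x) =
      (T.card : ℝ≥0∞)⁻¹ * ∑ r ∈ T,
        ((occ y [s] + (S.reach n s r).expect fun a => occ y a) +
        (occ y [t] + (S.reach n t r).expect fun a => occ y a)) := by
  rw [← Finset.sum_map_toList, ← Finset.length_toList,
    ← expect_unif_getD (by simpa using hT.ne_empty) s]
  simp only [walkLaw, PMF.expect_bind, PMF.expect_map]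
  congr 1
  funext x
  simp only [occ_append, occ_reverse, occ_cons, occ_nil, zero_add, PMF.expect_add, PMF.expect_const]
  ring

end Scheme

namespace SemiHypercube

open Scheme (occ)

variable {k d : ℕ} {τ : ℝ} {V : Finset (Fin d → Fin k)} {G : SimpleGraph V}
  {nb : (Fin d → Fin k) → Fin d → Fin k → (Fin d → Fin k)}

/-! ### Congestion -/

theorem take_upScript (v : Fin d → Fin k) {n i : ℕ} (hi : i ≤ n) :
    (upScript τ V v n).take i = upScript τ V v i := by
  rw [upScript, upScript, ← List.map_take, List.take_range, min_eq_left hi]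

theorem take_goalScript (r : Fin d → Fin k) {n i : ℕ} (hi : i ≤ n) :
    (goalScript τ V r n).take i = goalScript τ V r i := by
  rw [goalScript, goalScript, ← List.map_take, List.take_range, min_eq_left hi]

variable (H : Cube τ V G nb)
include H

-- The spread of the position, expressed through the clusters of y instead of u: for a fixed level
-- the bounds sum to at most 2 over all u.
open scoped Classical in
theorem Cube.upLaw_le (u y : V) {n : ℕ} (hn : n < d - base τ V u.1) :
    upLaw τ V nb u (n + 1) (some y) ≤
      if u ∈ cl V y.1 (d - (n + 1)) then 2 * ((cl V y.1 (d - (n + 1))).card : ℝ≥0∞)⁻¹ else 0 := by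
  by_cases h0 : upLaw τ V nb u (n + 1) (some y) = 0
  · rw [h0]
    exact zero_le
  rcases Nat.lt_or_ge (n + 1 + base τ V u.1) d with hlt | hge
  · obtain ⟨h1, h2, -⟩ := H.upLaw_spec u (n + 1) hlt
    rw [if_pos (mem_cl.2 (h2 y h0).symm)]
    refine (h1 y).trans ?_
    have h3 := card_cl_le (V := V) y.1 (d - (n + 1))
    rw [show d - (d - (n + 1)) = n + 1 by omega] at h3
    calc ((k ^ (n + 1) : ℕ) : ℝ≥0∞)⁻¹ ≤ ((cl V y.1 (d - (n + 1))).card : ℝ≥0∞)⁻¹ := by gcongr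
      _ ≤ _ := by
        rw [two_mul]
        exact le_self_add
  · obtain ⟨h1, h2, -⟩ := H.upLaw_base_spec u
    rw [show n + 1 = d - base τ V u.1 by omega] at h0 ⊢
    have hb := H.base_lt u
    rw [show d - (d - base τ V u.1) = base τ V u.1 by omega]
    have hag := (h2 y h0).1
    rw [if_pos (mem_cl.2 hag.symm), cl_congr hag]
    exact (h1 y).trans (H.spread_inv_le_base u)

open scoped Classical in
theorem Cube.goalLaw_le {u r : V} (hu : Final τ V u.1) (hr : Final τ V r.1) (y : V) {n : ℕ}
    (hn : n < d - top τ V) :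
    goalLaw τ V nb u r (n + 1) (some y) ≤ if r ∈ cl V y.1 (top τ V + n + 1) then
      ((k ^ (d - (top τ V + n + 1)) : ℕ) : ℝ≥0∞)⁻¹ else 0 := by
  obtain ⟨h1, h2, -⟩ := H.goalLaw_spec hu hr n (by omega)
  by_cases h0 : goalLaw τ V nb u r (n + 1) (some y) = 0
  · rw [h0]
    exact zero_le
  · rw [if_pos (mem_cl.2 (h2 y h0).symm)]
    exact h1 y

open scoped Classical in
theorem Cube.trial_occ_le (u : V) {r : V} (hr : Final τ V r.1) (y : V) :
    ((scheme τ V nb).trial u r).expect (fun tr => occ (some y) tr) ≤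
      ∑ n ∈ Finset.range d, (if u ∈ cl V y.1 (d - (n + 1)) then
        2 * ((cl V y.1 (d - (n + 1))).card : ℝ≥0∞)⁻¹ else 0) +
      ∑ l ∈ Finset.range d, 2 * ((critCl τ V y.1 l).card : ℝ≥0∞)⁻¹ * site τ V y.1 l u +
      ∑ n ∈ Finset.range d, (if r ∈ cl V y.1 (top τ V + n + 1) then
      ((k ^ (d - (top τ V + n + 1)) : ℕ) : ℝ≥0∞)⁻¹ else 0) := by
  have hup : ∑ i ∈ Finset.range (upScript τ V u.1 (d - base τ V u.1)).length,
      (scheme τ V nb).endLaw ((upScript τ V u.1 (d - base τ V u.1)).take (i + 1)) (some u) (some y) ≤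
      ∑ n ∈ Finset.range d, (if u ∈ cl V y.1 (d - (n + 1)) then
        2 * ((cl V y.1 (d - (n + 1))).card : ℝ≥0∞)⁻¹ else 0) := by
    rw [length_upScript]
    refine le_trans (Finset.sum_le_sum fun n hn => ?_)
      (Finset.sum_le_sum_of_subset (Finset.range_mono (Nat.sub_le _ _)))
    rw [Finset.mem_range] at hn
    rw [take_upScript _ (by omega)]
    exact H.upLaw_le u y hn
  rw [Scheme.trial]
  by_cases hu : Final τ V u.1
  · rw [script_of_final hu, Scheme.expect_traceLaw_append_occ]
    refine add_le_add (hup.trans le_self_add) ?_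
    have hlen : (goalScript τ V r.1 (d - top τ V)).length = d - top τ V := by simp [goalScript]
    rw [hlen]
    refine le_trans (Finset.sum_le_sum fun n hn => ?_)
      (Finset.sum_le_sum_of_subset (Finset.range_mono (Nat.sub_le _ _)))
    rw [Finset.mem_range] at hn
    rw [take_goalScript _ (by omega)]
    exact H.goalLaw_le hu hr y hn
  · have hh := H.hop_le_sum u r y hu
    rw [script_of_not_final hu] at hh ⊢
    rw [Scheme.expect_traceLaw_append_occ]
    refine le_trans (add_le_add hup ?_) le_self_add
    simpa using hh

omit H in
theorem sum_ite_inv_le {ι : Type*} [Fintype ι] (A : Finset ι) [DecidablePred (· ∈ A)] {N : ℕ}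
    (hN : A.card ≤ N) (B : Finset ι) :
    ∑ i ∈ B, (if i ∈ A then (N : ℝ≥0∞)⁻¹ else 0) ≤ 1 := by
  classical
  rw [← Finset.sum_filter, Finset.sum_const, nsmul_eq_mul]
  calc _ ≤ (N : ℝ≥0∞) * (N : ℝ≥0∞)⁻¹ := by
        gcongr
        refine (Finset.card_le_card fun i hi => ?_).trans hN
        exact (Finset.mem_filter.1 hi).2
    _ ≤ 1 := ENNReal.mul_inv_le_one _

-- Each level contributes at most 2 on the way up and 2 through hops, summed over the starts u. On
-- the way down it contributes at most 1 when summed over r, for each of the at most 3|core| starts.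
-- Conditioning on success doubles the sum: 14 = 2(2 + 2 + 3).
open scoped Classical in
theorem Cube.sum_trial_occ_le (y : V) :
    ((coreSet τ V).card : ℝ≥0∞)⁻¹ * ∑ r ∈ coreSet τ V, ∑ u,
      ((scheme τ V nb).condTrial u r).expect (fun tr => occ (some y) tr) ≤ 14 * d := by
  set c := (coreSet τ V).card with hc
  have hV : (0 : ℕ) < c := by
    have h1 := H.card_le_coreSet
    have h2 : 0 < Fintype.card V := Fintype.card_pos_iff.2 ⟨y⟩
    omega
  have hcc : (c : ℝ≥0∞)⁻¹ * c = 1 :=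
    ENNReal.inv_mul_cancel (by exact_mod_cast hV.ne') (ENNReal.natCast_ne_top _)
  have h1 : ∑ u : V, ∑ n ∈ Finset.range d, (if u ∈ cl V y.1 (d - (n + 1)) then
        2 * ((cl V y.1 (d - (n + 1))).card : ℝ≥0∞)⁻¹ else 0) ≤ 2 * d := by
    rw [Finset.sum_comm]
    calc _ ≤ ∑ _n ∈ Finset.range d, (2 : ℝ≥0∞) := by
          refine Finset.sum_le_sum fun n _ => ?_
          have := sum_ite_inv_le (cl V y.1 (d - (n + 1))) le_rfl Finset.univ
          calc _ = 2 * ∑ u : V, (if u ∈ cl V y.1 (d - (n + 1)) then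
                ((cl V y.1 (d - (n + 1))).card : ℝ≥0∞)⁻¹ else 0) := by
                rw [Finset.mul_sum]
                exact Finset.sum_congr rfl fun u _ => by split_ifs <;> simp
            _ ≤ 2 * 1 := by gcongr
            _ = 2 := mul_one _
      _ = 2 * d := by rw [Finset.sum_const, Finset.card_range, nsmul_eq_mul, mul_comm]
  have h2 : ∑ u : V, ∑ l ∈ Finset.range d,
      2 * ((critCl τ V y.1 l).card : ℝ≥0∞)⁻¹ * site τ V y.1 l u ≤ 2 * d := by
    rw [Finset.sum_comm]
    calc _ ≤ ∑ _l ∈ Finset.range d, (2 : ℝ≥0∞) := by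
          refine Finset.sum_le_sum fun l _ => ?_
          have := sum_ite_inv_le (critCl τ V y.1 l) le_rfl Finset.univ
          calc _ ≤ ∑ u : V, 2 * (if u ∈ critCl τ V y.1 l then
                ((critCl τ V y.1 l).card : ℝ≥0∞)⁻¹ else 0) := by
                refine Finset.sum_le_sum fun u _ => ?_
                by_cases h0 : site τ V y.1 l u = 0
                · rw [h0, mul_zero]
                  exact zero_le
                · rw [if_pos (H.mem_critCl_of_site h0)]
                  refine mul_le_of_le_one_right zero_le ?_
                  unfold site
                  split_ifs <;> simp
            _ ≤ 2 * 1 := by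
                rw [← Finset.mul_sum]
                gcongr
            _ = 2 := mul_one _
      _ = 2 * d := by rw [Finset.sum_const, Finset.card_range, nsmul_eq_mul, mul_comm]
  have h3 : ∑ r ∈ coreSet τ V, ∑ n ∈ Finset.range d, (if r ∈ cl V y.1 (top τ V + n + 1) then
      ((k ^ (d - (top τ V + n + 1)) : ℕ) : ℝ≥0∞)⁻¹ else 0) ≤ d := by
    rw [Finset.sum_comm]
    calc _ ≤ ∑ _n ∈ Finset.range d, (1 : ℝ≥0∞) := Finset.sum_le_sum fun n _ =>
          sum_ite_inv_le (cl V y.1 (top τ V + n + 1)) (card_cl_le _ _) _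
      _ = d := by rw [Finset.sum_const, Finset.card_range, nsmul_eq_mul, mul_one]
  calc _ ≤ (c : ℝ≥0∞)⁻¹ * ∑ r ∈ coreSet τ V, ∑ u : V, 2 * (_ + _ + _) := by
        refine mul_le_mul_right (Finset.sum_le_sum fun r hr => Finset.sum_le_sum fun u _ => ?_) _
        rw [mem_coreSet] at hr
        refine (H.efficient.condTrial_expect_le ((scheme_final r).2 hr) _).trans ?_
        exact mul_le_mul_right (H.trial_occ_le u hr y) _
    _ ≤ (c : ℝ≥0∞)⁻¹ * (2 * (c * (2 * d) + c * (2 * d) + 3 * c * d)) := by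
        simp only [← Finset.mul_sum, Finset.sum_add_distrib]
        refine mul_le_mul_right (mul_le_mul_right (add_le_add (add_le_add ?_ ?_) ?_) _) _
        · rw [Finset.sum_const, nsmul_eq_mul]
          exact mul_le_mul_right h1 _
        · rw [Finset.sum_const, nsmul_eq_mul]
          exact mul_le_mul_right h2 _
        · rw [Finset.sum_comm, Finset.sum_const, nsmul_eq_mul, Finset.card_univ]
          refine mul_le_mul' ?_ h3
          exact_mod_cast H.card_le_coreSet
    _ = ((c : ℝ≥0∞)⁻¹ * c) * (14 * d) := by ring
    _ = 14 * d := by rw [hcc, one_mul]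

-- Every visit of y other than as an endpoint happens in a successful trial from some u. For each
-- target r, at most K · 5^d such trials from u are expected; as this does not depend on u or r, the
-- visits of one trial can be summed over u and averaged over r separately. Both halves of a route
-- start a walk, so s and t count symmetrically and the demand enters through its load.
open scoped Classical in
theorem Cube.sum_walkLaw_occ_le {D : V → V → ℝ≥0} {K : ℝ≥0∞}
    (hD : ∀ s, (Routing.load D s : ℝ≥0∞) ≤ K) (n : ℕ) (y : V) :
    ∑ s, ∑ t, (D s t : ℝ≥0∞) * ((scheme τ V nb).walkLaw (coreSet τ V).toList n s t).expect
      (fun x => occ y x) ≤ K + 14 * d * (K * 5 ^ d) := by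
  set c := (coreSet τ V).card with hc
  have hV : (0 : ℕ) < c := by
    have h1 := H.card_le_coreSet
    have h2 : 0 < Fintype.card V := Fintype.card_pos_iff.2 ⟨y⟩
    omega
  have hcc : (c : ℝ≥0∞)⁻¹ * c = 1 :=
    ENNReal.inv_mul_cancel (by exact_mod_cast hV.ne') (ENNReal.natCast_ne_top _)
  set q : V → V → ℝ≥0∞ := fun r u =>
    ((scheme τ V nb).condTrial u r).expect fun tr => occ (some y) tr with hq
  set U : V → V → ℝ≥0∞ := fun r s =>
    occ y [s] + (scheme τ V nb).visits r (q r) n s with hU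
  have hwalk : ∀ s t, ((scheme τ V nb).walkLaw (coreSet τ V).toList n s t).expect
      (fun x => occ y x) ≤ (c : ℝ≥0∞)⁻¹ * ∑ r ∈ coreSet τ V, (U r s + U r t) := by
    intro s t
    rw [Scheme.expect_walkLaw_occ _ (Finset.card_pos.1 hV)]
    refine mul_le_mul_right (Finset.sum_le_sum fun r hr => ?_) _
    have hr' := (scheme_final (nb := nb) r).2 (mem_coreSet.1 hr)
    exact add_le_add (add_le_add le_rfl (H.efficient.expect_reach_occ hr' n s y))
      (add_le_add le_rfl (H.efficient.expect_reach_occ hr' n t y))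
  have hload : ∀ g : V → ℝ≥0∞, ∑ s, ∑ t, (D s t : ℝ≥0∞) * (g s + g t) =
      ∑ s, (Routing.load D s : ℝ≥0∞) * g s := by
    intro g
    simp only [mul_add, Finset.sum_add_distrib]
    rw [Finset.sum_comm (f := fun s t => (D s t : ℝ≥0∞) * g t), ← Finset.sum_add_distrib]
    refine Finset.sum_congr rfl fun s _ => ?_
    rw [Routing.load, ← Finset.sum_add_distrib]
    push_cast
    rw [Finset.sum_mul]
    exact Finset.sum_congr rfl fun t _ => by ring
  calc _ ≤ ∑ s, ∑ t, (D s t : ℝ≥0∞) * ((c : ℝ≥0∞)⁻¹ * ∑ r ∈ coreSet τ V, (U r s + U r t)) :=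
        Finset.sum_le_sum fun s _ => Finset.sum_le_sum fun t _ => mul_le_mul_right (hwalk s t) _
    _ = ∑ s, (Routing.load D s : ℝ≥0∞) * ((c : ℝ≥0∞)⁻¹ * ∑ r ∈ coreSet τ V, U r s) := by
        rw [← hload]
        refine Finset.sum_congr rfl fun s _ => Finset.sum_congr rfl fun t _ => ?_
        rw [Finset.sum_add_distrib, mul_add]
    _ = (c : ℝ≥0∞)⁻¹ * ∑ r ∈ coreSet τ V, ∑ s, (Routing.load D s : ℝ≥0∞) * U r s := by
        rw [Finset.sum_comm, Finset.mul_sum]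
        refine Finset.sum_congr rfl fun s _ => ?_
        rw [← Finset.mul_sum]
        ring
    _ ≤ (c : ℝ≥0∞)⁻¹ * ∑ r ∈ coreSet τ V, (K + (∑ u, q r u) * (K * 5 ^ d)) := by
        refine mul_le_mul_right (Finset.sum_le_sum fun r hr => ?_) _
        have hr' := mem_coreSet.1 hr
        simp only [hU, mul_add, Finset.sum_add_distrib]
        refine add_le_add ?_ ?_
        · simpa [occ] using hD y
        · calc _ = ∑ s, ∑ u, q r u * ((Routing.load D s : ℝ≥0∞) *
                (scheme τ V nb).visits r (fun w => if w = u then 1 else 0) n s) := by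
                refine Finset.sum_congr rfl fun s _ => ?_
                rw [Scheme.visits_eq_sum, Finset.mul_sum]
                exact Finset.sum_congr rfl fun u _ => by ring_nf
            _ ≤ ∑ u, q r u * (K * 5 ^ d) := by
                rw [Finset.sum_comm]
                refine Finset.sum_le_sum fun u _ => ?_
                rw [← Finset.mul_sum]
                exact mul_le_mul_right (H.sum_visits_vertex_le hr' hD n u) _
            _ = _ := (Finset.sum_mul _ _ _).symm
    _ = ((c : ℝ≥0∞)⁻¹ * c) * K +
          ((c : ℝ≥0∞)⁻¹ * ∑ r ∈ coreSet τ V, ∑ u, q r u) * (K * 5 ^ d) := by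
        rw [Finset.sum_add_distrib, Finset.sum_const, nsmul_eq_mul, ← Finset.sum_mul]
        ring
    _ ≤ K + 14 * d * (K * 5 ^ d) := by
        rw [hcc, one_mul]
        exact add_le_add le_rfl (mul_le_mul_left (H.sum_trial_occ_le y) _)

end SemiHypercube


namespace Scheme

variable {W : Type*} {S : Scheme W} {rank : W → ℕ} {J : ℕ} {R : W → W → Prop}

/-! ### The walks of a scheme -/

theorem chain_of_mem_traceLaw (hmove : ∀ y c z, S.move y c = some z → R y z) {ls : List (List ℕ)}
    (hne : ∀ l ∈ ls, l ≠ []) {v : W} {a : List W}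
    (h : a.map some ∈ (S.traceLaw ls (some v)).support) : (v :: a).IsChain R := by
  induction ls generalizing v a with
  | nil =>
    simp only [traceLaw, PMF.support_pure, Set.mem_singleton_iff, List.map_eq_nil_iff] at h
    simp [h]
  | cons l ls ih =>
    simp only [traceLaw, PMF.mem_support_bind_iff, PMF.mem_support_map_iff] at h
    obtain ⟨o, ho, tr, htr, h⟩ := h
    cases a with
    | nil => simp at h
    | cons y a =>
      rw [List.map_cons, List.cons.injEq] at h
      obtain ⟨rfl, rfl⟩ := h
      obtain ⟨c, -, hc⟩ := (S.mem_stepLaw (hne l (by simp))).1 ho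
      exact List.isChain_cons_cons.2
        ⟨hmove v c y hc.symm, ih (fun l hl => hne l (List.mem_cons_of_mem _ hl)) htr⟩

theorem Efficient.chain_of_mem_reach (hS : S.Efficient rank J)
    (hmove : ∀ y c z, S.move y c = some z → R y z) {r : W} (hr : S.final r)
    (hend : ∀ v, S.final v → ∀ tr ∈ (S.trial v r).support, tr ∈ succ v → endpoint v tr = r)
    {n : ℕ} {v : W} (hn : rank v < n) {a : List W} (ha : a ∈ (S.reach n v r).support) :
    (v :: a).IsChain R ∧ ∃ l, v :: a = l ++ [r] := by
  induction n generalizing v a with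
  | zero => omega
  | succ n ih =>
    simp only [reach, PMF.mem_support_bind_iff] at ha
    obtain ⟨tr, htr, ha⟩ := ha
    obtain ⟨h1, h2⟩ := hS.mem_condTrial hr htr
    have hmap := S.map_some_reduceOption h2 h1
    have hchain : (v :: tr.reduceOption).IsChain R :=
      chain_of_mem_traceLaw hmove (hS.script_ne_nil v r) (by rw [hmap]; exact h2)
    have hlast : ∃ l, v :: tr.reduceOption = l ++ [endpoint v tr] := by
      have h3 : some (endpoint v tr) = some (tr.reduceOption.getLastD v) := by
        rw [some_endpoint h1]
        conv_lhs => rw [← hmap]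
        generalize tr.reduceOption = a
        induction a using List.reverseRecOn with
        | nil => rfl
        | append_singleton a x _ => simp
      rw [Option.some_inj.1 h3]
      generalize tr.reduceOption = a
      induction a using List.reverseRecOn with
      | nil => exact ⟨[], by simp⟩
      | append_singleton a x _ => exact ⟨v :: a, by simp⟩
    obtain ⟨l, hl⟩ := hlast
    split_ifs at ha with hf
    · simp only [PMF.support_pure, Set.mem_singleton_iff] at ha
      subst ha
      rw [hend v hf tr h2 h1] at hl
      exact ⟨hchain, l, hl⟩
    · rw [PMF.mem_support_map_iff] at ha
      obtain ⟨b, hb, rfl⟩ := ha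
      have hlt := hS.rank_lt v r hf tr h2 h1
      obtain ⟨hc, l', hl'⟩ := ih (by omega) hb
      rw [← List.cons_append, hl]
      refine ⟨?_, l ++ l', ?_⟩
      · rw [hl] at hchain
        exact List.IsChain.append_overlap hchain hc (by simp)
      · rw [List.append_assoc, List.append_assoc, ← hl']
        rfl

/-- The walks that a scheme samples between `s` and `t`. -/
theorem Efficient.chain_of_mem_walkLaw (hS : S.Efficient rank J)
    (hmove : ∀ y c z, S.move y c = some z → R y z) (hrefl : ∀ y, R y y)
    (hsymm : ∀ y z, R y z → R z y) {core : List W} (hcore : core ≠ [])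
    (hfin : ∀ r ∈ core, S.final r)
    (hend : ∀ v r, S.final v → S.final r → ∀ tr ∈ (S.trial v r).support, tr ∈ succ v →
      endpoint v tr = r)
    {n : ℕ} (hn : ∀ v, rank v < n) {s t : W} {x : List W}
    (hx : x ∈ (S.walkLaw core n s t).support) :
    x.IsChain R ∧ x.head? = some s ∧ x.getLast? = some t ∧ x.length ≤ 2 * (n * J + 1) := by
  simp only [walkLaw, PMF.mem_support_bind_iff, PMF.mem_support_map_iff] at hx
  obtain ⟨i, hi, a, ha, b, hb, rfl⟩ := hx
  have hpos : 0 < core.length := List.length_pos_iff.2 hcore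
  rw [WordRAM.mem_support_unif] at hi
  have hi' : i < core.length := by omega
  have hmem : core.getD i s ∈ core := by
    rw [List.getD_eq_getElem _ _ hi']
    exact List.getElem_mem hi'
  set r := core.getD i s with hr
  have hr' := hfin r hmem
  have hla := hS.length_of_mem_reach hr' ha
  have hlb := hS.length_of_mem_reach hr' hb
  obtain ⟨ha1, la, ha2⟩ := hS.chain_of_mem_reach hmove hr' (fun v hv => hend v r hv hr') (hn s) ha
  obtain ⟨hb1, lb, hb2⟩ := hS.chain_of_mem_reach hmove hr' (fun v hv => hend v r hv hr') (hn t) hb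
  refine ⟨?_, by simp, by rw [List.reverse_cons, ← List.append_assoc, List.getLast?_concat], ?_⟩
  · rw [List.isChain_append]
    refine ⟨ha1, ?_, ?_⟩
    · rw [List.isChain_reverse]
      exact hb1.imp fun y z h => hsymm y z h
    · rw [ha2, hb2]
      simp only [List.getLast?_append, List.getLast?_singleton, List.reverse_append,
        List.reverse_singleton, Option.some_or, Option.mem_def, Option.some_inj]
      rintro y rfl z hz
      simp at hz
      subst hz
      exact hrefl _
  · simp only [List.length_append, List.length_cons, List.length_reverse]
    omega

end Scheme

/-! ### Paths -/

theorem SimpleGraph.exists_path_support_eq {W : Type*} {G : SimpleGraph W} {l : List W} {s t : W}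
    (hl : l.IsChain G.Adj) (hn : l.Nodup) (hs : l.head? = some s) (ht : l.getLast? = some t) :
    ∃ p : G.Path s t, (p : G.Walk s t).support = l := by
  suffices h : ∃ p : G.Walk s t, p.support = l by
    obtain ⟨p, hp⟩ := h
    exact ⟨⟨p, by rw [SimpleGraph.Walk.isPath_def, hp]; exact hn⟩, hp⟩
  clear hn
  induction l generalizing s with
  | nil => simp at hs
  | cons a l ih =>
    rw [List.head?_cons, Option.some_inj] at hs
    subst hs
    cases l with
    | nil =>
      rw [List.getLast?_singleton, Option.some_inj] at ht
      subst ht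
      exact ⟨.nil, rfl⟩
    | cons b l =>
      rw [List.isChain_cons_cons] at hl
      obtain ⟨p, hp⟩ := ih (s := b) hl.2 (by simp) (by simpa [List.getLast?_cons_cons] using ht)
      exact ⟨.cons hl.1 p, by simp [hp]⟩


namespace SemiHypercube

variable {k d : ℕ} {τ : ℝ} {V : Finset (Fin d → Fin k)} {G : SimpleGraph V}
  {nb : (Fin d → Fin k) → Fin d → Fin k → (Fin d → Fin k)}

/-! ### Codes of moves -/

theorem moveCode_bounds {l : ℕ} (hl : l < 2 * d) (x : Fin k) :
    5 + d ≤ moveCode k d l x ∧ moveCode k d l x < 5 + d + 2 * d * k := by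
  have h1 : (l + 1) * k ≤ 2 * d * k := Nat.mul_le_mul_right _ hl
  have h2 := x.2
  rw [add_mul, one_mul] at h1
  unfold moveCode
  omega

theorem inr_mem_entries {v : Fin d → Fin k} {i : ℕ} (h : Sum.inr i ∈ entries τ V v) : i < d := by
  classical
  rw [entries, List.mem_append] at h
  rcases h with h | h
  · simp at h
  · split_ifs at h
    · rw [List.mem_map] at h
      obtain ⟨j, hj, hji⟩ := h
      rw [List.mem_range] at hj
      rw [Sum.inr.injEq] at hji
      omega
    · simp at h

variable (H : Cube τ V G nb)
include H

theorem Cube.inl_mem_entries {v : V} {l : List ℕ} (h : Sum.inl l ∈ entries τ V v.1) :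
    ∃ (T : Finset (Fin k)) (lev : ℕ), lev < 2 * d ∧ l = T.toList.map (moveCode k d lev) := by
  classical
  rw [entries, List.mem_append] at h
  rcases h with h | h
  · rw [List.mem_map] at h
    obtain ⟨l', hl', heq⟩ := h
    rw [Sum.inl.injEq] at heq
    subst heq
    rw [upScript, List.mem_map] at hl'
    obtain ⟨i, hi, rfl⟩ := hl'
    rw [List.mem_range] at hi
    rw [digitCodes, dif_pos (by omega)]
    exact ⟨_, _, by omega, rfl⟩
  · split_ifs at h with hf
    · simp at h
    · rw [List.mem_singleton, Sum.inl.injEq] at h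
      subst h
      have := H.hopLevel_lt hf
      rw [H.hopCodes_eq hf]
      exact ⟨_, _, by omega, rfl⟩

theorem Cube.code_bounds (v r : V) : ∀ l ∈ (scheme τ V nb).script v r, ∀ c ∈ l,
    5 + d ≤ c ∧ c < 5 + d + 2 * d * k := by
  intro l hl c hc
  simp only [scheme, List.mem_map] at hl
  obtain ⟨e, he, rfl⟩ := hl
  cases e with
  | inl l =>
    obtain ⟨T, lev, hlev, rfl⟩ := H.inl_mem_entries he
    simp only [Sum.elim_inl, id, List.mem_map] at hc
    obtain ⟨x, -, rfl⟩ := hc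
    exact moveCode_bounds hlev x
  | inr i =>
    have hi := inr_mem_entries he
    simp only [Sum.elim_inr, List.mem_singleton] at hc
    rw [hc, goalCode, dif_pos hi]
    exact moveCode_bounds (by omega) _

theorem Cube.length_le_of_inl_mem_entries {v : V} {l : List ℕ} (h : Sum.inl l ∈ entries τ V v.1) :
    l.length ≤ k := by
  obtain ⟨T, lev, -, rfl⟩ := H.inl_mem_entries h
  simpa using Finset.card_le_univ T

theorem Cube.move_adj {y z : V} {c : ℕ} (h : (scheme τ V nb).move y c = some z) :
    y = z ∨ G.Adj y z := by
  have h' : codeMove τ V nb y c = some z := h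
  unfold codeMove at h'
  split_ifs at h' with h1 h2
  · exact H.adj_nb _ _ _ _ (digitMove_eq_some.1 h')
  · exact H.adj_nb _ _ _ _ (hopMove_eq_some.1 h').1

theorem Cube.endpoint_eq {v r : V} (hv : Final τ V v.1) (hr : Final τ V r.1)
    {tr : List (Option V)} (htr : tr ∈ ((scheme τ V nb).trial v r).support)
    (hs : tr ∈ Scheme.succ v) : Scheme.endpoint v tr = r := by
  have h := endpoint_mem htr hs
  have hlt := H.top_lt v
  rw [H.endLaw_script_final hv] at h
  have := (H.goalLaw_spec hv hr (d - (top τ V + 1)) (by omega)).2.1 _ h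
  exact Subtype.ext (this.eq (by omega))

theorem Cube.degree_le (v : V) [Fintype (G.neighborSet v)] : G.degree v ≤ k * d := by
  classical
  have hsub : G.neighborFinset v ⊆ (Finset.univ : Finset (Fin d × Fin k)).image fun e =>
      if h : nb v.1 e.1 e.2 ∈ V then ⟨nb v.1 e.1 e.2, h⟩ else v := by
    intro z hz
    rw [SimpleGraph.mem_neighborFinset] at hz
    obtain ⟨l, x, hx⟩ := H.exists_nb v z hz
    rw [Finset.mem_image]
    refine ⟨(l, x), Finset.mem_univ _, ?_⟩
    rw [dif_pos (by rw [hx]; exact z.2)]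
    exact Subtype.ext hx
  rw [← SimpleGraph.card_neighborFinset_eq_degree]
  refine (Finset.card_le_card hsub).trans (Finset.card_image_le.trans (le_of_eq ?_))
  rw [Finset.card_univ, Fintype.card_prod, Fintype.card_fin, Fintype.card_fin, mul_comm]

/-! ### The routing -/

theorem Cube.coreSet_nonempty [Nonempty V] : (coreSet τ V).Nonempty := by
  have h1 := H.card_le_coreSet
  have h2 : 0 < Fintype.card V := Fintype.card_pos
  exact Finset.card_pos.1 (by omega)

theorem Cube.exists_path [DecidableEq V] {s t : V} {x : List V}
    (hx : x ∈ ((scheme τ V nb).walkLaw (coreSet τ V).toList (d ^ 2 + 1) s t).support) :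
    (∃ p : G.Path s t, (p : G.Walk s t).support = eraseLoops x) ∧ x.length ≤ 10 * d ^ 3 := by
  have : Nonempty V := ⟨s⟩
  obtain ⟨h1, h2, h3, h4⟩ := H.efficient.chain_of_mem_walkLaw (R := fun y z => y = z ∨ G.Adj y z)
    (fun y c z h => H.move_adj h) (fun y => Or.inl rfl)
    (fun y z h => h.imp Eq.symm SimpleGraph.Adj.symm)
    (by simpa using H.coreSet_nonempty.ne_empty)
    (fun r hr => (scheme_final r).2 (mem_coreSet.1 (Finset.mem_toList.1 hr)))
    (fun v r hv hr tr htr hs =>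
      H.endpoint_eq ((scheme_final v).1 hv) ((scheme_final r).1 hr) htr hs)
    (n := d ^ 2 + 1) (fun v => Nat.lt_succ_of_le (rank_le v.1)) hx
  refine ⟨SimpleGraph.exists_path_support_eq (isChain_eraseLoops x h1) (nodup_eraseLoops x)
    (by rw [head?_eraseLoops, h2]) (by rw [getLast?_eraseLoops, h3]), h4.trans ?_⟩
  have h5 : d ≤ d ^ 3 := Nat.le_self_pow (by norm_num) d
  have h6 := H.d_pos
  calc 2 * ((d ^ 2 + 1) * (2 * d) + 1) = 4 * d ^ 3 + 4 * d + 2 := by ring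
    _ ≤ 10 * d ^ 3 := by omega

/-- Outside the support of the walk law any path serves as the value. -/
theorem Cube.exists_routing [DecidableEq V] :
    ∃ f : ∀ s t : V, List V → G.Path s t,
      ∀ s t, ∀ x ∈ ((scheme τ V nb).walkLaw (coreSet τ V).toList (d ^ 2 + 1) s t).support,
        (f s t x : G.Walk s t).support = eraseLoops x := by
  have hf : ∀ s t x, ∃ p : G.Path s t,
      x ∈ ((scheme τ V nb).walkLaw (coreSet τ V).toList (d ^ 2 + 1) s t).support →
        (p : G.Walk s t).support = eraseLoops x := by
    intro s t x
    by_cases hx : x ∈ ((scheme τ V nb).walkLaw (coreSet τ V).toList (d ^ 2 + 1) s t).support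
    · obtain ⟨p, hp⟩ := (H.exists_path hx).1
      exact ⟨p, fun _ => hp⟩
    · obtain ⟨x₀, hx₀⟩ :=
        ((scheme τ V nb).walkLaw (coreSet τ V).toList (d ^ 2 + 1) s t).support_nonempty
      obtain ⟨p, -⟩ := (H.exists_path hx₀).1
      exact ⟨p, fun h => absurd h hx⟩
  choose f hf using hf
  exact ⟨f, hf⟩

section Routing

variable [DecidableEq V] {f : ∀ s t : V, List V → G.Path s t}
  (hf : ∀ s t, ∀ x ∈ ((scheme τ V nb).walkLaw (coreSet τ V).toList (d ^ 2 + 1) s t).support,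
    (f s t x : G.Walk s t).support = eraseLoops x)
include hf

theorem Cube.hasLength : Routing.HasLength (fun s t =>
    ((scheme τ V nb).walkLaw (coreSet τ V).toList (d ^ 2 + 1) s t).map (f s t)) (10 * d ^ 3) := by
  intro s t p hp
  rw [PMF.mem_support_map_iff] at hp
  obtain ⟨x, hx, rfl⟩ := hp
  have h1 := congrArg List.length (hf s t x hx)
  rw [SimpleGraph.Walk.length_support] at h1
  have h2 := length_eraseLoops_le x
  have h3 := (H.exists_path hx).2
  omega

-- A path through an edge visits one fixed end of it, and loop erasure adds no visits. Degrees are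
-- at most kd, so K = kd, and d · 5^d ≤ 2^d · 5^d.
open scoped Classical in
theorem Cube.congestion_le {D : V → V → ℝ≥0} (hD : Routing.IsUnitDemand G D) :
    Routing.congestion (fun s t =>
      ((scheme τ V nb).walkLaw (coreSet τ V).toList (d ^ 2 + 1) s t).map (f s t)) D ≤
      ((15 * (k * d * 10 ^ d) : ℕ) : ℝ≥0∞) := by
  refine iSup₂_le fun e he => ?_
  induction e using Sym2.ind with
  | _ a b =>
    have hload : ∀ s, (Routing.load D s : ℝ≥0∞) ≤ ((k * d : ℕ) : ℝ≥0∞) := by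
      intro s
      have h1 := (hD s).trans (Nat.cast_le.2 (H.degree_le s))
      exact_mod_cast ENNReal.coe_le_coe.2 h1
    refine le_trans ?_ ((H.sum_walkLaw_occ_le hload (d ^ 2 + 1) a).trans ?_)
    · refine Finset.sum_le_sum fun s _ => Finset.sum_le_sum fun t _ => mul_le_mul_right ?_ _
      rw [PMF.toOuterMeasure_map_apply, PMF.toOuterMeasure_eq_expect]
      refine PMF.expect_mono fun x hx => ?_
      by_cases hxe : x ∈ (f s t) ⁻¹' {p : G.Path s t | s(a, b) ∈ (p : G.Walk s t).edges}
      · rw [Set.indicator_of_mem hxe]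
        have h1 := SimpleGraph.Walk.fst_mem_support_of_mem_edges _ hxe
        rw [hf s t x hx] at h1
        exact Scheme.one_le_occ (eraseLoops_subset x h1)
      · rw [Set.indicator_of_notMem hxe]
        exact zero_le
    · have h1 : d * 5 ^ d ≤ 10 ^ d := by
        calc d * 5 ^ d ≤ 2 ^ d * 5 ^ d := Nat.mul_le_mul_right _ Nat.lt_two_pow_self.le
          _ = 10 ^ d := (mul_pow 2 5 d).symm
      have h2 : k * d + 14 * d * (k * d * 5 ^ d) ≤ 15 * (k * d * 10 ^ d) := by
        have h3 : 1 ≤ 10 ^ d := Nat.one_le_pow _ _ (by norm_num)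
        calc k * d + 14 * d * (k * d * 5 ^ d) = k * d * 1 + 14 * (k * d * (d * 5 ^ d)) := by ring
          _ ≤ k * d * 10 ^ d + 14 * (k * d * 10 ^ d) := by gcongr
          _ = _ := by ring
      exact_mod_cast h2

theorem Cube.samples [Nonempty V] (num : V ≃ Fin (Fintype.card V)) {w : ℕ}
    (hw : WordRAM.storeSize V d (2 * d * k) (2 * d) k + 3 * ((d ^ 2 + 1) * (2 * d) + 2) < 2 ^ w) :
    ∃ data : List ℕ, data.length = WordRAM.storeSize V d (2 * d * k) (2 * d) k ∧
      (∀ x ∈ data, x < 2 ^ w) ∧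
      WordRAM.Samples WordRAM.sampler w data num (fun s t =>
        ((scheme τ V nb).walkLaw (coreSet τ V).toList (d ^ 2 + 1) s t).map (f s t))
        ((1300 * d ^ 3 : ℕ) : ℝ≥0∞) := by
  obtain ⟨data, h1, h2, ⟨A, D, h3⟩, h4, h5⟩ := WordRAM.exists_layout (scheme τ V nb) num
    (coreSet τ V).toList (fun v => entries τ V v.1) (fun r => goalCode r.1) d (2 * d * k) (2 * d) k
    (d ^ 2 + 1) w (fun v r => rfl) (fun v => length_entries_le v.1 H.d_pos) H.code_bounds
    (fun v l => H.length_le_of_inl_mem_entries) (fun v i => inr_mem_entries)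
    (by rw [Finset.length_toList]; exact Finset.card_le_univ _) hw
  refine ⟨data, h1, h2, fun s t => ?_⟩
  have h6 : 6 ≤ WordRAM.storeSize V d (2 * d * k) (2 * d) k := by
    unfold WordRAM.storeSize
    omega
  have hspec := fun N => WordRAM.spec_sampler (N := N) h3 H.efficient
    (by simpa using H.coreSet_nonempty.ne_empty)
    (fun r hr => (scheme_final r).2 (mem_coreSet.1 (Finset.mem_toList.1 hr))) (d ^ 2 + 1)
    (fun v => Nat.lt_succ_of_le (rank_le v.1)) (by omega) (le_of_eq h4.symm)
    (by simp only [h4, h5]; exact le_rfl) (by simp only [h5]; omega) s t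
    (WordRAM.init WordRAM.sampler data (num s) (num t)).reg rfl rfl rfl
  constructor
  · intro p
    set μ := ((scheme τ V nb).walkLaw (coreSet τ V).toList (d ^ 2 + 1) s t).map
      fun x => (eraseLoops x).map fun v => (num v : ℕ) with hμ
    -- For the output any truncation of the time serves, here 0; the expected time needs all of
    -- them.
    have hout := WordRAM.outputProb_eq_of_spec (μ := μ) ((hspec 0).weaken (fun l => by
      rw [PMF.apply_eq_expect, hμ, PMF.expect_map]
      exact PMF.expect_mono fun x _ => le_of_eq (if_congr eq_comm rfl rfl)) le_rfl)
      ((p : G.Walk s t).support.map fun v => (num v : ℕ))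
    refine hout.trans ?_
    classical
    rw [PMF.apply_eq_expect, PMF.apply_eq_expect (PMF.map (f s t) _), hμ, PMF.expect_map,
      PMF.expect_map]
    refine PMF.expect_congr fun x hx => ?_
    rw [← hf s t x hx]
    refine if_congr ?_ rfl rfl
    have hinj : Function.Injective fun v : V => (num v : ℕ) :=
      fun u v h => num.injective (Fin.ext h)
    rw [hinj.list_map.eq_iff]
    exact ⟨fun h => Subtype.ext (SimpleGraph.Walk.ext_support h), fun h => by rw [h]⟩
  · refine (WordRAM.expectedTime_le_of_spec hspec).trans ?_
    rw [Nat.cast_zero, add_zero]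
    refine Nat.cast_le.2 ?_
    have h7 : d ≤ d ^ 3 := Nat.le_self_pow (by norm_num) d
    have h8 : d ^ 2 ≤ d ^ 3 := Nat.pow_le_pow_right H.d_pos (by norm_num)
    have h9 := H.d_pos
    calc _ = 376 * d ^ 3 + 160 * d ^ 2 + 376 * d + 380 := by ring
      -- The coefficients add up to 1292; this is the source of the final constant 1300.
      _ ≤ 1300 * d ^ 3 := by omega

end Routing

theorem Cube.le_k' : 54 ≤ k := by
  have h1 := H.le_k
  have h2 : 2 ^ 1 ≤ 2 ^ d := Nat.pow_le_pow_right (by norm_num) H.d_pos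
  omega

theorem Cube.storeSize_le [Nonempty V] :
    WordRAM.storeSize V d (2 * d * k) (2 * d) k ≤ 11 * (k * d * V.card) := by
  have hd := H.d_pos
  have hk := H.le_k'
  have hn : 1 ≤ V.card := by
    rw [← Fintype.card_coe]
    exact Fintype.card_pos
  unfold WordRAM.storeSize WordRAM.recSize
  rw [Fintype.card_coe]
  have h1 : 54 * d ≤ k * d := Nat.mul_le_mul_right _ hk
  have h2 : 54 * V.card ≤ k * d * V.card := Nat.mul_le_mul_right _ (by omega)
  have h3 : 5 + d + 2 * d * k + 3 * (2 * d) + k * (2 * d) ≤ 5 * (k * d) := by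
    calc 5 + d + 2 * d * k + 3 * (2 * d) + k * (2 * d) = 5 + 7 * d + 4 * (k * d) := by ring
      _ ≤ _ := by omega
  have h4 : (5 + d + 2 * d * k + 3 * (2 * d) + k * (2 * d)) * (V.card + 1) ≤
      5 * (k * d) * (2 * V.card) := Nat.mul_le_mul h3 (by omega)
  have h5 : 5 * (k * d) * (2 * V.card) = 10 * (k * d * V.card) := by ring
  omega

/-- The addresses must also cover the buffers for walks of O(d³) vertices. As d is at most x =
kd|V|, the fourth power of x is enough, hence `4 ≤ c`. -/
theorem Cube.storeSize_lt [Nonempty V] {c : ℕ} (hc : 4 ≤ c) :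
    WordRAM.storeSize V d (2 * d * k) (2 * d) k + 3 * ((d ^ 2 + 1) * (2 * d) + 2) <
      2 ^ (c * Nat.size (k * d * V.card)) := by
  have hd := H.d_pos
  have h0 := H.storeSize_le
  have hk := H.le_k'
  have hn : 1 ≤ V.card := by
    rw [← Fintype.card_coe]
    exact Fintype.card_pos
  set x := k * d * V.card with hx
  have h1 : 54 * d ≤ x := by
    calc 54 * d ≤ k * d * 1 := by rw [mul_one]; exact Nat.mul_le_mul_right _ hk
      _ ≤ x := Nat.mul_le_mul_left _ hn
  have h2 : d ^ 3 ≤ x ^ 3 := Nat.pow_le_pow_left (by omega) _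
  have h4 : 3 * ((d ^ 2 + 1) * (2 * d) + 2) ≤ 18 * d ^ 3 := by
    have h5 : d ≤ d ^ 3 := Nat.le_self_pow (by norm_num) d
    calc 3 * ((d ^ 2 + 1) * (2 * d) + 2) = 6 * d ^ 3 + 6 * d + 6 := by ring
      _ ≤ _ := by omega
  have h5 : x ≤ x ^ 3 := Nat.le_self_pow (by norm_num) x
  have h6 : 54 * x ^ 3 ≤ x ^ 4 := by
    rw [pow_succ x 3, mul_comm]
    exact Nat.mul_le_mul_left _ (by omega)
  have h7 : x ^ 4 ≤ 2 ^ (c * Nat.size x) := by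
    calc x ^ 4 ≤ (2 ^ Nat.size x) ^ 4 := Nat.pow_le_pow_left (Nat.lt_size_self x).le 4
      _ = 2 ^ (4 * Nat.size x) := by rw [← pow_mul, mul_comm]
      _ ≤ _ := Nat.pow_le_pow_right (by norm_num) (Nat.mul_le_mul_right _ hc)
  omega

end SemiHypercube


theorem mainTheorem4 :
    ∃ (C : ℕ) (P : WordRAM.Prog),
      ∀ (k d : ℕ) (τ : ℝ) (V : Finset (Fin d → Fin k)) (G : SimpleGraph V),
        SemiHypercube.IsSemiHypercube τ V G → τ ≤ 1 / (27 * (d : ℝ)) → 27 * 2 ^ d ≤ k →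
        ∃ R : Routing.Oblivious G,
          Routing.HasLength R (C * d ^ 3) ∧
          (∀ D : V → V → ℝ≥0, Routing.IsUnitDemand G D →
            Routing.congestion R D ≤ ((C * (k * d * 10 ^ d) : ℕ) : ℝ≥0∞)) ∧
          (∀ num : V ≃ Fin (Fintype.card V),
            ∃ data : List ℕ,
              data.length ≤ C * (k * d * V.card) ∧
              (∀ x ∈ data, x < 2 ^ (C * Nat.size (k * d * V.card))) ∧
              WordRAM.Samples P (C * Nat.size (k * d * V.card)) data num R
                ((C * d ^ 3 : ℕ) : ℝ≥0∞)) := by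
  classical
  refine ⟨1300, WordRAM.sampler, fun k d τ V G hG hτ hk => ?_⟩
  obtain ⟨nb, H⟩ := hG.exists_cube hτ hk
  obtain ⟨f, hf⟩ := H.exists_routing
  refine ⟨fun s t =>
    ((SemiHypercube.scheme τ V nb).walkLaw (SemiHypercube.coreSet τ V).toList (d ^ 2 + 1) s t).map
      (f s t), fun s t p hp => ?_, fun D hD => ?_, fun num => ?_⟩
  · exact (H.hasLength hf s t p hp).trans (Nat.mul_le_mul_right _ (by norm_num))
  · exact (H.congestion_le hf hD).trans (Nat.cast_le.2 (Nat.mul_le_mul_right _ (by norm_num)))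
  · rcases isEmpty_or_nonempty V with hV | hV
    -- The sampler needs a nonempty core, but without vertices there are no queries.
    · exact ⟨[], by simp, by simp, fun s => isEmptyElim s⟩
    · obtain ⟨data, h1, h2, h3⟩ := H.samples hf num (H.storeSize_lt (c := 1300) (by norm_num))
      exact ⟨data, h1.le.trans (H.storeSize_le.trans (Nat.mul_le_mul_right _ (by norm_num))), h2, h3⟩
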